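/- **Null-access theorem.** Let $\omega_{IJ}$ be the metric of the unit sphere $S^2$ and consider, on the region $u\in\mathbb R$, $r>R$ $(R>0)$, $x\in S^2$, a Lorentzian metric $g$ of class $C^{1,1}$ in Bondi form, $g_{rr}=g_{rI}=0$, with $g_{ur}<0$, $g_{IJ}$ positive definite, and $$g_{uu}=-1+\frac mr+O(r^{-2}),\quad g_{ur}=-1+O(r^{-2}),\quad g_{IJ}=\omega_{IJ}r^2+h^{(1)}_{IJ}r+O(1),\quad g_{uI}=O(1),$$ in the gauge $\det(g_{IJ})=\det(r^2\omega_{IJ})$. Here $m(u,x)$ and $h^{(1)}_{IJ}(u,x)$ are of class $C^1$ and bounded together with their first derivatives, and $f=O(r^{-n})$ means that $f$, $\partial_uf$, $\partial_{x^I}f$ are bounded by a constant times $r^{-n}$ and $\partial_rf$ by a constant times $r^{-n-1}$ for $r>R$, uniformly in $u$ and $x$ (angular components and derivatives taken in two stereographic charts, on the closed unit discs, which cover $S^2$). Let $C$ be a common bound for all these quantities. For a nonzero vector $k$ tangent to $S^2$ at $x$ put $$\Omega(u,x;k)=\frac{\Omega_{IJ}k^Ik^J}{\omega_{IJ}k^Ik^J},\qquad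 \Omega_{IJ}=\omega_{IJ}-\tfrac12\,\partial_uh^{(1)}_{IJ}+\tfrac12\,\partial_um\;\omega_{IJ},$$ and let $\Omega_i$ be the infimum of $\Omega$ over all $u$, $x$, $k$. Put $\beta_{\rm crit}=\frac{-3+\sqrt{9-6\Omega_i}}3$ if $\Omega_i>0$, and let $\beta_{\rm crit}$ be an arbitrary positive constant if $\Omega_i\le0$. Then for every $K$ there is a number $r_*$, depending only on $R$, $C$, $K$, $\Omega_i$ and $\beta_{\rm crit}$, such that the following holds. Let $\gamma$ be an affinely parametrized, future-directed and future-inextendible null geodesic of $g$ in $\{r>R\}$ through a point $p$ with $r(p)=r_0\ge r_*$, with $du>0$ along the tangent at $p$, and suppose that $$0<\Bigl(\frac{dr}{du}\Big|_p-\beta_{\rm crit}\Bigr)^{-1}\le K .$$ Then, to the future of $p$, $\gamma$ reaches future null infinity: $u$ stays bounded along $\gamma$, and $r\to\infty$ at the future end of $\gamma$. (Neither $\partial_um\le0$ nor positive definiteness of $\Omega_{IJ}$ is assumed.) -/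

import Mathlib

noncomputable section

namespace NullAccess

/-- Euclidean three-space. The sphere of angular directions is its unit sphere `S²`, and the tangent
space of `S²` at `x` is the set of all vectors orthogonal to `x`. -/
abbrev E3 : Type := EuclideanSpace ℝ (Fin 3)

/-! ### The angular coordinates `x^I`: two stereographic charts covering `S²` -/

/-- The sign attached to a stereographic chart: chart `s` misses exactly the pole
`(0, 0, poleSign s)`. -/
def poleSign (s : Bool) : ℝ := if s then 1 else -1

/-- Inverse stereographic projection: the point of `S²` with angular coordinates `y`. -/
def stereo (s : Bool) (y : Fin 2 → ℝ) : E3 :=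
  !₂[2 * y 0 / (1 + y 0 ^ 2 + y 1 ^ 2),
     2 * y 1 / (1 + y 0 ^ 2 + y 1 ^ 2),
     poleSign s * (y 0 ^ 2 + y 1 ^ 2 - 1) / (1 + y 0 ^ 2 + y 1 ^ 2)]

/-- The domain of chart `s` on `S²`: everything but one pole. -/
def InChart (s : Bool) (x : E3) : Prop := x 2 ≠ poleSign s

/-- Stereographic projection: the angular coordinates of a point of `S²` other than the pole. -/
def angularCoord (s : Bool) (x : E3) : Fin 2 → ℝ :=
  ![x 0 / (1 - poleSign s * x 2), x 1 / (1 - poleSign s * x 2)]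

/-- The coordinate vector field `∂/∂x^I` of chart `s`, as a vector tangent to `S²`. -/
def frame (s : Bool) (y : Fin 2 → ℝ) (I : Fin 2) : E3 :=
  fderiv ℝ (stereo s) y (Pi.single I 1)

/-- The components `ω_{IJ}` of the metric of the unit sphere. -/
def roundMetric (s : Bool) (y : Fin 2 → ℝ) : Matrix (Fin 2) (Fin 2) ℝ :=
  Matrix.of fun I J => inner ℝ (frame s y I) (frame s y J)

/-! ### Bondi coordinates `X = (u, r, x^2, x^3)` -/

/-- The angular part of a coordinate quadruple. -/
def ang (X : Fin 4 → ℝ) : Fin 2 → ℝ := ![X 2, X 3]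

/-- The partial derivative `∂f/∂X^μ`. -/
def pd (μ : Fin 4) (f : (Fin 4 → ℝ) → ℝ) (X : Fin 4 → ℝ) : ℝ :=
  fderiv ℝ f X (Pi.single μ 1)

/-- The coordinate region `r > R`. -/
def region (R : ℝ) : Set (Fin 4 → ℝ) := {X | R < X 1}

/-- Class `C^{1,1}` on an open set: `C^1` with locally Lipschitz derivative. -/
def C11On (f : (Fin 4 → ℝ) → ℝ) (U : Set (Fin 4 → ℝ)) : Prop :=
  ContDiffOn ℝ 1 f U ∧ LocallyLipschitzOn U (fderiv ℝ f)

/-- `f = O(r^{-n})` for `r > R` with constant `C`, in the sense of expansions in powers of `r`: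
the derivatives along `u` and `x^I` are again `O(r^{-n})`, the derivative along `r` is
`O(r^{-n-1})`. The bounds are uniform in `u` and in the angles; as the closed unit discs of the two
charts cover `S²`, it is enough to impose them there. -/
def OrderBound (R C : ℝ) (n : ℕ) (f : (Fin 4 → ℝ) → ℝ) : Prop :=
  ∀ X : Fin 4 → ℝ, R < X 1 → X 2 ^ 2 + X 3 ^ 2 ≤ 1 →
    |f X| ≤ C / X 1 ^ n ∧ |pd 1 f X| ≤ C / X 1 ^ (n + 1) ∧
      ∀ μ : Fin 4, μ ≠ 1 → |pd μ f X| ≤ C / X 1 ^ n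

/-! ### Metrics in Bondi form -/

/-- The components of a metric in Bondi form as functions of `(u, r, x)` with `x ∈ S²`; `g_{rr}` and
`g_{rI}` vanish. The angular parts are a covector and a bilinear form on the tangent space of `S²`
at `x`: they are given on the ambient space, but only their values on tangent vectors are ever
used. -/
structure BondiMetric where
  guu : ℝ → ℝ → E3 → ℝ
  gur : ℝ → ℝ → E3 → ℝ
  guA : ℝ → ℝ → E3 → E3 →L[ℝ] ℝ
  gAB : ℝ → ℝ → E3 → E3 →L[ℝ] E3 →L[ℝ] ℝ

namespace BondiMetric

/-- The metric `g(V, W)` at `(u, r, x)`; a tangent vector is a triple `(V^u, V^r, ξ)` with `ξ` tangent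
to `S²` at `x`. -/
def form (g : BondiMetric) (u r : ℝ) (x : E3) (V W : ℝ × ℝ × E3) : ℝ :=
  g.guu u r x * (V.1 * W.1) + g.gur u r x * (V.1 * W.2.1 + V.2.1 * W.1)
    + (V.1 * g.guA u r x W.2.2 + W.1 * g.guA u r x V.2.2) + g.gAB u r x V.2.2 W.2.2

end BondiMetric

/-- The coordinate basis `∂_u, ∂_r, ∂_2, ∂_3` in chart `s`. -/
def basisVec (s : Bool) (y : Fin 2 → ℝ) : Fin 4 → ℝ × ℝ × E3 :=
  ![(1, 0, 0), (0, 1, 0), (0, 0, frame s y 0), (0, 0, frame s y 1)]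

namespace BondiMetric

/-- The matrix `g_{μν}` of the metric in the coordinates of chart `s`. -/
def comp (g : BondiMetric) (s : Bool) (X : Fin 4 → ℝ) : Matrix (Fin 4) (Fin 4) ℝ :=
  Matrix.of fun μ ν => g.form (X 0) (X 1) (stereo s (ang X))
    (basisVec s (ang X) μ) (basisVec s (ang X) ν)

/-- The angular block `g_{IJ}`. -/
def angularBlock (g : BondiMetric) (s : Bool) (X : Fin 4 → ℝ) : Matrix (Fin 2) (Fin 2) ℝ :=
  Matrix.of fun I J => g.gAB (X 0) (X 1) (stereo s (ang X)) (frame s (ang X) I) (frame s (ang X) J)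

/-- The Christoffel symbol
`Γ^μ_{αβ} = ½ g^{μν} (∂_α g_{νβ} + ∂_β g_{να} - ∂_ν g_{αβ})` in chart `s`. -/
def christoffel (g : BondiMetric) (s : Bool) (X : Fin 4 → ℝ) (μ α β : Fin 4) : ℝ :=
  (1 / 2) * ∑ ν, (g.comp s X)⁻¹ μ ν *
    (pd α (fun Y => g.comp s Y ν β) X + pd β (fun Y => g.comp s Y ν α) X
      - pd ν (fun Y => g.comp s Y α β) X)

end BondiMetric

/-! ### Asymptotic flatness -/

/-- `g` is a Lorentzian metric of class `C^{1,1}` on `{r > R}`, in Bondi form, and for `r → ∞`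
`g_{uu} = -1 + m r⁻¹ + O(r⁻²)`, `g_{ur} = -1 + O(r⁻²)`, `g_{uI} = O(1)`,
`g_{IJ} = ω_{IJ} r² + h_{IJ} r + O(1)`.
The coefficients `m(u, x)` and `h_{IJ}(u, x)` (the `h^{(1)}_{IJ}` of the expansion) are of class `C^1`;
`C` bounds them, their first derivatives and all the remainders. -/
structure AsymptoticallyFlat (R C : ℝ) (g : BondiMetric) (m : ℝ → E3 → ℝ)
    (h : ℝ → E3 → E3 →L[ℝ] E3 →L[ℝ] ℝ) : Prop where
  angular_pos : ∀ s, ∀ X ∈ region R, (g.angularBlock s X).PosDef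
  gur_neg : ∀ s, ∀ X ∈ region R, g.comp s X 0 1 < 0
  regular : ∀ s μ ν, C11On (fun X => g.comp s X μ ν) (region R)
  m_regular : ∀ s, ContDiff ℝ 1 (fun X : Fin 4 → ℝ => m (X 0) (stereo s (ang X)))
  h_regular : ∀ s I J, ContDiff ℝ 1 (fun X : Fin 4 → ℝ =>
    h (X 0) (stereo s (ang X)) (frame s (ang X) I) (frame s (ang X) J))
  m_bound : ∀ s, OrderBound R C 0 (fun X => m (X 0) (stereo s (ang X)))
  h_bound : ∀ s I J, OrderBound R C 0 (fun X =>
    h (X 0) (stereo s (ang X)) (frame s (ang X) I) (frame s (ang X) J))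
  guu_expansion : ∀ s, OrderBound R C 2 (fun X =>
    g.comp s X 0 0 - (-1 + m (X 0) (stereo s (ang X)) / X 1))
  gur_expansion : ∀ s, OrderBound R C 2 (fun X => g.comp s X 0 1 - (-1))
  guI_expansion : ∀ s (I : Fin 2), OrderBound R C 0 (fun X =>
    g.guA (X 0) (X 1) (stereo s (ang X)) (frame s (ang X) I))
  gIJ_expansion : ∀ s I J, OrderBound R C 0 (fun X =>
    g.angularBlock s X I J - (roundMetric s (ang X) I J * X 1 ^ 2
      + h (X 0) (stereo s (ang X)) (frame s (ang X) I) (frame s (ang X) J) * X 1))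

/-- The gauge condition `det g_{IJ} = det (r² ω_{IJ})`. -/
def BondiGauge (R : ℝ) (g : BondiMetric) : Prop :=
  ∀ s, ∀ X ∈ region R,
    (g.angularBlock s X).det = ((X 1 ^ 2) • roundMetric s (ang X)).det

/-! ### The function `Ω` -/

/-- The value `α_{KL} e^K e^L` of an angular tensor in the direction of `k ≠ 0`, where `e = k / |k|`. -/
def inDirection (α : E3 → E3 → ℝ) (k : E3) : ℝ := α k k / ‖k‖ ^ 2

/-- The tensor `Ω_{IJ} = ω_{IJ} - ½ ∂_u h_{IJ} + ½ ∂_u m ω_{IJ}` at `(u, x)`. -/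
def omegaTensor (m : ℝ → E3 → ℝ) (h : ℝ → E3 → E3 →L[ℝ] E3 →L[ℝ] ℝ) (u : ℝ) (x k l : E3) : ℝ :=
  inner ℝ k l - (1 / 2) * deriv (fun t => h t x k l) u
    + (1 / 2) * deriv (fun t => m t x) u * inner ℝ k l

/-- All values of the function `Ω`: `(u, x) ∈ ℝ × S²`, and all directions tangent to `S²` at `x`. -/
def omegaValues (m : ℝ → E3 → ℝ) (h : ℝ → E3 → E3 →L[ℝ] E3 →L[ℝ] ℝ) : Set ℝ :=
  {w | ∃ (u : ℝ) (x k : E3), ‖x‖ = 1 ∧ inner ℝ x k = 0 ∧ k ≠ 0 ∧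
    w = inDirection (omegaTensor m h u x) k}

/-- `β` is an admissible value of `β_crit`, given the infimum `Ωi` of `Ω`. -/
def IsBetaCrit (Ωi β : ℝ) : Prop :=
  (0 < Ωi → β = (-3 + Real.sqrt (9 - 6 * Ωi)) / 3) ∧ (Ωi ≤ 0 → 0 < β)

/-! ### Null geodesics -/

/-- A parametrized curve `(u, r, x)`; only its values on an interval of parameters are used. -/
structure Curve where
  u : ℝ → ℝ
  r : ℝ → ℝ
  x : ℝ → E3

namespace Curve

/-- The Bondi coordinates of a curve in chart `s`. -/
def coord (c : Curve) (s : Bool) (μ : Fin 4) (t : ℝ) : ℝ :=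
  (![c.u t, c.r t, angularCoord s (c.x t) 0, angularCoord s (c.x t) 1] : Fin 4 → ℝ) μ

/-- The velocity of a curve. -/
def velocity (c : Curve) (t : ℝ) : ℝ × ℝ × E3 := (deriv c.u t, deriv c.r t, deriv c.x t)

end Curve

/-- `c` is, on the open interval `J`, an affinely parametrized null geodesic of `g` in `{r > R}`: the
geodesic equation holds in each of the two charts, wherever the curve is in its domain. -/
structure IsNullGeodesic (R : ℝ) (g : BondiMetric) (c : Curve) (J : Set ℝ) : Prop where
  isOpen : IsOpen J
  ordConnected : J.OrdConnected
  u_regular : ContDiffOn ℝ 2 c.u J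
  r_regular : ContDiffOn ℝ 2 c.r J
  x_regular : ContDiffOn ℝ 2 c.x J
  mem_region : ∀ t ∈ J, R < c.r t
  mem_sphere : ∀ t ∈ J, ‖c.x t‖ = 1
  null : ∀ t ∈ J, g.form (c.u t) (c.r t) (c.x t) (c.velocity t) (c.velocity t) = 0
  geodesic : ∀ t ∈ J, ∀ s, InChart s (c.x t) → ∀ μ : Fin 4,
    deriv (deriv (c.coord s μ)) t =
      - ∑ α, ∑ β, g.christoffel s (fun ν => c.coord s ν t) μ α β
          * deriv (c.coord s α) t * deriv (c.coord s β) t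

/-- `c` on `J` cannot be continued to the future: no null geodesic agrees with it on `J` and is defined
at a parameter beyond all of `J`. -/
def FutureInextendible (R : ℝ) (g : BondiMetric) (c : Curve) (J : Set ℝ) : Prop :=
  ∀ (c' : Curve) (J' : Set ℝ), IsNullGeodesic R g c' J' → J ⊆ J' →
    Set.EqOn c.u c'.u J → Set.EqOn c.r c'.r J → Set.EqOn c.x c'.x J →
    ¬ ∃ b ∈ J', ∀ t ∈ J, t < b

/-- The curve `c`, followed through `J` from the parameter `0` to the future, reaches future null
infinity: `r → ∞` at the future end of `J`, while `u` stays bounded. -/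
def ReachesNullInfinity (c : Curve) (J : Set ℝ) : Prop :=
  (∃ B : ℝ, ∀ t ∈ J, 0 ≤ t → |c.u t| ≤ B) ∧
    ∀ M : ℝ, ∃ t₀ ∈ J, ∀ t ∈ J, t₀ ≤ t → M ≤ c.r t

end NullAccess

end

open Set Filter Topology
noncomputable section
namespace NullAccess

/-! Put p = du/dt, a = 1 + dr/du, and let V be the angular velocity dx/du scaled by r. In Minkowski
space a null geodesic satisfies a' = (2a − 1) a p / r. The null condition forces a ≥ 1/2, with
equality only for radially ingoing rays. Once a > 1/2, the slope a increases, and r/a + u is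
conserved, so u stays bounded while r escapes.

For the metric g the equation for a contains the additional terms (½ ∂_u m − ½ ∂_u h(V,V)) p/r,
which are not small compared with the main term when a is of order one. Up to terms smaller by a
factor 1/r they are, however, total derivatives along the geodesic. The quantity Q = a − m/(2r) +
h(V,V)/(2r), called `Curve.correctedSlope`, differs from a by O(a/r) and obeys the Minkowski
equation with relative error O(1/r); this is `exists_correctedSlope_estimates`. Far out the motion
in the (u, r)-plane is therefore almost that of a straight line, whatever the sign of ∂_u m or of Ω.

The infimum of Ω enters only through `omega_inf_le_one`. The gauge makes h trace-free, so the
average of Ω over directions is 1 + ½ ∂_u m; an infimum above 1 would make the bounded function m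
grow linearly in u. Hence β_crit ≥ −1 + 1/√3, and initially a > 0.57, safely above the threshold
1/2.

The motion in the plane is studied under the hypotheses `AlmostStraight`. A continuity argument
(`AlmostStraight.good`) preserves a > 0.55, and monotone quantities that perturb the Minkowski ones
show that u is bounded and that r never falls below e⁻⁶ times an earlier value. If r did not tend to
infinity it would thus be bounded; then the velocity and the parameter would be bounded too, and the
geodesic could be continued (`IsNullGeodesic.not_futureInextendible`), because the acceleration of a
C^{1,1} metric is locally Lipschitz.

Two devices organise the work. The geodesic equation is treated as the vanishing of the
Euler–Lagrange covector, which makes changes of chart and the elimination of accelerations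
transparent. Uniformity in the metric is obtained by estimating all second jets of all geodesics at
once: `Jet` serves as an index type, and `Deg` records growth in √(1 + dr/du) with a single
constant. -/

section

/-! ### Stereographic charts of the sphere. -/

lemma poleSign_sq (s : Bool) : poleSign s ^ 2 = 1 := by
  cases s <;> norm_num [poleSign]

lemma one_add_sq_pos (y : Fin 2 → ℝ) : 0 < 1 + y 0 ^ 2 + y 1 ^ 2 := by positivity

lemma stereo_apply_zero (s : Bool) (y : Fin 2 → ℝ) :
    stereo s y 0 = 2 * y 0 / (1 + y 0 ^ 2 + y 1 ^ 2) := rfl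

lemma stereo_apply_one (s : Bool) (y : Fin 2 → ℝ) :
    stereo s y 1 = 2 * y 1 / (1 + y 0 ^ 2 + y 1 ^ 2) := rfl

lemma stereo_apply_two (s : Bool) (y : Fin 2 → ℝ) :
    stereo s y 2 = poleSign s * (y 0 ^ 2 + y 1 ^ 2 - 1) / (1 + y 0 ^ 2 + y 1 ^ 2) := rfl

lemma E3_ext {a b : E3} (h0 : a 0 = b 0) (h1 : a 1 = b 1) (h2 : a 2 = b 2) : a = b := by
  ext i; fin_cases i <;> assumption

lemma norm_sq_E3 (x : E3) : ‖x‖ ^ 2 = x 0 ^ 2 + x 1 ^ 2 + x 2 ^ 2 := by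
  rw [EuclideanSpace.norm_sq_eq]; simp [Fin.sum_univ_three]

lemma inner_E3 (x y : E3) : inner ℝ x y = x 0 * y 0 + x 1 * y 1 + x 2 * y 2 := by
  simp [PiLp.inner_apply, Fin.sum_univ_three]; ring

lemma norm_eq_one_iff_E3 (x : E3) : ‖x‖ = 1 ↔ x 0 ^ 2 + x 1 ^ 2 + x 2 ^ 2 = 1 := by
  rw [← norm_sq_E3]
  constructor
  · intro h; rw [h]; norm_num
  · intro h; nlinarith [norm_nonneg x]

lemma contDiff_stereo (s : Bool) {n : WithTop ℕ∞} : ContDiff ℝ n (stereo s) := by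
  rw [contDiff_euclidean]
  have hD : ∀ y : Fin 2 → ℝ, 1 + y 0 ^ 2 + y 1 ^ 2 ≠ 0 := fun y => (one_add_sq_pos y).ne'
  intro i
  fin_cases i
  · exact ContDiff.div (by fun_prop) (by fun_prop) hD
  · exact ContDiff.div (by fun_prop) (by fun_prop) hD
  · exact ContDiff.div (by fun_prop) (by fun_prop) hD

/-- The differential of inverse stereographic projection. -/
lemma fderiv_stereo_apply (s : Bool) (y v : Fin 2 → ℝ) :
    fderiv ℝ (stereo s) y v =
      !₂[2 * v 0 / (1 + y 0 ^ 2 + y 1 ^ 2)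
          - 4 * y 0 * (y 0 * v 0 + y 1 * v 1) / (1 + y 0 ^ 2 + y 1 ^ 2) ^ 2,
        2 * v 1 / (1 + y 0 ^ 2 + y 1 ^ 2)
          - 4 * y 1 * (y 0 * v 0 + y 1 * v 1) / (1 + y 0 ^ 2 + y 1 ^ 2) ^ 2,
        poleSign s * (4 * (y 0 * v 0 + y 1 * v 1)) / (1 + y 0 ^ 2 + y 1 ^ 2) ^ 2] := by
  have hdiff : HasFDerivAt (stereo s) (fderiv ℝ (stereo s) y) y :=
    ((contDiff_stereo s (n := 1)).differentiable (by norm_num) y).hasFDerivAt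
  have hline : HasDerivAt (fun t : ℝ => y + t • v) v 0 := by
    simpa using ((hasDerivAt_id (0 : ℝ)).smul_const v).const_add y
  have h1 : HasDerivAt (fun t : ℝ => stereo s (y + t • v)) (fderiv ℝ (stereo s) y v) 0 := by
    have hdiff' : HasFDerivAt (stereo s) (fderiv ℝ (stereo s) y) (y + (0 : ℝ) • v) := by
      simpa using hdiff
    exact hdiff'.comp_hasDerivAt 0 hline
  have hc : ∀ i : Fin 3, HasDerivAt (fun t : ℝ => stereo s (y + t • v) i)
      (fderiv ℝ (stereo s) y v i) 0 := fun i =>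
    (EuclideanSpace.proj i : E3 →L[ℝ] ℝ).hasFDerivAt.comp_hasDerivAt 0 h1
  have hy : ∀ i : Fin 2, HasDerivAt (fun t : ℝ => y i + t * v i) (v i) 0 := fun i => by
    simpa using ((hasDerivAt_id (0 : ℝ)).mul_const (v i)).const_add (y i)
  have hD : HasDerivAt (fun t : ℝ => 1 + (y 0 + t * v 0) ^ 2 + (y 1 + t * v 1) ^ 2)
      (2 * (y 0 * v 0 + y 1 * v 1)) 0 := by
    refine ((((hy 0).pow 2).const_add 1).add ((hy 1).pow 2)).congr_deriv ?_
    simp; ring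
  have hD0 : (fun t : ℝ => 1 + (y 0 + t * v 0) ^ 2 + (y 1 + t * v 1) ^ 2) 0 ≠ 0 := by
    simpa using (one_add_sq_pos y).ne'
  have hDy := (one_add_sq_pos y).ne'
  apply E3_ext
  · refine (hc 0).unique ?_
    refine (((hy 0).const_mul 2).div hD hD0).congr_deriv ?_
    simp; field_simp; ring
  · refine (hc 1).unique ?_
    refine (((hy 1).const_mul 2).div hD hD0).congr_deriv ?_
    simp; field_simp; ring
  · refine (hc 2).unique ?_
    refine ((((((hy 0).pow 2).add ((hy 1).pow 2)).sub_const 1).const_mul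
      (poleSign s)).div hD hD0).congr_deriv ?_
    simp; field_simp; ring

/-- Stereographic projection is conformal; the sign of the pole enters only squared, so both charts
have the same factor. -/
lemma inner_fderiv_stereo (s : Bool) (y v w : Fin 2 → ℝ) :
    inner ℝ (fderiv ℝ (stereo s) y v) (fderiv ℝ (stereo s) y w) =
      4 / (1 + y 0 ^ 2 + y 1 ^ 2) ^ 2 * (v 0 * w 0 + v 1 * w 1) := by
  have hDy := (one_add_sq_pos y).ne'
  rw [inner_E3, fderiv_stereo_apply, fderiv_stereo_apply]
  have := poleSign_sq s
  simp
  field_simp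
  rw [this]
  ring

lemma roundMetric_apply (s : Bool) (y : Fin 2 → ℝ) (I J : Fin 2) :
    roundMetric s y I J = 4 / (1 + y 0 ^ 2 + y 1 ^ 2) ^ 2 * (if I = J then 1 else 0) := by
  simp only [roundMetric, frame, Matrix.of_apply, inner_fderiv_stereo]
  fin_cases I <;> fin_cases J <;> simp

lemma fderiv_stereo_eq_sum (s : Bool) (y v : Fin 2 → ℝ) :
    fderiv ℝ (stereo s) y v = v 0 • frame s y 0 + v 1 • frame s y 1 := by
  have : v = v 0 • Pi.single 0 1 + v 1 • Pi.single 1 1 := by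
    ext i; fin_cases i <;> simp
  conv_lhs => rw [this]
  simp only [map_add, map_smul, frame]

lemma norm_stereo (s : Bool) (y : Fin 2 → ℝ) : ‖stereo s y‖ = 1 := by
  rw [norm_eq_one_iff_E3, stereo_apply_zero, stereo_apply_one, stereo_apply_two]
  have hDy := (one_add_sq_pos y).ne'
  have := poleSign_sq s
  field_simp
  rw [this]; ring

lemma one_sub_poleSign_stereo (s : Bool) (y : Fin 2 → ℝ) :
    1 - poleSign s * stereo s y 2 = 2 / (1 + y 0 ^ 2 + y 1 ^ 2) := by
  rw [stereo_apply_two]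
  have hDy := (one_add_sq_pos y).ne'
  have := poleSign_sq s
  field_simp
  rw [this]; ring

lemma inChart_iff (s : Bool) (x : E3) : InChart s x ↔ 1 - poleSign s * x 2 ≠ 0 := by
  have := poleSign_sq s
  unfold InChart
  constructor
  · intro h h'
    apply h
    linear_combination -poleSign s * h' - x 2 * this
  · intro h h'
    apply h; rw [h']; linear_combination -this

lemma inChart_stereo (s : Bool) (y : Fin 2 → ℝ) : InChart s (stereo s y) := by
  rw [inChart_iff, one_sub_poleSign_stereo]
  exact (div_pos two_pos (one_add_sq_pos y)).ne'

lemma angularCoord_stereo (s : Bool) (y : Fin 2 → ℝ) : angularCoord s (stereo s y) = y := by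
  have hDy := (one_add_sq_pos y).ne'
  ext i
  fin_cases i
  · simp only [angularCoord, one_sub_poleSign_stereo]
    simp [stereo_apply_zero]
    field_simp
  · simp only [angularCoord, one_sub_poleSign_stereo]
    simp [stereo_apply_one]
    field_simp

lemma stereo_angularCoord {s : Bool} {x : E3} (hx : ‖x‖ = 1) (hs : InChart s x) :
    stereo s (angularCoord s x) = x := by
  rw [norm_eq_one_iff_E3] at hx
  rw [inChart_iff] at hs
  have hp := poleSign_sq s
  set d := 1 - poleSign s * x 2 with hd
  have hden : 1 + (x 0 / d) ^ 2 + (x 1 / d) ^ 2 = 2 / d := by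
    field_simp
    have : x 0 ^ 2 + x 1 ^ 2 = 1 - x 2 ^ 2 := by linarith
    rw [add_assoc, this, hd]
    linear_combination x 2 ^ 2 * hp
  have h0 : angularCoord s x 0 = x 0 / d := rfl
  have h1 : angularCoord s x 1 = x 1 / d := rfl
  apply E3_ext
  · rw [stereo_apply_zero, h0, h1, hden]; field_simp
  · rw [stereo_apply_one, h0, h1, hden]; field_simp
  · rw [stereo_apply_two, h0, h1, hden]
    have : (x 0 / d) ^ 2 + (x 1 / d) ^ 2 - 1 = 2 / d - 2 := by linarith
    rw [this]
    field_simp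
    rw [hd]; linear_combination x 2 * hp

/-- The chart is chosen so that its missing pole is not in the hemisphere of `x`. That closed
hemisphere corresponds to the closed unit disc, where the asymptotic bounds are imposed. -/
lemma exists_chart {x : E3} (hx : ‖x‖ = 1) :
    ∃ s, InChart s x ∧ angularCoord s x 0 ^ 2 + angularCoord s x 1 ^ 2 ≤ 1 := by
  rw [norm_eq_one_iff_E3] at hx
  have key : ∀ s : Bool, poleSign s * x 2 ≤ 0 →
      InChart s x ∧ angularCoord s x 0 ^ 2 + angularCoord s x 1 ^ 2 ≤ 1 := by
    intro s hs
    have hp := poleSign_sq s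
    have hd : 0 < 1 - poleSign s * x 2 := by linarith
    refine ⟨(inChart_iff s x).2 hd.ne', ?_⟩
    have h0 : angularCoord s x 0 = x 0 / (1 - poleSign s * x 2) := rfl
    have h1 : angularCoord s x 1 = x 1 / (1 - poleSign s * x 2) := rfl
    rw [h0, h1, div_pow, div_pow, ← add_div, div_le_one (by positivity)]
    nlinarith
  rcases le_total (x 2) 0 with h | h
  · exact ⟨true, key true (by simpa [poleSign] using h)⟩
  · exact ⟨false, key false (by simpa [poleSign] using h)⟩

lemma isOpen_inChart (s : Bool) : IsOpen {x : E3 | InChart s x} := by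
  have : Continuous fun x : E3 => x 2 := by fun_prop
  exact isOpen_ne_fun this continuous_const

lemma contDiffAt_angularCoord {s : Bool} {x : E3} (hs : InChart s x) {n : WithTop ℕ∞} :
    ContDiffAt ℝ n (angularCoord s) x := by
  rw [inChart_iff] at hs
  rw [contDiffAt_pi]
  have h2 : ∀ i : Fin 3, ContDiffAt ℝ n (fun x : E3 => x i) x := fun i =>
    (EuclideanSpace.proj i : E3 →L[ℝ] ℝ).contDiff.contDiffAt
  intro i
  fin_cases i
  · exact (h2 0).div (contDiffAt_const.sub (contDiffAt_const.mul (h2 2))) hs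
  · exact (h2 1).div (contDiffAt_const.sub (contDiffAt_const.mul (h2 2))) hs

end

/-! ### The geodesic equation as an Euler–Lagrange equation. -/

section

section EulerLagrange

variable {E : Type*} [NormedAddCommGroup E] [NormedSpace ℝ E]

/-- The Euler–Lagrange covector of the Lagrangian `½ G_X(V, V)` along a motion with position `X`,
velocity `V` and acceleration `A`. -/
def eulerLagrange (G : E → E →L[ℝ] E →L[ℝ] ℝ) (X V A : E) : E →L[ℝ] ℝ :=
  (G X).flip A + (fderiv ℝ G X V).flip V - (1 / 2 : ℝ) • ((fderiv ℝ G X).flip V).flip V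

lemma eulerLagrange_apply (G : E → E →L[ℝ] E →L[ℝ] ℝ) (X V A w : E) :
    eulerLagrange G X V A w = G X w A + fderiv ℝ G X V w V - 1 / 2 * fderiv ℝ G X w V V := by
  simp [eulerLagrange]

/-- The Euler–Lagrange covector transforms as a covector under changes of coordinates. -/
lemma eulerLagrange_pullback {G G' : E → E →L[ℝ] E →L[ℝ] ℝ} {Φ : E → E} {X : E}
    (hΦ : ContDiffAt ℝ 2 Φ X) (hG : DifferentiableAt ℝ G X) (hG' : DifferentiableAt ℝ G' (Φ X))
    (hsymm : ∀ v w, G' (Φ X) v w = G' (Φ X) w v)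
    (hpull : ∀ᶠ Y in 𝓝 X, ∀ v w, G Y v w = G' (Φ Y) (fderiv ℝ Φ Y v) (fderiv ℝ Φ Y w))
    (V A w : E) :
    eulerLagrange G X V A w = eulerLagrange G' (Φ X) (fderiv ℝ Φ X V)
      (fderiv ℝ (fderiv ℝ Φ) X V V + fderiv ℝ Φ X A) (fderiv ℝ Φ X w) := by
  have hΦ1 : DifferentiableAt ℝ Φ X := hΦ.differentiableAt (by norm_num)
  have hΦ2 : DifferentiableAt ℝ (fderiv ℝ Φ) X :=
    (hΦ.fderiv_right (m := 1) (by norm_num)).differentiableAt (by norm_num)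
  have hsymm2 : ∀ a b, fderiv ℝ (fderiv ℝ Φ) X a b = fderiv ℝ (fderiv ℝ Φ) X b a := fun a b =>
    hΦ.isSymmSndFDerivAt (by simp) a b
  have hder : ∀ c a b, fderiv ℝ G X c a b =
      fderiv ℝ G' (Φ X) (fderiv ℝ Φ X c) (fderiv ℝ Φ X a) (fderiv ℝ Φ X b)
      + G' (Φ X) (fderiv ℝ (fderiv ℝ Φ) X c a) (fderiv ℝ Φ X b)
      + G' (Φ X) (fderiv ℝ Φ X a) (fderiv ℝ (fderiv ℝ Φ) X c b) := by
    intro c a b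
    have h1 : HasFDerivAt (fun Y => G Y a b)
        (((fderiv ℝ G X).flip a).flip b) X := by
      have := (hG.hasFDerivAt.clm_apply (hasFDerivAt_const a X)).clm_apply (hasFDerivAt_const b X)
      refine this.congr_fderiv ?_
      ext; simp
    have hG'c : HasFDerivAt (fun Y => G' (Φ Y)) ((fderiv ℝ G' (Φ X)).comp (fderiv ℝ Φ X)) X :=
      HasFDerivAt.comp (g := G') (f := Φ) X hG'.hasFDerivAt hΦ1.hasFDerivAt
    have ha : ∀ a : E, HasFDerivAt (fun Y => fderiv ℝ Φ Y a) ((fderiv ℝ (fderiv ℝ Φ) X).flip a) X := by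
      intro a
      refine (hΦ2.hasFDerivAt.clm_apply (hasFDerivAt_const a X)).congr_fderiv ?_
      ext; simp
    have h2 := (hG'c.clm_apply (ha a)).clm_apply (ha b)
    have h3 : HasFDerivAt (fun Y => G Y a b) _ X :=
      h2.congr_of_eventuallyEq (hpull.mono fun Y hY => hY a b)
    have := congrArg (fun L : E →L[ℝ] ℝ => L c) (h1.unique h3)
    simp at this
    rw [this]; ring
  have hX := hpull.self_of_nhds
  -- The terms with Φ''(V, w) cancel by the symmetry of the second derivative; the remaining Φ''(V,
  -- V) is the correction to the acceleration.
  rw [eulerLagrange_apply, eulerLagrange_apply, hder, hder, hX, map_add,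
    hsymm2 w V, hsymm (fderiv ℝ Φ X V) (fderiv ℝ (fderiv ℝ Φ) X V w)]
  ring

/-- Along solutions of the Euler–Lagrange equation, `G(X', X')` is constant. -/
lemma hasDerivAt_metric_velocity {G : E → E →L[ℝ] E →L[ℝ] ℝ} {X V : ℝ → E} {A : E} {t : ℝ}
    (hG : DifferentiableAt ℝ G (X t)) (hX : HasDerivAt X (V t) t) (hV : HasDerivAt V A t)
    (hsymm : ∀ v w, G (X t) v w = G (X t) w v)
    (hEL : eulerLagrange G (X t) (V t) A (V t) = 0) :
    HasDerivAt (fun τ => G (X τ) (V τ) (V τ)) 0 t := by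
  have h1 : HasDerivAt (fun τ => G (X τ)) (fderiv ℝ G (X t) (V t)) t :=
    HasFDerivAt.comp_hasDerivAt (l := G) (f := X) t hG.hasFDerivAt hX
  refine ((h1.clm_apply hV).clm_apply hV).congr_deriv ?_
  rw [eulerLagrange_apply] at hEL
  simp only [add_apply]
  rw [hsymm A (V t)]
  linear_combination 2 * hEL

end EulerLagrange

/-! ### The metric as a bilinear form on coordinate space -/

abbrev E4 : Type := Fin 4 → ℝ

/-- The bilinear form `dX^μ ⊗ dX^ν`. -/
def coordTensor (μ ν : Fin 4) : E4 →L[ℝ] E4 →L[ℝ] ℝ :=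
  (ContinuousLinearMap.proj μ : E4 →L[ℝ] ℝ).smulRight (ContinuousLinearMap.proj ν : E4 →L[ℝ] ℝ)

lemma coordTensor_apply (μ ν : Fin 4) (v w : E4) : coordTensor μ ν v w = v μ * w ν := by
  simp [coordTensor]

/-- The continuous bilinear form on `ℝ⁴` with matrix `M`. -/
def bilin (M : Matrix (Fin 4) (Fin 4) ℝ) : E4 →L[ℝ] E4 →L[ℝ] ℝ :=
  ∑ μ, ∑ ν, M μ ν • coordTensor μ ν

lemma bilin_apply (M : Matrix (Fin 4) (Fin 4) ℝ) (v w : E4) :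
    bilin M v w = ∑ μ, ∑ ν, M μ ν * v μ * w ν := by
  simp [bilin, coordTensor_apply, mul_assoc]

lemma hasFDerivAt_bilin {M : E4 → Matrix (Fin 4) (Fin 4) ℝ} {X : E4}
    (hM : ∀ μ ν, DifferentiableAt ℝ (fun Y => M Y μ ν) X) :
    HasFDerivAt (fun Y => bilin (M Y))
      (∑ μ, ∑ ν, (fderiv ℝ (fun Y => M Y μ ν) X).smulRight (coordTensor μ ν)) X := by
  have key : ∀ {F : Type} [NormedAddCommGroup F] [NormedSpace ℝ F] (T : Fin 4 → Fin 4 → F),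
      HasFDerivAt (fun Y => ∑ μ, ∑ ν, M Y μ ν • T μ ν)
        (∑ μ, ∑ ν, (fderiv ℝ (fun Y => M Y μ ν) X).smulRight (T μ ν)) X := by
    intro F _ _ T
    refine HasFDerivAt.fun_sum fun μ _ => HasFDerivAt.fun_sum fun ν _ => ?_
    exact (hM μ ν).hasFDerivAt.smul_const _
  exact key coordTensor

lemma fderiv_bilin_apply {M : E4 → Matrix (Fin 4) (Fin 4) ℝ} {X : E4}
    (hM : ∀ μ ν, DifferentiableAt ℝ (fun Y => M Y μ ν) X) (c v w : E4) :
    fderiv ℝ (fun Y => bilin (M Y)) X c v w =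
      ∑ μ, ∑ ν, fderiv ℝ (fun Y => M Y μ ν) X c * v μ * w ν := by
  rw [(hasFDerivAt_bilin hM).fderiv]
  simp [coordTensor_apply, mul_assoc]

lemma fderiv_eq_sum_pd (f : E4 → ℝ) (X c : E4) : fderiv ℝ f X c = ∑ μ, pd μ f X * c μ := by
  have : c = ∑ μ, c μ • Pi.single μ (1 : ℝ) := by
    ext i; simp [Finset.sum_apply, Pi.single_apply]
  conv_lhs => rw [this]
  simp only [map_sum, map_smul, pd, smul_eq_mul, mul_comm]

lemma eulerLagrange_bilin_single {M : E4 → Matrix (Fin 4) (Fin 4) ℝ} {X : E4}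
    (hM : ∀ μ ν, DifferentiableAt ℝ (fun Y => M Y μ ν) X) (V A : E4) (μ : Fin 4) :
    eulerLagrange (fun Y => bilin (M Y)) X V A (Pi.single μ 1) =
      ∑ ν, M X μ ν * A ν + ∑ α, ∑ β, (pd α (fun Y => M Y μ β) X
        - 1 / 2 * pd μ (fun Y => M Y α β) X) * V α * V β := by
  rw [eulerLagrange_apply, bilin_apply, fderiv_bilin_apply hM, fderiv_bilin_apply hM]
  have h1 : ∀ f : Fin 4 → ℝ, ∑ ν, f ν * (Pi.single μ (1 : ℝ) : E4) ν = f μ := by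
    intro f; simp [Pi.single_apply]
  have e1 : ∑ κ, ∑ ν, M X κ ν * (Pi.single μ (1 : ℝ) : E4) κ * A ν = ∑ ν, M X μ ν * A ν := by
    rw [Finset.sum_comm]
    refine Finset.sum_congr rfl fun ν _ => ?_
    rw [← h1 fun κ => M X κ ν, Finset.sum_mul, ]
  have e2 : ∑ κ, ∑ ν, fderiv ℝ (fun Y => M Y κ ν) X V * (Pi.single μ (1 : ℝ) : E4) κ * V ν
      = ∑ α, ∑ β, pd α (fun Y => M Y μ β) X * V α * V β := by
    rw [Finset.sum_comm]
    rw [Finset.sum_comm (f := fun α β => pd α (fun Y => M Y μ β) X * V α * V β)]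
    refine Finset.sum_congr rfl fun ν _ => ?_
    rw [← Finset.sum_mul, h1 fun κ => fderiv ℝ (fun Y => M Y κ ν) X V, fderiv_eq_sum_pd,
      Finset.sum_mul]
  rw [e1, e2]
  simp only [sub_mul, Finset.sum_sub_distrib, Finset.mul_sum, pd, add_sub_assoc, mul_assoc]

/-- The geodesic equation in Christoffel form is equivalent to the Euler–Lagrange equation. -/
lemma geodesic_iff_eulerLagrange {M : E4 → Matrix (Fin 4) (Fin 4) ℝ} {X : E4}
    (hM : ∀ μ ν, DifferentiableAt ℝ (fun Y => M Y μ ν) X)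
    (hdet : (M X).det ≠ 0) (V A : E4) :
    (∀ μ, A μ = - ∑ α, ∑ β, ((1 / 2) * ∑ ν, (M X)⁻¹ μ ν *
      (pd α (fun Y => M Y ν β) X + pd β (fun Y => M Y ν α) X - pd ν (fun Y => M Y α β) X))
        * V α * V β) ↔ eulerLagrange (fun Y => bilin (M Y)) X V A = 0 := by
  set b : E4 := fun μ => ∑ α, ∑ β, (pd α (fun Y => M Y μ β) X
        - 1 / 2 * pd μ (fun Y => M Y α β) X) * V α * V β with hb
  have hu : IsUnit (M X).det := hdet.isUnit
  have hsum : ∀ μ, ∑ α, ∑ β, ((1 / 2) * ∑ ν, (M X)⁻¹ μ ν *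
      (pd α (fun Y => M Y ν β) X + pd β (fun Y => M Y ν α) X - pd ν (fun Y => M Y α β) X))
        * V α * V β = ((M X)⁻¹.mulVec b) μ := by
    intro μ
    have hbν : ∀ ν, b ν = ∑ α, ∑ β, (1 / 2) * (pd α (fun Y => M Y ν β) X
        + pd β (fun Y => M Y ν α) X - pd ν (fun Y => M Y α β) X) * V α * V β := by
      intro ν
      -- Contraction with `V α * V β`, symmetric in α and β, makes the first two terms of the
      -- Christoffel bracket equal.
      have hsw : ∑ α, ∑ β, pd β (fun Y => M Y ν α) X * V α * V β
          = ∑ α, ∑ β, pd α (fun Y => M Y ν β) X * V α * V β := by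
        rw [Finset.sum_comm]
        refine Finset.sum_congr rfl fun α _ => Finset.sum_congr rfl fun β _ => by ring
      have : ∑ α, ∑ β, (1 / 2) * (pd α (fun Y => M Y ν β) X
        + pd β (fun Y => M Y ν α) X - pd ν (fun Y => M Y α β) X) * V α * V β =
        (1 / 2) * ∑ α, ∑ β, pd α (fun Y => M Y ν β) X * V α * V β
        + (1 / 2) * ∑ α, ∑ β, pd β (fun Y => M Y ν α) X * V α * V β
        - (1 / 2) * ∑ α, ∑ β, pd ν (fun Y => M Y α β) X * V α * V β := by
        simp only [Finset.mul_sum, ← Finset.sum_add_distrib, ← Finset.sum_sub_distrib]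
        refine Finset.sum_congr rfl fun α _ => Finset.sum_congr rfl fun β _ => by ring
      rw [this, hsw, hb]
      simp only [Finset.mul_sum, ← Finset.sum_add_distrib, ← Finset.sum_sub_distrib]
      refine Finset.sum_congr rfl fun α _ => Finset.sum_congr rfl fun β _ => by ring
    simp only [Matrix.mulVec, dotProduct, hbν, Finset.mul_sum, Finset.sum_mul]
    rw [Finset.sum_comm (s := Finset.univ (α := Fin 4))
      (f := fun ν α => ∑ β, (M X)⁻¹ μ ν * (1 / 2 * (pd α (fun Y => M Y ν β) X
        + pd β (fun Y => M Y ν α) X - pd ν (fun Y => M Y α β) X) * V α * V β))]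
    refine Finset.sum_congr rfl fun α _ => ?_
    rw [Finset.sum_comm]
    refine Finset.sum_congr rfl fun ν _ => Finset.sum_congr rfl fun β _ => by ring
  simp only [hsum]
  have hEL : eulerLagrange (fun Y => bilin (M Y)) X V A = 0 ↔ (M X).mulVec A + b = 0 := by
    constructor
    · intro h
      ext μ
      have := eulerLagrange_bilin_single hM V A μ
      rw [h] at this
      simpa [Matrix.mulVec, dotProduct, hb] using this.symm
    · intro h
      ext w
      have hw : w = ∑ μ, w μ • Pi.single μ (1 : ℝ) := by
        ext i; simp [Finset.sum_apply, Pi.single_apply]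
      rw [hw, map_sum]
      refine Finset.sum_eq_zero fun μ _ => ?_
      rw [map_smul, eulerLagrange_bilin_single hM V A μ]
      have := congrFun h μ
      simp only [Matrix.mulVec, dotProduct, hb, Pi.add_apply, Pi.zero_apply] at this
      rw [this, smul_zero]
  rw [hEL]
  constructor
  · intro h
    have : A = -((M X)⁻¹.mulVec b) := funext h
    rw [this, Matrix.mulVec_neg, Matrix.mulVec_mulVec, Matrix.mul_nonsing_inv _ hu,
      Matrix.one_mulVec, neg_add_cancel]
  · intro h μ
    have h1 : (M X).mulVec A = -b := eq_neg_of_add_eq_zero_left h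
    have h2 : A = (M X)⁻¹.mulVec (-b) := by
      rw [← h1, Matrix.mulVec_mulVec, Matrix.nonsing_inv_mul _ hu, Matrix.one_mulVec]
    rw [Matrix.mulVec_neg] at h2
    exact congrFun h2 μ

end

/-! ### Bondi metrics in components, and changes of chart. -/

section

/-- The tangent vector with coordinate components `v` in chart `s`. -/
def tangent (s : Bool) (y : Fin 2 → ℝ) (v : E4) : ℝ × ℝ × E3 :=
  (v 0, v 1, fderiv ℝ (stereo s) y (ang v))

namespace BondiMetric
variable (g : BondiMetric) (s : Bool) (X : E4)

lemma comp_zero_zero : g.comp s X 0 0 = g.guu (X 0) (X 1) (stereo s (ang X)) := by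
  simp [comp, form, basisVec]
lemma comp_zero_one : g.comp s X 0 1 = g.gur (X 0) (X 1) (stereo s (ang X)) := by
  simp [comp, form, basisVec]
lemma comp_one_zero : g.comp s X 1 0 = g.gur (X 0) (X 1) (stereo s (ang X)) := by
  simp [comp, form, basisVec]
lemma comp_one_one : g.comp s X 1 1 = 0 := by
  simp [comp, form, basisVec]
lemma comp_one_two : g.comp s X 1 2 = 0 := by
  simp [comp, form, basisVec]
lemma comp_one_three : g.comp s X 1 3 = 0 := by
  simp [comp, form, basisVec]
lemma comp_two_one : g.comp s X 2 1 = 0 := by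
  simp [comp, form, basisVec]
lemma comp_three_one : g.comp s X 3 1 = 0 := by
  simp [comp, form, basisVec]
lemma comp_zero_two :
    g.comp s X 0 2 = g.guA (X 0) (X 1) (stereo s (ang X)) (frame s (ang X) 0) := by
  simp [comp, form, basisVec]
lemma comp_zero_three :
    g.comp s X 0 3 = g.guA (X 0) (X 1) (stereo s (ang X)) (frame s (ang X) 1) := by
  simp [comp, form, basisVec]
lemma comp_two_zero : g.comp s X 2 0 = g.comp s X 0 2 := by
  simp [comp, form, basisVec]
lemma comp_three_zero : g.comp s X 3 0 = g.comp s X 0 3 := by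
  simp [comp, form, basisVec]
lemma comp_two_two : g.comp s X 2 2 = g.angularBlock s X 0 0 := by
  simp [comp, form, basisVec, angularBlock]
lemma comp_two_three : g.comp s X 2 3 = g.angularBlock s X 0 1 := by
  simp [comp, form, basisVec, angularBlock]
lemma comp_three_two : g.comp s X 3 2 = g.angularBlock s X 1 0 := by
  simp [comp, form, basisVec, angularBlock]
lemma comp_three_three : g.comp s X 3 3 = g.angularBlock s X 1 1 := by
  simp [comp, form, basisVec, angularBlock]

lemma form_tangent (v w : E4) :
    g.form (X 0) (X 1) (stereo s (ang X)) (tangent s (ang X) v) (tangent s (ang X) w)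
      = bilin (g.comp s X) v w := by
  rw [bilin_apply]
  simp only [Fin.sum_univ_four, comp_zero_zero, comp_zero_one, comp_one_zero, comp_one_one,
    comp_one_two, comp_one_three, comp_two_one, comp_three_one, comp_zero_two, comp_zero_three,
    comp_two_zero, comp_three_zero, comp_two_two, comp_two_three, comp_three_two, comp_three_three,
    angularBlock, Matrix.of_apply, form, tangent, fderiv_stereo_eq_sum, map_add, map_smul, ang,
    add_apply, smul_apply, smul_eq_mul]
  simp only [Matrix.cons_val_zero, Matrix.cons_val_one]
  ring

/-- The r-row and the r-column have g_{ur} as their only nonzero entry. This yields nondegeneracy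
from g_{ur} < 0 and the positivity of the angular block. -/
lemma det_comp : (g.comp s X).det = - g.comp s X 0 1 ^ 2 * (g.angularBlock s X).det := by
  rw [Matrix.det_fin_two, Matrix.det_succ_row _ 1]
  simp only [Fin.sum_univ_four, comp_one_one, comp_one_two, comp_one_three]
  simp only [Matrix.det_fin_three, Matrix.submatrix_apply]
  simp [Fin.succAbove, comp_two_one, comp_three_one, comp_one_zero, comp_two_two, comp_two_three,
    comp_three_two, comp_three_three, ← comp_zero_one]
  ring

end BondiMetric

namespace AsymptoticallyFlat
variable {R C : ℝ} {g : BondiMetric} {m : ℝ → E3 → ℝ} {h : ℝ → E3 → E3 →L[ℝ] E3 →L[ℝ] ℝ}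
  (H : AsymptoticallyFlat R C g m h)
include H

lemma det_comp_ne_zero (s : Bool) {X : E4} (hX : X ∈ region R) : (g.comp s X).det ≠ 0 := by
  rw [g.det_comp]
  have h1 := H.gur_neg s X hX
  have h2 := (H.angular_pos s X hX).det_pos
  exact mul_ne_zero (neg_ne_zero.2 (pow_ne_zero 2 h1.ne)) h2.ne'

lemma angularBlock_symm (s : Bool) {X : E4} (hX : X ∈ region R) :
    g.angularBlock s X 1 0 = g.angularBlock s X 0 1 := by
  simpa using (H.angular_pos s X hX).isHermitian.apply 0 1

lemma comp_symm (s : Bool) {X : E4} (hX : X ∈ region R) (μ ν : Fin 4) :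
    g.comp s X μ ν = g.comp s X ν μ := by
  have := H.angularBlock_symm s hX
  fin_cases μ <;> fin_cases ν <;>
  simp [BondiMetric.comp_zero_one, BondiMetric.comp_one_zero, BondiMetric.comp_one_two,
    BondiMetric.comp_one_three, BondiMetric.comp_two_one, BondiMetric.comp_three_one,
    BondiMetric.comp_two_zero, BondiMetric.comp_three_zero, BondiMetric.comp_two_three,
    BondiMetric.comp_three_two, this]

lemma bilin_symm (s : Bool) {X : E4} (hX : X ∈ region R) (v w : E4) :
    bilin (g.comp s X) v w = bilin (g.comp s X) w v := by
  rw [bilin_apply, bilin_apply, Finset.sum_comm]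
  refine Finset.sum_congr rfl fun μ _ => Finset.sum_congr rfl fun ν _ => ?_
  rw [H.comp_symm s hX]; ring

end AsymptoticallyFlat

lemma isOpen_region (R : ℝ) : IsOpen (region R) :=
  isOpen_lt continuous_const (continuous_apply (1 : Fin 4))

namespace AsymptoticallyFlat
variable {R C : ℝ} {g : BondiMetric} {m : ℝ → E3 → ℝ} {h : ℝ → E3 → E3 →L[ℝ] E3 →L[ℝ] ℝ}
  (H : AsymptoticallyFlat R C g m h)
include H

lemma contDiffAt_comp (s : Bool) {X : E4} (hX : X ∈ region R) (μ ν : Fin 4) :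
    ContDiffAt ℝ 1 (fun X => g.comp s X μ ν) X :=
  (H.regular s μ ν).1.contDiffAt ((isOpen_region R).mem_nhds hX)

lemma differentiableAt_comp (s : Bool) {X : E4} (hX : X ∈ region R) (μ ν : Fin 4) :
    DifferentiableAt ℝ (fun X => g.comp s X μ ν) X :=
  (H.contDiffAt_comp s hX μ ν).differentiableAt (by norm_num)

lemma differentiableAt_bilin (s : Bool) {X : E4} (hX : X ∈ region R) :
    DifferentiableAt ℝ (fun X => bilin (g.comp s X)) X :=
  (hasFDerivAt_bilin (H.differentiableAt_comp s hX)).differentiableAt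

end AsymptoticallyFlat

/-! ### Change of chart -/

/-- The coordinate quadruple with given `u`, `r` and angular part. -/
def quad (u r : ℝ) (y : Fin 2 → ℝ) : E4 := ![u, r, y 0, y 1]

@[simp] lemma quad_zero (u r : ℝ) (y : Fin 2 → ℝ) : quad u r y 0 = u := rfl
@[simp] lemma quad_one (u r : ℝ) (y : Fin 2 → ℝ) : quad u r y 1 = r := rfl
@[simp] lemma ang_quad (u r : ℝ) (y : Fin 2 → ℝ) : ang (quad u r y) = y := by
  ext i; fin_cases i <;> rfl

lemma quad_ang (X : E4) : quad (X 0) (X 1) (ang X) = X := by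
  ext i; fin_cases i <;> rfl

/-- The angular projection as a continuous linear map. -/
def angL : E4 →L[ℝ] (Fin 2 → ℝ) :=
  ContinuousLinearMap.pi ![ContinuousLinearMap.proj 2, ContinuousLinearMap.proj 3]

lemma angL_apply (X : E4) : angL X = ang X := by
  ext i; fin_cases i <;> rfl

lemma contDiff_ang {n : WithTop ℕ∞} : ContDiff ℝ n ang := by
  have : ang = angL := by ext1 X; rw [angL_apply]
  rw [this]; exact angL.contDiff

/-- The change of coordinates from chart `s` to chart `s'`. -/
def chartChange (s s' : Bool) (X : E4) : E4 :=
  quad (X 0) (X 1) (angularCoord s' (stereo s (ang X)))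

lemma contDiffAt_quad {F : Type*} [NormedAddCommGroup F] [NormedSpace ℝ F] {n : WithTop ℕ∞}
    {u r : F → ℝ} {y : F → Fin 2 → ℝ} {X : F} (hu : ContDiffAt ℝ n u X) (hr : ContDiffAt ℝ n r X)
    (hy : ContDiffAt ℝ n y X) : ContDiffAt ℝ n (fun X => quad (u X) (r X) (y X)) X := by
  rw [contDiffAt_pi] at hy ⊢
  intro i
  fin_cases i
  · exact hu
  · exact hr
  · exact hy 0
  · exact hy 1

lemma contDiffAt_chartChange {s s' : Bool} {X : E4} (hX : InChart s' (stereo s (ang X)))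
    {n : WithTop ℕ∞} : ContDiffAt ℝ n (chartChange s s') X := by
  refine contDiffAt_quad ?_ ?_ ?_
  · exact (contDiff_apply ℝ ℝ (0 : Fin 4)).contDiffAt
  · exact (contDiff_apply ℝ ℝ (1 : Fin 4)).contDiffAt
  · exact (contDiffAt_angularCoord hX).comp X ((contDiff_stereo s).comp contDiff_ang).contDiffAt

lemma eventually_inChart {s s' : Bool} {X : E4} (hX : InChart s' (stereo s (ang X))) :
    ∀ᶠ Y in 𝓝 X, InChart s' (stereo s (ang Y)) := by
  have hc : Continuous fun Y : E4 => stereo s (ang Y) :=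
    ((contDiff_stereo s (n := 0)).comp contDiff_ang).continuous
  exact hc.continuousAt.eventually ((isOpen_inChart s').mem_nhds hX)

@[simp] lemma chartChange_zero (s s' : Bool) (X : E4) : chartChange s s' X 0 = X 0 := rfl
@[simp] lemma chartChange_one (s s' : Bool) (X : E4) : chartChange s s' X 1 = X 1 := rfl

lemma stereo_ang_chartChange {s s' : Bool} {X : E4} (hX : InChart s' (stereo s (ang X))) :
    stereo s' (ang (chartChange s s' X)) = stereo s (ang X) := by
  rw [chartChange, ang_quad, stereo_angularCoord (norm_stereo _ _) hX]

lemma chartChange_chartChange {s s' : Bool} {X : E4} (hX : InChart s' (stereo s (ang X))) :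
    chartChange s' s (chartChange s s' X) = X := by
  conv_rhs => rw [← quad_ang X]
  rw [chartChange, stereo_ang_chartChange hX, angularCoord_stereo]
  simp

/-- The embedding `(u, r, y) ↦ (u, r, x)` has the tangent map as its derivative. -/
lemma hasFDerivAt_stereo_ang (s : Bool) (X : E4) :
    HasFDerivAt (fun Y => stereo s (ang Y)) ((fderiv ℝ (stereo s) (ang X)).comp angL) X := by
  have h1 : HasFDerivAt (stereo s) (fderiv ℝ (stereo s) (ang X)) (ang X) :=
    ((contDiff_stereo s (n := 1)).differentiable (by norm_num) _).hasFDerivAt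
  have h2 : HasFDerivAt ang angL X := by
    have : ang = angL := by ext1 X; rw [angL_apply]
    rw [this]; exact angL.hasFDerivAt
  exact h1.comp X h2

/-- Both charts parametrize the same points (u, r, x), so the chain rule applied to
`stereo_ang_chartChange` identifies the tangent vectors. -/
lemma tangent_chartChange {s s' : Bool} {X : E4} (hX : InChart s' (stereo s (ang X))) (v : E4) :
    tangent s' (ang (chartChange s s' X)) (fderiv ℝ (chartChange s s') X v) =
      tangent s (ang X) v := by
  have hΦ : HasFDerivAt (chartChange s s') (fderiv ℝ (chartChange s s') X) X :=
    ((contDiffAt_chartChange hX (n := 1)).differentiableAt (by norm_num)).hasFDerivAt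
  have hcomp : ∀ i : Fin 4, HasFDerivAt (fun Y => chartChange s s' Y i)
      ((ContinuousLinearMap.proj i : E4 →L[ℝ] ℝ).comp (fderiv ℝ (chartChange s s') X)) X :=
    fun i => (ContinuousLinearMap.proj i : E4 →L[ℝ] ℝ).hasFDerivAt.comp X hΦ
  have h0 : (fderiv ℝ (chartChange s s') X v) 0 = v 0 := by
    have := (hcomp 0).unique (ContinuousLinearMap.proj 0 : E4 →L[ℝ] ℝ).hasFDerivAt
    exact congrArg (fun L : E4 →L[ℝ] ℝ => L v) this
  have h1 : (fderiv ℝ (chartChange s s') X v) 1 = v 1 := by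
    have := (hcomp 1).unique (ContinuousLinearMap.proj 1 : E4 →L[ℝ] ℝ).hasFDerivAt
    exact congrArg (fun L : E4 →L[ℝ] ℝ => L v) this
  have h2 := (hasFDerivAt_stereo_ang s' (chartChange s s' X)).comp X hΦ
  have h3 := h2.unique ((hasFDerivAt_stereo_ang s X).congr_of_eventuallyEq
    ((eventually_inChart hX).mono fun Y hY => stereo_ang_chartChange hY))
  have h4 := congrArg (fun L : E4 →L[ℝ] E3 => L v) h3
  simp only [ContinuousLinearMap.comp_apply, angL_apply] at h4
  simp only [tangent, h0, h1, h4]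

lemma BondiMetric.bilin_chartChange (g : BondiMetric) {s s' : Bool} {X : E4}
    (hX : InChart s' (stereo s (ang X))) (v w : E4) :
    bilin (g.comp s X) v w = bilin (g.comp s' (chartChange s s' X))
      (fderiv ℝ (chartChange s s') X v) (fderiv ℝ (chartChange s s') X w) := by
  rw [← g.form_tangent, ← g.form_tangent, tangent_chartChange hX, tangent_chartChange hX,
    stereo_ang_chartChange hX]
  rfl

/-- The transition maps in the two directions invert each other. Surjectivity is needed because
covectors in the new chart are compared only on the image of this differential. -/
lemma fderiv_chartChange_surjective {s s' : Bool} {X : E4} (hX : InChart s' (stereo s (ang X)))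
    (w : E4) : ∃ v, fderiv ℝ (chartChange s s') X v = w := by
  have hX' : InChart s (stereo s' (ang (chartChange s s' X))) := by
    rw [stereo_ang_chartChange hX]; exact inChart_stereo _ _
  have hΦ : HasFDerivAt (chartChange s s') (fderiv ℝ (chartChange s s') X) X :=
    ((contDiffAt_chartChange hX (n := 1)).differentiableAt (by norm_num)).hasFDerivAt
  have hΨ : HasFDerivAt (chartChange s' s) (fderiv ℝ (chartChange s' s) (chartChange s s' X))
      (chartChange s s' X) :=
    ((contDiffAt_chartChange hX' (n := 1)).differentiableAt (by norm_num)).hasFDerivAt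
  rw [← chartChange_chartChange hX] at hΦ
  have h1 := hΦ.comp _ hΨ
  have h2 : HasFDerivAt (chartChange s s' ∘ chartChange s' s) (ContinuousLinearMap.id ℝ E4)
      (chartChange s s' X) := by
    refine (hasFDerivAt_id _).congr_of_eventuallyEq ?_
    exact (eventually_inChart hX').mono fun Y hY => chartChange_chartChange hY
  have h3 := congrArg (fun L : E4 →L[ℝ] E4 => L w) (h1.unique h2)
  rw [chartChange_chartChange hX] at h3
  exact ⟨_, h3⟩

end

/-! ### Geodesics in a chart and geodesics on the manifold. -/

section

lemma Curve.coord_eq (c : Curve) (s : Bool) (t : ℝ) :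
    (fun μ => c.coord s μ t) = quad (c.u t) (c.r t) (angularCoord s (c.x t)) := by
  ext μ; fin_cases μ <;> rfl

/-- The coordinates of a curve as a curve in `ℝ⁴`. -/
def Curve.lift (c : Curve) (s : Bool) (t : ℝ) : E4 :=
  quad (c.u t) (c.r t) (angularCoord s (c.x t))

lemma deriv_apply_of_contDiffAt {X : ℝ → E4} {t : ℝ} (hX : ContDiffAt ℝ 1 X t) (μ : Fin 4) :
    deriv (fun τ => X τ μ) t = deriv X t μ :=
  ((hasDerivAt_pi.1 (hX.differentiableAt (by norm_num)).hasDerivAt) μ).deriv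

lemma contDiffAt_deriv {F : Type*} [NormedAddCommGroup F] [NormedSpace ℝ F] {X : ℝ → F} {t : ℝ}
    (hX : ContDiffAt ℝ 2 X t) : ContDiffAt ℝ 1 (deriv X) t := by
  have h1 : ContDiffAt ℝ 1 (fderiv ℝ X) t := hX.fderiv_right (by norm_num)
  exact h1.clm_apply contDiffAt_const

lemma deriv_deriv_apply_of_contDiffAt {X : ℝ → E4} {t : ℝ} (hX : ContDiffAt ℝ 2 X t) (μ : Fin 4) :
    deriv (deriv fun τ => X τ μ) t = deriv (deriv X) t μ := by
  have h1 : ∀ᶠ τ in 𝓝 t, ContDiffAt ℝ 2 X τ := hX.eventually (by simp)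
  have h2 : deriv (fun τ => X τ μ) =ᶠ[𝓝 t] fun τ => deriv X τ μ :=
    h1.mono fun τ hτ => deriv_apply_of_contDiffAt (hτ.of_le (by norm_num)) μ
  rw [h2.deriv_eq]
  exact deriv_apply_of_contDiffAt (contDiffAt_deriv hX) μ

variable {R C : ℝ} {g : BondiMetric} {m : ℝ → E3 → ℝ} {h : ℝ → E3 → E3 →L[ℝ] E3 →L[ℝ] ℝ}

lemma AsymptoticallyFlat.christoffel_iff (H : AsymptoticallyFlat R C g m h) (s : Bool)
    {X : ℝ → E4} {t : ℝ} (hX : ContDiffAt ℝ 2 X t) (hR : X t ∈ region R) :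
    (∀ μ, deriv (deriv fun τ => X τ μ) t = - ∑ α, ∑ β, g.christoffel s (X t) μ α β
      * deriv (fun τ => X τ α) t * deriv (fun τ => X τ β) t) ↔
    eulerLagrange (fun Y => bilin (g.comp s Y)) (X t) (deriv X t) (deriv (deriv X) t) = 0 := by
  rw [← geodesic_iff_eulerLagrange (H.differentiableAt_comp s hR) (H.det_comp_ne_zero s hR)]
  simp only [deriv_deriv_apply_of_contDiffAt hX,
    deriv_apply_of_contDiffAt (hX.of_le (show (1 : WithTop ℕ∞) ≤ 2 by norm_num)),
    BondiMetric.christoffel]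

namespace IsNullGeodesic

variable {c : Curve} {J : Set ℝ} (hc : IsNullGeodesic R g c J)
include hc

lemma contDiffAt_u {t : ℝ} (ht : t ∈ J) : ContDiffAt ℝ 2 c.u t :=
  hc.u_regular.contDiffAt (hc.isOpen.mem_nhds ht)

lemma contDiffAt_r {t : ℝ} (ht : t ∈ J) : ContDiffAt ℝ 2 c.r t :=
  hc.r_regular.contDiffAt (hc.isOpen.mem_nhds ht)

lemma contDiffAt_x {t : ℝ} (ht : t ∈ J) : ContDiffAt ℝ 2 c.x t :=
  hc.x_regular.contDiffAt (hc.isOpen.mem_nhds ht)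

lemma eventually_inChart {s : Bool} {t : ℝ} (ht : t ∈ J) (hs : InChart s (c.x t)) :
    ∀ᶠ τ in 𝓝 t, τ ∈ J ∧ InChart s (c.x τ) :=
  (hc.isOpen.mem_nhds ht |> Filter.Eventually.and <|
    (hc.contDiffAt_x ht).continuousAt.eventually ((isOpen_inChart s).mem_nhds hs))

lemma contDiffAt_lift {s : Bool} {t : ℝ} (ht : t ∈ J) (hs : InChart s (c.x t)) :
    ContDiffAt ℝ 2 (c.lift s) t :=
  contDiffAt_quad (hc.contDiffAt_u ht) (hc.contDiffAt_r ht)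
    ((contDiffAt_angularCoord hs).comp t (hc.contDiffAt_x ht))

lemma stereo_lift {s : Bool} {t : ℝ} (ht : t ∈ J) (hs : InChart s (c.x t)) :
    stereo s (ang (c.lift s t)) = c.x t := by
  rw [Curve.lift, ang_quad, stereo_angularCoord (hc.mem_sphere t ht) hs]

lemma lift_mem_region {s : Bool} {t : ℝ} (ht : t ∈ J) : c.lift s t ∈ region R :=
  hc.mem_region t ht

lemma velocity_eq {s : Bool} {t : ℝ} (ht : t ∈ J) (hs : InChart s (c.x t)) :
    c.velocity t = tangent s (ang (c.lift s t)) (deriv (c.lift s) t) := by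
  have hd := ((hc.contDiffAt_lift ht hs).of_le (show (1 : WithTop ℕ∞) ≤ 2 by norm_num))
  have h0 := deriv_apply_of_contDiffAt hd 0
  have h1 := deriv_apply_of_contDiffAt hd 1
  have h2 : HasDerivAt c.x
      (fderiv ℝ (stereo s) (ang (c.lift s t)) (ang (deriv (c.lift s) t))) t := by
    have := (hasFDerivAt_stereo_ang s (c.lift s t)).comp_hasDerivAt t
      (hd.differentiableAt (by norm_num)).hasDerivAt
    rw [ContinuousLinearMap.comp_apply, angL_apply] at this
    refine this.congr_of_eventuallyEq ?_
    exact (hc.eventually_inChart ht hs).mono fun τ hτ => (hc.stereo_lift hτ.1 hτ.2).symm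
  rw [Curve.velocity, tangent, h2.deriv, ← h0, ← h1]
  rfl

lemma deriv_x {s : Bool} {t : ℝ} (ht : t ∈ J) (hs : InChart s (c.x t)) :
    deriv c.x t = fderiv ℝ (stereo s) (ang (c.lift s t)) (ang (deriv (c.lift s) t)) :=
  congrArg (fun z => z.2.2) (hc.velocity_eq ht hs)

lemma deriv_u {s : Bool} {t : ℝ} (ht : t ∈ J) (hs : InChart s (c.x t)) :
    deriv c.u t = deriv (c.lift s) t 0 :=
  congrArg (fun z => z.1) (hc.velocity_eq ht hs)

lemma deriv_r {s : Bool} {t : ℝ} (ht : t ∈ J) (hs : InChart s (c.x t)) :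
    deriv c.r t = deriv (c.lift s) t 1 :=
  congrArg (fun z => z.2.1) (hc.velocity_eq ht hs)

lemma null_lift {s : Bool} {t : ℝ} (ht : t ∈ J) (hs : InChart s (c.x t)) :
    bilin (g.comp s (c.lift s t)) (deriv (c.lift s) t) (deriv (c.lift s) t) = 0 := by
  rw [← g.form_tangent, ← hc.velocity_eq ht hs, hc.stereo_lift ht hs]
  exact hc.null t ht

lemma eulerLagrange_lift (H : AsymptoticallyFlat R C g m h) {s : Bool} {t : ℝ} (ht : t ∈ J)
    (hs : InChart s (c.x t)) :
    eulerLagrange (fun Y => bilin (g.comp s Y)) (c.lift s t) (deriv (c.lift s) t)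
      (deriv (deriv (c.lift s)) t) = 0 := by
  rw [← H.christoffel_iff s (hc.contDiffAt_lift ht hs) (hc.lift_mem_region ht)]
  intro μ
  have hco : ∀ μ, (fun τ => c.lift s τ μ) = c.coord s μ := fun μ =>
    funext fun τ => (congrFun (c.coord_eq s τ) μ).symm
  simp only [hco]
  have := hc.geodesic t ht s hs μ
  rw [c.coord_eq] at this
  exact this

end IsNullGeodesic

/-- The curve with given coordinates in chart `s`. -/
def curveOfLift (s : Bool) (X : ℝ → E4) : Curve where
  u t := X t 0
  r t := X t 1
  x t := stereo s (ang (X t))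

/-- A solution of the geodesic equation in one chart is a geodesic. -/
lemma AsymptoticallyFlat.isNullGeodesic_curveOfLift (H : AsymptoticallyFlat R C g m h) {s : Bool}
    {X : ℝ → E4} {I : Set ℝ} (hI : IsOpen I) (hI' : I.OrdConnected) (hX : ContDiffOn ℝ 2 X I)
    (hR : ∀ t ∈ I, X t ∈ region R)
    (hnull : ∀ t ∈ I, bilin (g.comp s (X t)) (deriv X t) (deriv X t) = 0)
    (hEL : ∀ t ∈ I, eulerLagrange (fun Y => bilin (g.comp s Y)) (X t) (deriv X t)
      (deriv (deriv X) t) = 0) :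
    IsNullGeodesic R g (curveOfLift s X) I := by
  have hXt : ∀ t ∈ I, ContDiffAt ℝ 2 X t := fun t ht => hX.contDiffAt (hI.mem_nhds ht)
  have hx : ContDiffOn ℝ 2 (curveOfLift s X).x I :=
    ((contDiff_stereo s).comp contDiff_ang).comp_contDiffOn hX
  refine ⟨hI, hI', contDiffOn_pi.1 hX 0, contDiffOn_pi.1 hX 1, hx, hR,
    fun t _ => norm_stereo _ _, ?_, ?_⟩
  · intro t ht
    have hd := ((hXt t ht).of_le (show (1 : WithTop ℕ∞) ≤ 2 by norm_num))
    have h2 := (hasFDerivAt_stereo_ang s (X t)).comp_hasDerivAt t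
      (hd.differentiableAt (by norm_num)).hasDerivAt
    have : (curveOfLift s X).velocity t = tangent s (ang (X t)) (deriv X t) := by
      rw [Curve.velocity, tangent, ← deriv_apply_of_contDiffAt hd 0,
        ← deriv_apply_of_contDiffAt hd 1]
      rw [ContinuousLinearMap.comp_apply, angL_apply] at h2
      rw [← h2.deriv]
      rfl
    rw [this]
    exact (g.form_tangent s (X t) _ _).trans (hnull t ht)
  -- The equation is also required in the other chart. The second derivative of the transformed
  -- curve is exactly the acceleration that occurs in `eulerLagrange_pullback`.
  · intro t ht s' hs'
    have hs'' : InChart s' (stereo s (ang (X t))) := hs'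
    have hd := hXt t ht
    have hXd : ∀ᶠ τ in 𝓝 t, ContDiffAt ℝ 2 X τ := hd.eventually (by simp)
    have hch : ∀ᶠ τ in 𝓝 t, InChart s' (stereo s (ang (X τ))) :=
      hd.continuousAt.eventually (NullAccess.eventually_inChart hs'')
    have hΦ : ContDiffAt ℝ 2 (chartChange s s') (X t) := contDiffAt_chartChange hs''
    have hZ : ContDiffAt ℝ 2 (fun τ => chartChange s s' (X τ)) t := hΦ.comp t hd
    have hco : ∀ μ, (fun τ => chartChange s s' (X τ) μ) = (curveOfLift s X).coord s' μ := fun μ =>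
      funext fun τ => (congrFun ((curveOfLift s X).coord_eq s' τ) μ).symm
    have hXr : X t ∈ region R := hR t ht
    have hZr : chartChange s s' (X t) ∈ region R := hXr
    rw [(curveOfLift s X).coord_eq]
    simp only [← hco]
    refine (H.christoffel_iff s' hZ hZr).2 ?_
    have hder : ∀ᶠ τ in 𝓝 t, deriv (fun τ => chartChange s s' (X τ)) τ
        = fderiv ℝ (chartChange s s') (X τ) (deriv X τ) := by
      filter_upwards [hXd, hch] with τ h1 h2
      exact (((contDiffAt_chartChange h2 (n := 1)).differentiableAt
        (by norm_num)).hasFDerivAt.comp_hasDerivAt τ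
          (h1.differentiableAt (by norm_num)).hasDerivAt).deriv
    have hder2 : deriv (deriv fun τ => chartChange s s' (X τ)) t =
        fderiv ℝ (fderiv ℝ (chartChange s s')) (X t) (deriv X t) (deriv X t)
        + fderiv ℝ (chartChange s s') (X t) (deriv (deriv X) t) := by
      have hder' : deriv (fun τ => chartChange s s' (X τ)) =ᶠ[𝓝 t]
        fun τ => fderiv ℝ (chartChange s s') (X τ) (deriv X τ) := hder
      rw [hder'.deriv_eq]
      have hF : HasFDerivAt (fderiv ℝ (chartChange s s'))
          (fderiv ℝ (fderiv ℝ (chartChange s s')) (X t)) (X t) :=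
        ((hΦ.fderiv_right (m := 1) (by norm_num)).differentiableAt (by norm_num)).hasFDerivAt
      have h1 : HasDerivAt (fun τ => fderiv ℝ (chartChange s s') (X τ))
          (fderiv ℝ (fderiv ℝ (chartChange s s')) (X t) (deriv X t)) t :=
        HasFDerivAt.comp_hasDerivAt (l := fderiv ℝ (chartChange s s')) (f := X) t hF
          (hd.differentiableAt (by norm_num)).hasDerivAt
      have h2 : HasDerivAt (deriv X) (deriv (deriv X) t) t :=
        ((contDiffAt_deriv hd).differentiableAt (by norm_num)).hasDerivAt
      exact (h1.clm_apply h2).deriv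
    rw [hder.self_of_nhds, hder2]
    ext w
    obtain ⟨v, rfl⟩ := fderiv_chartChange_surjective hs'' w
    have key := eulerLagrange_pullback (G := fun Y => bilin (g.comp s Y))
      (G' := fun Y => bilin (g.comp s' Y)) hΦ
      (H.differentiableAt_bilin s hXr) (H.differentiableAt_bilin s' hZr) (H.bilin_symm s' hZr)
      ((NullAccess.eventually_inChart hs'').mono fun Y hY => g.bilin_chartChange hY)
      (deriv X t) (deriv (deriv X) t) v
    rw [← key, hEL t ht]
    simp

end

/-! ### Local Lipschitz continuity and the initial value problem. -/

section

/-- Lipschitz continuity on some neighbourhood of a point. -/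
def LipschitzNear {E : Type*} [PseudoMetricSpace E] {F : Type*} [PseudoMetricSpace F] (f : E → F)
    (x : E) : Prop :=
  ∃ K, ∃ t ∈ 𝓝 x, LipschitzOnWith K f t

namespace LipschitzNear

section
variable {E F : Type*} [PseudoMetricSpace E] [PseudoMetricSpace F]

lemma continuousAt {f : E → F} {x : E} (hf : LipschitzNear f x) : ContinuousAt f x := by
  obtain ⟨K, t, ht, h⟩ := hf
  exact h.continuousOn.continuousAt ht

lemma const (a : F) (x : E) : LipschitzNear (fun _ : E => a) x :=
  ⟨0, univ, univ_mem, (LipschitzWith.const a).lipschitzOnWith⟩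

lemma comp_lipschitzWith {G : Type*} [PseudoMetricSpace G] {f : E → F} {φ : G → E} {x : G}
    {K : NNReal} (hf : LipschitzNear f (φ x)) (hφ : LipschitzWith K φ) :
    LipschitzNear (fun y => f (φ y)) x := by
  obtain ⟨L, t, ht, h⟩ := hf
  exact ⟨L * K, φ ⁻¹' t, hφ.continuous.continuousAt.preimage_mem_nhds ht,
    h.comp hφ.lipschitzOnWith (mapsTo_preimage φ t)⟩

lemma _root_.LipschitzWith.comp_lipschitzNear {G : Type*} [PseudoMetricSpace G] {f : E → F}
    {φ : F → G} {x : E} {K : NNReal} (hφ : LipschitzWith K φ) (hf : LipschitzNear f x) :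
    LipschitzNear (fun y => φ (f y)) x := by
  obtain ⟨L, t, ht, h⟩ := hf
  exact ⟨K * L, t, ht, hφ.comp_lipschitzOnWith h⟩

variable {f g : E → ℝ} {x : E}

lemma add (hf : LipschitzNear f x) (hg : LipschitzNear g x) :
    LipschitzNear (fun y => f y + g y) x := by
  obtain ⟨K, t, ht, h⟩ := hf
  obtain ⟨L, u, hu, k⟩ := hg
  exact ⟨K + L, t ∩ u, inter_mem ht hu, (h.mono inter_subset_left).add (k.mono inter_subset_right)⟩

lemma mul (hf : LipschitzNear f x) (hg : LipschitzNear g x) :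
    LipschitzNear (fun y => f y * g y) x := by
  have hfb : ∀ᶠ y in 𝓝 x, |f y| < |f x| + 1 :=
    hf.continuousAt.abs.eventually (gt_mem_nhds (by linarith))
  have hgb : ∀ᶠ y in 𝓝 x, |g y| < |g x| + 1 :=
    hg.continuousAt.abs.eventually (gt_mem_nhds (by linarith))
  obtain ⟨K, t, ht, h⟩ := hf
  obtain ⟨L, u, hu, k⟩ := hg
  have ha : 0 ≤ |f x| + 1 := by positivity
  have hb : 0 ≤ |g x| + 1 := by positivity
  refine ⟨(|f x| + 1).toNNReal * L + (|g x| + 1).toNNReal * K, _, inter_mem (inter_mem ht hu)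
    (inter_mem hfb hgb), ?_⟩
  refine LipschitzOnWith.of_dist_le_mul fun y hy z hz => ?_
  have h1 := h.dist_le_mul y hy.1.1 z hz.1.1
  have h2 := k.dist_le_mul y hy.1.2 z hz.1.2
  rw [Real.dist_eq] at h1 h2 ⊢
  have e : f y * g y - f z * g z = f y * (g y - g z) + g z * (f y - f z) := by ring
  have hfy : |f y| ≤ |f x| + 1 := le_of_lt hy.2.1
  have hgz : |g z| ≤ |g x| + 1 := le_of_lt hz.2.2
  rw [e]
  refine (abs_add_le _ _).trans ?_
  rw [abs_mul, abs_mul]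
  calc |f y| * |g y - g z| + |g z| * |f y - f z|
      ≤ (|f x| + 1) * (L * dist y z) + (|g x| + 1) * (K * dist y z) := by gcongr
    _ = _ := by push_cast; rw [Real.coe_toNNReal _ ha, Real.coe_toNNReal _ hb]; ring

lemma const_mul (a : ℝ) (hf : LipschitzNear f x) : LipschitzNear (fun y => a * f y) x :=
  (const a x).mul hf

lemma neg (hf : LipschitzNear f x) : LipschitzNear (fun y => - f y) x := by
  simpa using hf.const_mul (-1)

lemma sub (hf : LipschitzNear f x) (hg : LipschitzNear g x) :
    LipschitzNear (fun y => f y - g y) x := by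
  simpa [sub_eq_add_neg] using hf.add hg.neg

lemma sum {ι : Type*} (s : Finset ι) {f : ι → E → ℝ} (hf : ∀ i, LipschitzNear (f i) x) :
    LipschitzNear (fun y => ∑ i ∈ s, f i y) x := by
  classical
  induction s using Finset.induction_on with
  | empty => simpa using const (0 : ℝ) x
  | insert i s hi ih => simpa [Finset.sum_insert hi] using (hf i).add ih

lemma pi {ι : Type*} [Fintype ι] {f : ι → E → ℝ} (hf : ∀ i, LipschitzNear (f i) x) :
    LipschitzNear (fun y i => f i y) x := by
  choose K t ht h using hf
  refine ⟨Finset.univ.sup K, ⋂ i, t i, (Filter.iInter_mem).2 ht, ?_⟩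
  refine LipschitzOnWith.of_dist_le_mul fun y hy z hz => ?_
  refine (dist_pi_le_iff (by positivity)).2 fun i => ?_
  refine ((h i).dist_le_mul y (mem_iInter.1 hy i) z (mem_iInter.1 hz i)).trans ?_
  gcongr
  exact Finset.le_sup (f := K) (Finset.mem_univ i)

lemma prodMk {G : Type*} [PseudoMetricSpace G] {f : E → F} {g : E → G}
    (hf : LipschitzNear f x) (hg : LipschitzNear g x) :
    LipschitzNear (fun y => (f y, g y)) x := by
  obtain ⟨K, t, ht, h⟩ := hf
  obtain ⟨L, u, hu, k⟩ := hg
  refine ⟨max K L, t ∩ u, inter_mem ht hu, LipschitzOnWith.of_dist_le_mul fun y hy z hz => ?_⟩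
  rw [Prod.dist_eq]
  refine max_le ((h.dist_le_mul y hy.1 z hz.1).trans ?_) ((k.dist_le_mul y hy.2 z hz.2).trans ?_)
  · gcongr; exact le_max_left _ _
  · gcongr; exact le_max_right _ _

end

lemma of_contDiffAt {E F : Type*} [NormedAddCommGroup E] [NormedSpace ℝ E] [NormedAddCommGroup F]
    [NormedSpace ℝ F] {f : E → F} {x : E} (hf : ContDiffAt ℝ 1 f x) : LipschitzNear f x :=
  hf.exists_lipschitzOnWith

/-- The initial value problem for a vector field that is Lipschitz near the initial value. -/
lemma exists_solution {E : Type*} [NormedAddCommGroup E] [NormedSpace ℝ E] [CompleteSpace E]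
    {f : E → E} {x₀ : E} (hf : LipschitzNear f x₀) (t₀ : ℝ) :
    ∃ α : ℝ → E, α t₀ = x₀ ∧ ∃ ε > 0, ∀ t ∈ Ioo (t₀ - ε) (t₀ + ε), HasDerivAt α (f (α t)) t := by
  obtain ⟨K, s, hs, hl⟩ := hf
  obtain ⟨a, ha, has⟩ := Metric.mem_nhds_iff.mp hs
  set L : ℝ := K * a + ‖f x₀‖ + 1 with hL
  have hL0 : 0 < L := by positivity
  have hsub : Metric.closedBall x₀ (a / 2) ⊆ s :=
    (Metric.closedBall_subset_ball (half_lt_self ha)).trans has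
  have hb : ∀ x ∈ Metric.closedBall x₀ (a / 2), ‖f x‖ ≤ L := by
    intro x hx
    have h1 := hl.norm_sub_le (hsub hx) (mem_of_mem_nhds hs)
    have h2 : ‖x - x₀‖ ≤ a := by
      rw [mem_closedBall_iff_norm] at hx; linarith
    have h3 : (K : ℝ) * ‖x - x₀‖ ≤ K * a := by gcongr
    have h4 := norm_le_norm_add_norm_sub' (f x) (f x₀)
    linarith
  -- `L` bounds the vector field on the ball of radius `a / 2`, so a solution cannot leave this ball
  -- within time `ε`.
  set ε := a / 2 / L with hε
  have hε0 : 0 < ε := by positivity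
  have hpl : IsPicardLindelof (fun _ ↦ f) (tmin := t₀ - ε) (tmax := t₀ + ε)
      ⟨t₀, by constructor <;> linarith⟩ x₀ (a / 2).toNNReal 0 L.toNNReal K := by
    have e1 := Real.coe_toNNReal _ (half_pos ha).le
    have e2 := Real.coe_toNNReal _ hL0.le
    refine IsPicardLindelof.of_time_independent (by rwa [e1, e2])
      (by rw [e1]; exact hl.mono hsub) ?_
    rw [e1, e2]
    simp only [add_sub_cancel_left, sub_sub_cancel, max_self, NNReal.coe_zero, sub_zero, hε]
    field_simp
    exact le_rfl
  obtain ⟨α, h1, h2⟩ := hpl.exists_eq_forall_mem_Icc_hasDerivWithinAt₀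
  exact ⟨α, h1, ε, hε0, fun t ht => (h2 t (Ioo_subset_Icc_self ht)).hasDerivAt
    (Icc_mem_nhds ht.1 ht.2)⟩

end LipschitzNear

lemma contDiffAt_det {E : Type*} [NormedAddCommGroup E] [NormedSpace ℝ E] {n : ℕ}
    {M : E → Matrix (Fin n) (Fin n) ℝ} {X : E} {k : WithTop ℕ∞}
    (hM : ∀ i j, ContDiffAt ℝ k (fun Y => M Y i j) X) : ContDiffAt ℝ k (fun Y => (M Y).det) X := by
  simp only [Matrix.det_apply']
  exact ContDiffAt.sum fun σ _ => contDiffAt_const.mul (contDiffAt_prod fun i _ => hM _ _)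

lemma contDiffAt_matrix_inv {E : Type*} [NormedAddCommGroup E] [NormedSpace ℝ E] {n : ℕ}
    {M : E → Matrix (Fin n) (Fin n) ℝ} {X : E} {k : WithTop ℕ∞}
    (hM : ∀ i j, ContDiffAt ℝ k (fun Y => M Y i j) X) (hdet : (M X).det ≠ 0) (i j : Fin n) :
    ContDiffAt ℝ k (fun Y => (M Y)⁻¹ i j) X := by
  simp only [Matrix.inv_def, Ring.inverse_eq_inv', Matrix.smul_apply, smul_eq_mul,
    Matrix.adjugate_apply]
  refine ((contDiffAt_det hM).inv hdet).mul (contDiffAt_det fun a b => ?_)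
  by_cases hab : a = j
  · subst hab
    simp only [Matrix.updateRow_self]
    exact contDiffAt_const
  · simp only [Matrix.updateRow_ne hab]
    exact hM a b

/-- A function with bounded derivative has a limit at the end of its interval of definition. -/
lemma exists_tendsto_of_deriv_bounded {F : Type*} [NormedAddCommGroup F] [NormedSpace ℝ F]
    [CompleteSpace F] {f f' : ℝ → F} {a T B : ℝ} (haT : a < T)
    (hf : ∀ t ∈ Ioo a T, HasDerivAt f (f' t) t) (hB : ∀ t ∈ Ioo a T, ‖f' t‖ ≤ B) :
    ∃ L, Tendsto f (𝓝[<] T) (𝓝 L) := by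
  have hl : LipschitzOnWith (Real.toNNReal B) f (Ioo a T) := by
    refine (convex_Ioo a T).lipschitzOnWith_of_nnnorm_hasDerivWithin_le
      (fun t ht => (hf t ht).hasDerivWithinAt) fun t ht => ?_
    rw [← NNReal.coe_le_coe, coe_nnnorm]
    exact (hB t ht).trans (Real.le_coe_toNNReal B)
  have hc : Cauchy (𝓝[<] T) := (cauchy_nhds (a := T)).mono nhdsWithin_le_nhds
  have := hc.map_of_le hl.uniformContinuousOn
    (le_principal_iff.2 (Ioo_mem_nhdsLT haT))
  exact CompleteSpace.complete this

end

/-! ### Lipschitz acceleration; restriction, union and gluing of solutions. -/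

section

variable {R C : ℝ} {g : BondiMetric} {m : ℝ → E3 → ℝ} {h : ℝ → E3 → E3 →L[ℝ] E3 →L[ℝ] ℝ}

/-- The acceleration of a geodesic with position `X` and velocity `V` in chart `s`. -/
def BondiMetric.acceleration (g : BondiMetric) (s : Bool) (p : E4 × E4) : E4 := fun μ =>
  - ∑ α, ∑ β, g.christoffel s p.1 μ α β * p.2 α * p.2 β

/-- Class C^{1,1} is used here: the inverse metric is C¹ by Cramer's rule, while the first
derivatives of the metric are only locally Lipschitz. -/
lemma AsymptoticallyFlat.lipschitzNear_christoffel (H : AsymptoticallyFlat R C g m h) (s : Bool)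
    {X : E4} (hX : X ∈ region R) (μ α β : Fin 4) :
    LipschitzNear (fun Y => g.christoffel s Y μ α β) X := by
  have hpd : ∀ κ ν ρ, LipschitzNear (fun Y => pd κ (fun Z => g.comp s Z ν ρ) Y) X := by
    intro κ ν ρ
    have h1 : LipschitzNear (fderiv ℝ fun Z => g.comp s Z ν ρ) X := by
      obtain ⟨K, t, ht, hK⟩ := (H.regular s ν ρ).2 hX
      rw [(isOpen_region R).nhdsWithin_eq hX] at ht
      exact ⟨K, t, ht, hK⟩
    exact (ContinuousLinearMap.apply ℝ ℝ (Pi.single κ (1 : ℝ) : E4)).lipschitz.comp_lipschitzNear h1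
  unfold BondiMetric.christoffel
  refine LipschitzNear.const_mul _ (LipschitzNear.sum _ fun ν => LipschitzNear.mul ?_ ?_)
  · exact LipschitzNear.of_contDiffAt (contDiffAt_matrix_inv (H.contDiffAt_comp s hX)
      (H.det_comp_ne_zero s hX) μ ν)
  · exact ((hpd _ _ _).add (hpd _ _ _)).sub (hpd _ _ _)

lemma AsymptoticallyFlat.lipschitzNear_acceleration (H : AsymptoticallyFlat R C g m h) (s : Bool)
    {p : E4 × E4} (hp : p.1 ∈ region R) : LipschitzNear (g.acceleration s) p := by
  have hc : ∀ μ : Fin 4, LipschitzNear (fun q : E4 × E4 => q.2 μ) p := fun μ =>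
    LipschitzNear.of_contDiffAt
      ((contDiff_apply ℝ ℝ μ).comp contDiff_snd).contDiffAt
  refine LipschitzNear.pi fun μ => LipschitzNear.neg ?_
  refine LipschitzNear.sum _ fun α => LipschitzNear.sum _ fun β => ?_
  exact (((H.lipschitzNear_christoffel s hp μ α β).comp_lipschitzWith
    LipschitzWith.prod_fst).mul (hc α)).mul (hc β)

lemma AsymptoticallyFlat.eulerLagrange_iff_acceleration (H : AsymptoticallyFlat R C g m h)
    (s : Bool) {X : E4} (hX : X ∈ region R) (V A : E4) :
    eulerLagrange (fun Y => bilin (g.comp s Y)) X V A = 0 ↔ A = g.acceleration s (X, V) := by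
  rw [← geodesic_iff_eulerLagrange (H.differentiableAt_comp s hX) (H.det_comp_ne_zero s hX),
    funext_iff]
  rfl

/-- Curves are total functions of which only the values on the open set `J` matter; derivatives at
points of `J` depend only on germs. -/
lemma IsNullGeodesic.congr {c c' : Curve} {J : Set ℝ} (hc : IsNullGeodesic R g c J)
    (hu : EqOn c.u c'.u J) (hr : EqOn c.r c'.r J) (hx : EqOn c.x c'.x J) :
    IsNullGeodesic R g c' J := by
  have eu : ∀ t ∈ J, c'.u =ᶠ[𝓝 t] c.u := fun t ht =>
    (hu.symm).eventuallyEq_of_mem (hc.isOpen.mem_nhds ht)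
  have er : ∀ t ∈ J, c'.r =ᶠ[𝓝 t] c.r := fun t ht =>
    (hr.symm).eventuallyEq_of_mem (hc.isOpen.mem_nhds ht)
  have ex : ∀ t ∈ J, c'.x =ᶠ[𝓝 t] c.x := fun t ht =>
    (hx.symm).eventuallyEq_of_mem (hc.isOpen.mem_nhds ht)
  refine ⟨hc.isOpen, hc.ordConnected, hc.u_regular.congr hu.symm, hc.r_regular.congr hr.symm,
    hc.x_regular.congr hx.symm, fun t ht => hr ht ▸ hc.mem_region t ht,
    fun t ht => hx ht ▸ hc.mem_sphere t ht, ?_, ?_⟩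
  · intro t ht
    have : c'.velocity t = c.velocity t := by
      simp only [Curve.velocity, (eu t ht).deriv_eq, (er t ht).deriv_eq, (ex t ht).deriv_eq]
    rw [this, ← hu ht, ← hr ht, ← hx ht]
    exact hc.null t ht
  · intro t ht s hs μ
    have e : ∀ μ, c'.coord s μ =ᶠ[𝓝 t] c.coord s μ := fun μ => by
      filter_upwards [eu t ht, er t ht, ex t ht] with τ h1 h2 h3
      simp only [Curve.coord, h1, h2, h3]
    have e' : (fun ν => c'.coord s ν t) = fun ν => c.coord s ν t :=
      funext fun ν => (e ν).self_of_nhds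
    rw [(e μ).deriv.deriv_eq, e']
    simp only [fun μ => (e μ).deriv_eq]
    rw [← hx ht] at hs
    exact hc.geodesic t ht s hs μ

lemma IsNullGeodesic.union {c : Curve} {J J' : Set ℝ} (hc : IsNullGeodesic R g c J)
    (hc' : IsNullGeodesic R g c J') (hJ : (J ∪ J').OrdConnected) :
    IsNullGeodesic R g c (J ∪ J') where
  isOpen := hc.isOpen.union hc'.isOpen
  ordConnected := hJ
  u_regular := hc.u_regular.union_of_isOpen hc'.u_regular hc.isOpen hc'.isOpen
  r_regular := hc.r_regular.union_of_isOpen hc'.r_regular hc.isOpen hc'.isOpen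
  x_regular := hc.x_regular.union_of_isOpen hc'.x_regular hc.isOpen hc'.isOpen
  mem_region t ht := ht.elim (hc.mem_region t) (hc'.mem_region t)
  mem_sphere t ht := ht.elim (hc.mem_sphere t) (hc'.mem_sphere t)
  null t ht := ht.elim (hc.null t) (hc'.null t)
  geodesic t ht := ht.elim (hc.geodesic t) (hc'.geodesic t)

/-- Gluing two solutions of an ordinary differential equation. -/
lemma hasDerivAt_glue {E : Type*} [NormedAddCommGroup E] [NormedSpace ℝ E] {F : E → E}
    {y α : ℝ → E} {a T b : ℝ} (haT : a < T) (hTb : T < b)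
    (hy : ∀ t ∈ Ioo a T, HasDerivAt y (F (y t)) t) (hα : ∀ t ∈ Ioo a b, HasDerivAt α (F (α t)) t)
    (hlim : Tendsto y (𝓝[<] T) (𝓝 (α T))) (hF : ContinuousAt F (α T)) :
    ∀ t ∈ Ioo a b, HasDerivAt (fun t => if t < T then y t else α t)
      (F (if t < T then y t else α t)) t := by
  intro t ht
  rcases lt_trichotomy t T with h | h | h
  · simp only [h, if_true]
    refine (hy t ⟨ht.1, h⟩).congr_of_eventuallyEq ?_
    filter_upwards [gt_mem_nhds h] with τ hτ
    simp only [if_pos (show τ < T from hτ)]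
  · subst h
    simp only [lt_irrefl, if_false]
    have hlt : (fun τ => if τ < t then y τ else α τ) =ᶠ[𝓝[<] t] y := by
      filter_upwards [self_mem_nhdsWithin] with τ hτ
      simp only [if_pos (show τ < t from hτ)]
    have hr : HasDerivWithinAt (fun τ => if τ < t then y τ else α τ) (F (α t)) (Ici t) t := by
      refine (hα t ht).hasDerivWithinAt.congr (fun τ hτ => ?_) (by simp)
      simp only [if_neg (not_lt.2 (show t ≤ τ from hτ))]
    have hl : HasDerivWithinAt (fun τ => if τ < t then y τ else α τ) (F (α t)) (Iic t) t := by
      have hd : ∀ τ ∈ Ioo a t, HasDerivAt (fun τ => if τ < t then y τ else α τ) (F (y τ)) τ := by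
        intro τ hτ
        refine (hy τ hτ).congr_of_eventuallyEq ?_
        filter_upwards [gt_mem_nhds hτ.2] with σ hσ
        simp only [if_pos (show σ < t from hσ)]
      -- At the junction the left derivative is the limit of `F (y τ)`, which by continuity of `F`
      -- is the right derivative `F (α t)`.
      refine hasDerivWithinAt_Iic_of_tendsto_deriv (s := Ioo a t)
        (fun τ hτ => (hd τ hτ).differentiableAt.differentiableWithinAt) ?_
        (Ioo_mem_nhdsLT haT) ?_
      · have : Tendsto (fun τ => if τ < t then y τ else α τ) (𝓝[<] t) (𝓝 (α t)) :=
          hlim.congr' hlt.symm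
        rw [ContinuousWithinAt]
        simp only [lt_irrefl, if_false]
        exact this.mono_left (nhdsWithin_mono _ fun τ hτ => hτ.2)
      · refine (hF.tendsto.comp hlim).congr' ?_
        filter_upwards [Ioo_mem_nhdsLT haT] with τ hτ
        exact (hd τ hτ).deriv.symm
    simpa using hl.union hr
  · simp only [not_lt.2 h.le, if_false]
    refine (hα t ht).congr_of_eventuallyEq ?_
    filter_upwards [lt_mem_nhds h] with τ hτ
    simp only [if_neg (not_lt.2 (show T < τ from hτ).le)]

end

/-! ### Continuation of geodesics with bounded velocity. -/

section

variable {R C : ℝ} {g : BondiMetric} {m : ℝ → E3 → ℝ} {h : ℝ → E3 → E3 →L[ℝ] E3 →L[ℝ] ℝ}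

/-- The state `(X, V)` of a geodesic converges at the end of a parameter interval on which its
velocity is bounded and on which it stays away from the boundary of the region. -/
lemma IsNullGeodesic.exists_tendsto_lift (H : AsymptoticallyFlat R C g m h) {c : Curve}
    {J : Set ℝ} (hc : IsNullGeodesic R g c J) {a T B r₁ : ℝ} (haT : a < T) (hJ : Ioo a T ⊆ J)
    (hr₁ : R < r₁) (hr : ∀ t ∈ Ioo a T, r₁ ≤ c.r t) (hBu : ∀ t ∈ Ioo a T, |deriv c.u t| ≤ B)
    (hBr : ∀ t ∈ Ioo a T, |deriv c.r t| ≤ B) (hBx : ∀ t ∈ Ioo a T, ‖deriv c.x t‖ ≤ B) :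
    ∃ (s : Bool) (b : ℝ) (X V : E4), a ≤ b ∧ b < T ∧ X ∈ region R ∧
      (∀ t ∈ Ioo b T, InChart s (c.x t)) ∧ Tendsto (c.lift s) (𝓝[<] T) (𝓝 X) ∧
      Tendsto (deriv (c.lift s)) (𝓝[<] T) (𝓝 V) := by
  have hne : (𝓝[<] T).NeBot := inferInstance
  have hB0 : 0 ≤ B := by
    obtain ⟨t, ht⟩ := nonempty_Ioo.2 haT
    exact (abs_nonneg _).trans (hBu t ht)
  have hIoo : Ioo a T ∈ 𝓝[<] T := Ioo_mem_nhdsLT haT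
  obtain ⟨u, hu⟩ := exists_tendsto_of_deriv_bounded haT (f := c.u) (fun t ht =>
    ((hc.contDiffAt_u (hJ ht)).differentiableAt (by norm_num)).hasDerivAt) hBu
  obtain ⟨r, hr'⟩ := exists_tendsto_of_deriv_bounded haT (f := c.r) (fun t ht =>
    ((hc.contDiffAt_r (hJ ht)).differentiableAt (by norm_num)).hasDerivAt) hBr
  obtain ⟨x, hx⟩ := exists_tendsto_of_deriv_bounded haT (f := c.x) (fun t ht =>
    ((hc.contDiffAt_x (hJ ht)).differentiableAt (by norm_num)).hasDerivAt) hBx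
  have hxn : ‖x‖ = 1 := by
    refine tendsto_nhds_unique hx.norm ?_
    refine tendsto_const_nhds.congr' ?_
    filter_upwards [hIoo] with t ht
    exact (hc.mem_sphere t (hJ ht)).symm
  have hrr : r₁ ≤ r := ge_of_tendsto hr' (by filter_upwards [hIoo] with t ht using hr t ht)
  obtain ⟨s, hs, -⟩ := exists_chart hxn
  set X : E4 := quad u r (angularCoord s x) with hX
  have hXR : X ∈ region R := hr₁.trans_le hrr
  have hlift : Tendsto (c.lift s) (𝓝[<] T) (𝓝 X) := by
    have hy : Tendsto (fun t => angularCoord s (c.x t)) (𝓝[<] T) (𝓝 (angularCoord s x)) :=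
      (contDiffAt_angularCoord hs (n := 0)).continuousAt.tendsto.comp hx
    rw [tendsto_pi_nhds] at hy ⊢
    intro i
    fin_cases i
    · exact hu
    · exact hr'
    · exact hy 0
    · exact hy 1
  have hch : ∀ᶠ t in 𝓝[<] T, InChart s (c.x t) := hx.eventually ((isOpen_inChart s).mem_nhds hs)
  -- the coordinate velocity is bounded
  set D : ℝ := ‖fderiv ℝ (angularCoord s) x‖ + 1 with hD
  have hD0 : 0 ≤ D := by positivity
  have hfd : ∀ᶠ t in 𝓝[<] T, ‖fderiv ℝ (angularCoord s) (c.x t)‖ ≤ D := by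
    have h1 : ContinuousAt (fderiv ℝ (angularCoord s)) x :=
      ((contDiffAt_angularCoord hs (n := 1)).fderiv_right (m := 0) (by norm_num)).continuousAt
    exact (h1.norm.tendsto.comp hx).eventually (ge_mem_nhds (by rw [hD]; linarith))
  have hVb : ∀ᶠ t in 𝓝[<] T, ‖deriv (c.lift s) t‖ ≤ B + D * B := by
    filter_upwards [hIoo, hch, hfd] with t ht h1 h2
    have hd := (hc.contDiffAt_lift (hJ ht) h1).of_le (show (1 : WithTop ℕ∞) ≤ 2 by norm_num)
    have hang : ∀ i : Fin 2, |deriv (fun τ => angularCoord s (c.x τ) i) t| ≤ D * B := by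
      intro i
      have e1 : HasDerivAt (fun τ => angularCoord s (c.x τ))
          (fderiv ℝ (angularCoord s) (c.x t) (deriv c.x t)) t := ((contDiffAt_angularCoord h1 (n := 1)).differentiableAt
        (by norm_num)).hasFDerivAt.comp_hasDerivAt t
          ((hc.contDiffAt_x (hJ ht)).differentiableAt (by norm_num)).hasDerivAt
      rw [((hasDerivAt_pi.1 e1) i).deriv]
      have e2 := norm_le_pi_norm (fderiv ℝ (angularCoord s) (c.x t) (deriv c.x t)) i
      have e3 := (fderiv ℝ (angularCoord s) (c.x t)).le_opNorm (deriv c.x t)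
      exact (e2.trans e3).trans (mul_le_mul h2 (hBx t ht) (norm_nonneg _) hD0)
    refine (pi_norm_le_iff_of_nonneg (by positivity)).2 fun μ => ?_
    rw [← deriv_apply_of_contDiffAt hd μ, Real.norm_eq_abs]
    have hDB : 0 ≤ D * B := by positivity
    fin_cases μ
    · exact (hBu t ht).trans (by linarith)
    · exact (hBr t ht).trans (by linarith)
    · exact (hang 0).trans (by linarith)
    · exact (hang 1).trans (by linarith)
  -- the coordinate acceleration is bounded
  have hG : ∃ G : ℝ, ∀ᶠ t in 𝓝[<] T, ∀ μ α β, |g.christoffel s (c.lift s t) μ α β| ≤ G := by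
    have h1 : ∀ μ α β, ∀ᶠ t in 𝓝[<] T,
        |g.christoffel s (c.lift s t) μ α β| ≤ |g.christoffel s X μ α β| + 1 := fun μ α β =>
      ((H.lipschitzNear_christoffel s hXR μ α β).continuousAt.abs.tendsto.comp hlift).eventually
        (ge_mem_nhds (by linarith))
    refine ⟨∑ μ, ∑ α, ∑ β, (|g.christoffel s X μ α β| + 1), ?_⟩
    simp only [← eventually_all] at h1
    filter_upwards [h1] with t ht μ α β
    refine (ht μ α β).trans ?_
    have hn : ∀ μ α β, 0 ≤ |g.christoffel s X μ α β| + 1 := fun μ α β => by positivity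
    calc |g.christoffel s X μ α β| + 1
        ≤ ∑ β, (|g.christoffel s X μ α β| + 1) :=
          Finset.single_le_sum (f := fun β => |g.christoffel s X μ α β| + 1)
            (fun β _ => hn μ α β) (Finset.mem_univ β)
      _ ≤ ∑ α, ∑ β, (|g.christoffel s X μ α β| + 1) :=
          Finset.single_le_sum (f := fun α => ∑ β, (|g.christoffel s X μ α β| + 1))
            (fun α _ => Finset.sum_nonneg fun β _ => hn μ α β) (Finset.mem_univ α)
      _ ≤ _ := Finset.single_le_sum (f := fun μ => ∑ α, ∑ β, (|g.christoffel s X μ α β| + 1))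
            (fun μ _ => Finset.sum_nonneg fun α _ => Finset.sum_nonneg fun β _ => hn μ α β)
            (Finset.mem_univ μ)
  obtain ⟨G, hG⟩ := hG
  obtain ⟨b, hbT, hb⟩ := mem_nhdsLT_iff_exists_Ico_subset.1 
    (inter_mem hIoo (inter_mem hch (inter_mem hVb hG)))
  have hab : a ≤ b := (hb ⟨le_rfl, hbT⟩).1.1.le
  have hb' : Ioo b T ⊆ _ := fun t ht => hb (Ioo_subset_Ico_self ht)
  obtain ⟨V, hV⟩ := exists_tendsto_of_deriv_bounded (f := deriv (c.lift s))
    (B := ∑ _α : Fin 4, ∑ _β : Fin 4, G * (B + D * B) * (B + D * B)) hbT (fun t ht =>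
      ((contDiffAt_deriv (hc.contDiffAt_lift (hJ (hb' ht).1) (hb' ht).2.1)).differentiableAt
        (by norm_num)).hasDerivAt) fun t ht => by
      obtain ⟨h1, h2, h3, h4⟩ := hb' ht
      have hG0 : 0 ≤ G := (abs_nonneg _).trans (h4 0 0 0)
      have hEL := hc.eulerLagrange_lift H (hJ h1) h2
      rw [H.eulerLagrange_iff_acceleration s (hc.lift_mem_region (hJ h1))] at hEL
      rw [hEL]
      refine (pi_norm_le_iff_of_nonneg (by positivity)).2 fun μ => ?_
      rw [BondiMetric.acceleration, norm_neg]
      refine (norm_sum_le _ _).trans (Finset.sum_le_sum fun α _ => (norm_sum_le _ _).trans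
        (Finset.sum_le_sum fun β _ => ?_))
      rw [norm_mul, norm_mul]
      have h5 : ‖deriv (c.lift s) t α‖ ≤ B + D * B := (norm_le_pi_norm _ α).trans h3
      have h6 : ‖deriv (c.lift s) t β‖ ≤ B + D * B := (norm_le_pi_norm _ β).trans h3
      have h7 : ‖g.christoffel s (c.lift s t) μ α β‖ ≤ G := h4 μ α β
      gcongr
  exact ⟨s, b, X, V, hab, hbT, hXR, fun t ht => (hb' ht).2.1, hlift, hV⟩

/-- A geodesic whose velocity stays bounded, and which stays away from the boundary of the region,
can be continued. -/
lemma IsNullGeodesic.not_futureInextendible (H : AsymptoticallyFlat R C g m h) {c : Curve}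
    {J : Set ℝ} (hc : IsNullGeodesic R g c J) {a T B r₁ : ℝ} (haT : a < T) (hJ : Ioo a T ⊆ J)
    (hJT : J ⊆ Iio T)
    (hr₁ : R < r₁) (hr : ∀ t ∈ Ioo a T, r₁ ≤ c.r t) (hBu : ∀ t ∈ Ioo a T, |deriv c.u t| ≤ B)
    (hBr : ∀ t ∈ Ioo a T, |deriv c.r t| ≤ B) (hBx : ∀ t ∈ Ioo a T, ‖deriv c.x t‖ ≤ B) :
    ¬ FutureInextendible R g c J := by
  obtain ⟨s, b, X₀, V₀, hab, hbT, hXR, hch, hX, hV⟩ :=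
    hc.exists_tendsto_lift H haT hJ hr₁ hr hBu hBr hBx
  have hbJ : Ioo b T ⊆ J := (Ioo_subset_Ioo_left hab).trans hJ
  -- The first-order system for position and velocity; the limits at `T` are its initial values.
  set F : E4 × E4 → E4 × E4 := fun p => (p.2, g.acceleration s p) with hF
  have hFlip : ∀ p : E4 × E4, p.1 ∈ region R → LipschitzNear F p := fun p hp =>
    (LipschitzNear.of_contDiffAt contDiff_snd.contDiffAt).prodMk
      (H.lipschitzNear_acceleration s hp)
  obtain ⟨α, hα0, ε, hε, hα⟩ := (hFlip (X₀, V₀) hXR).exists_solution T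
  have hαR : ∀ᶠ t in 𝓝 T, (α t).1 ∈ region R := by
    have h1 : ContinuousAt (fun t => (α t).1) T :=
      (hα T ⟨by linarith, by linarith⟩).continuousAt.fst
    exact h1.eventually ((isOpen_region R).mem_nhds (by simpa only [hα0] using hXR))
  obtain ⟨δ, hδ, hαR⟩ := Metric.eventually_nhds_iff.1 hαR
  set η : ℝ := min ε δ with hη
  have hη0 : 0 < η := lt_min hε hδ
  set a' : ℝ := max b (T - η) with ha'
  have ha'T : a' < T := max_lt hbT (by linarith)
  have ha'b : b ≤ a' := le_max_left _ _
  set I : Set ℝ := Ioo a' (T + η) with hI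
  set y : ℝ → E4 × E4 := fun t => (c.lift s t, deriv (c.lift s) t) with hy
  have hIJ : Ioo a' T ⊆ J := (Ioo_subset_Ioo_left ha'b).trans hbJ
  have hyd : ∀ t ∈ Ioo a' T, HasDerivAt y (F (y t)) t := by
    intro t ht
    have htJ := hIJ ht
    have hts := hch t (Ioo_subset_Ioo_left ha'b ht)
    have h1 := hc.contDiffAt_lift htJ hts
    have hEL := hc.eulerLagrange_lift H htJ hts
    rw [H.eulerLagrange_iff_acceleration s (hc.lift_mem_region htJ)] at hEL
    have h2 := ((contDiffAt_deriv h1).differentiableAt (by norm_num)).hasDerivAt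
    rw [hEL] at h2
    exact (h1.differentiableAt (by norm_num)).hasDerivAt.prodMk h2
  have hαI : ∀ t ∈ I, HasDerivAt α (F (α t)) t := fun t ht =>
    hα t ⟨by linarith [min_le_left ε δ, le_max_right b (T - η), ht.1],
      by linarith [min_le_left ε δ, ht.2]⟩
  have hglue := hasDerivAt_glue ha'T (by linarith) hyd hαI
    (by rw [hα0]; exact hX.prodMk_nhds hV)
    (by rw [hα0]; exact (hFlip (X₀, V₀) hXR).continuousAt)
  set z : ℝ → E4 × E4 := fun t => if t < T then y t else α t with hz
  have hzR : ∀ t ∈ I, (z t).1 ∈ region R := by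
    intro t ht
    by_cases h1 : t < T
    · simp only [hz, if_pos h1]; exact hc.lift_mem_region (hIJ ⟨ht.1, h1⟩)
    · simp only [hz, if_neg h1]
      refine hαR ?_
      rw [Real.dist_eq, abs_lt]
      constructor <;> linarith [min_le_right ε δ, ht.2, not_lt.1 h1]
  have hIo : IsOpen I := isOpen_Ioo
  have hz1 : ∀ t ∈ I, HasDerivAt (fun t => (z t).1) (z t).2 t := fun t ht => (hglue t ht).fst
  have hz2 : ∀ t ∈ I, HasDerivAt (fun t => (z t).2) (g.acceleration s (z t)) t := fun t ht =>
    (hglue t ht).snd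
  have hd1 : EqOn (deriv fun t => (z t).1) (fun t => (z t).2) I := fun t ht => (hz1 t ht).deriv
  have hd2 : EqOn (deriv (deriv fun t => (z t).1)) (fun t => g.acceleration s (z t)) I := by
    intro t ht
    have : deriv (fun t => (z t).1) =ᶠ[𝓝 t] fun t => (z t).2 :=
      hd1.eventuallyEq_of_mem (hIo.mem_nhds ht)
    rw [this.deriv_eq]
    exact (hz2 t ht).deriv
  have hC1 : ContDiffOn ℝ 1 (fun t => (z t).2) I := by
    rw [show (1 : WithTop ℕ∞) = 0 + 1 by norm_num, contDiffOn_succ_iff_deriv_of_isOpen hIo]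
    refine ⟨fun t ht => (hz2 t ht).differentiableAt.differentiableWithinAt, by simp, ?_⟩
    rw [contDiffOn_zero]
    refine ContinuousOn.congr (f := fun t => g.acceleration s (z t)) ?_
      fun t ht => (hz2 t ht).deriv
    intro t ht
    exact ((H.lipschitzNear_acceleration s (hzR t ht)).continuousAt.comp
      (hglue t ht).continuousAt).continuousWithinAt
  have hC2 : ContDiffOn ℝ 2 (fun t => (z t).1) I := by
    rw [show (2 : WithTop ℕ∞) = 1 + 1 by norm_num, contDiffOn_succ_iff_deriv_of_isOpen hIo]
    exact ⟨fun t ht => (hz1 t ht).differentiableAt.differentiableWithinAt, by simp, hC1.congr hd1⟩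
  have hEL : ∀ t ∈ I, eulerLagrange (fun Y => bilin (g.comp s Y)) (z t).1
      (deriv (fun t => (z t).1) t) (deriv (deriv fun t => (z t).1) t) = 0 := by
    intro t ht
    rw [H.eulerLagrange_iff_acceleration s (hzR t ht), hd1 ht, hd2 ht]
  have hnull : ∀ t ∈ I, bilin (g.comp s (z t).1) (deriv (fun t => (z t).1) t)
      (deriv (fun t => (z t).1) t) = 0 := by
    -- The null condition propagates: the square of the velocity is constant on `I`, and it vanishes
    -- before `T`, where the solution is the old geodesic.
    have hconst : ∀ t ∈ I, HasDerivAt (fun t => bilin (g.comp s (z t).1) (z t).2 (z t).2) 0 t := by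
      intro t ht
      refine hasDerivAt_metric_velocity (G := fun Y => bilin (g.comp s Y)) (X := fun t => (z t).1)
        (V := fun t => (z t).2)
        (H.differentiableAt_bilin s (hzR t ht)) (hz1 t ht) (hz2 t ht) (H.bilin_symm s (hzR t ht)) ?_
      rw [(H.eulerLagrange_iff_acceleration s (hzR t ht) _ _).2 rfl]
      rfl
    intro t ht
    simp only [hd1 ht]
    set t₁ : ℝ := (a' + T) / 2 with ht₁
    have ht₁I : t₁ ∈ Ioo a' T := ⟨by linarith, by linarith⟩
    have ht₁I' : t₁ ∈ I := ⟨ht₁I.1, by linarith [ht₁I.2]⟩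
    have e := hIo.is_const_of_deriv_eq_zero isPreconnected_Ioo
      (fun τ hτ => (hconst τ hτ).differentiableAt.differentiableWithinAt)
      (fun τ hτ => (hconst τ hτ).deriv) ht ht₁I'
    rw [e]
    simp only [hz, if_pos ht₁I.2]
    exact hc.null_lift (hIJ ht₁I) (hch t₁ (Ioo_subset_Ioo_left ha'b ht₁I))
  have hnew := H.isNullGeodesic_curveOfLift hIo ordConnected_Ioo hC2 hzR hnull hEL
  set c₀ := curveOfLift s fun t => (z t).1 with hc₀
  -- Before `T` the old curve is kept, so that `c'` agrees with `c` on all of `J`, also where `c`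
  -- lies outside chart `s`.
  set c' : Curve := ⟨fun t => if t < T then c.u t else c₀.u t,
    fun t => if t < T then c.r t else c₀.r t, fun t => if t < T then c.x t else c₀.x t⟩ with hc'
  have hcc' : IsNullGeodesic R g c' J := hc.congr
    (fun t ht => (if_pos (hJT ht)).symm) (fun t ht => (if_pos (hJT ht)).symm)
    (fun t ht => (if_pos (hJT ht)).symm)
  have hzlt : ∀ t, t < T → (z t).1 = c.lift s t := fun t ht => by simp only [hz, if_pos ht, hy]
  have hcc₀ : IsNullGeodesic R g c' I := by
    refine hnew.congr (fun t ht => ?_) (fun t ht => ?_) (fun t ht => ?_)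
    · by_cases h1 : t < T
      · simp only [hc', if_pos h1]; simp only [hc₀, curveOfLift, hzlt t h1]; rfl
      · simp only [hc', if_neg h1]
    · by_cases h1 : t < T
      · simp only [hc', if_pos h1]; simp only [hc₀, curveOfLift, hzlt t h1]; rfl
      · simp only [hc', if_neg h1]
    · by_cases h1 : t < T
      · simp only [hc', if_pos h1]; simp only [hc₀, curveOfLift, hzlt t h1]
        have ht' : t ∈ Ioo a' T := ⟨ht.1, h1⟩
        exact hc.stereo_lift (hIJ ht') (hch t (Ioo_subset_Ioo_left ha'b ht'))
      · simp only [hc', if_neg h1]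
  have hoc : (J ∪ I).OrdConnected := by
    have h1 : ((a' + T) / 2) ∈ Ioo a' T := ⟨by linarith, by linarith⟩
    have h2 : IsPreconnected (J ∪ I) := IsPreconnected.union ((a' + T) / 2) (hIJ h1)
      ⟨h1.1, by linarith [h1.2]⟩ hc.ordConnected.isPreconnected isPreconnected_Ioo
    exact h2.ordConnected
  intro hinext
  exact hinext c' (J ∪ I) (hcc'.union hcc₀ hoc) subset_union_left
    (fun t ht => (if_pos (hJT ht)).symm) (fun t ht => (if_pos (hJT ht)).symm)
    (fun t ht => (if_pos (hJT ht)).symm) ⟨T, Or.inr ⟨ha'T, by linarith⟩, fun t ht => hJT ht⟩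

end

/-! ### Almost straight motion in the (u, r)-plane. -/

section

lemma monotoneOn_of_hasDerivAt_nonneg {D : Set ℝ} (hD : Convex ℝ D) {f f' : ℝ → ℝ}
    (hf : ∀ t ∈ D, HasDerivAt f (f' t) t) (hf' : ∀ t ∈ D, 0 ≤ f' t) : MonotoneOn f D :=
  monotoneOn_of_deriv_nonneg hD (fun t ht => (hf t ht).continuousAt.continuousWithinAt)
    (fun t ht => (hf t (interior_subset ht)).differentiableAt.differentiableWithinAt)
    fun t ht => by rw [(hf t (interior_subset ht)).deriv]; exact hf' t (interior_subset ht)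

lemma antitoneOn_of_hasDerivAt_nonpos {D : Set ℝ} (hD : Convex ℝ D) {f f' : ℝ → ℝ}
    (hf : ∀ t ∈ D, HasDerivAt f (f' t) t) (hf' : ∀ t ∈ D, f' t ≤ 0) : AntitoneOn f D :=
  antitoneOn_of_deriv_nonpos hD (fun t ht => (hf t ht).continuousAt.continuousWithinAt)
    (fun t ht => (hf t (interior_subset ht)).differentiableAt.differentiableWithinAt)
    fun t ht => by rw [(hf t (interior_subset ht)).deriv]; exact hf' t (interior_subset ht)

/-- A motion in the `(u, r)`-plane whose slope `1 + dr/du` is, up to small relative errors, a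
function `Q` that satisfies the equation of straight lines in Minkowski space, as long as
`r₂ ≤ r` and `1 + dr/du ≥ 0.55`. -/
structure AlmostStraight (r₂ : ℝ) (J : Set ℝ) (u r p q Q : ℝ → ℝ) : Prop where
  r₂_pos : 0 < r₂
  ordConnected : J.OrdConnected
  zero_mem : (0 : ℝ) ∈ J
  u_deriv : ∀ t ∈ J, HasDerivAt u (p t) t
  r_deriv : ∀ t ∈ J, HasDerivAt r (q t) t
  p_diff : ∀ t ∈ J, DifferentiableAt ℝ p t
  q_cont : ∀ t ∈ J, ContinuousAt q t
  estimate : ∀ t ∈ J, r₂ ≤ r t → 0 < p t → 0.55 ≤ 1 + q t / p t →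
    DifferentiableAt ℝ Q t ∧
    0.99 * ((2 * (1 + q t / p t) - 1) * (1 + q t / p t) * p t / r t) ≤ deriv Q t ∧
    deriv Q t ≤ 1.01 * ((2 * (1 + q t / p t) - 1) * (1 + q t / p t) * p t / r t) ∧
    |Q t - (1 + q t / p t)| ≤ (1 + q t / p t) / 1000 ∧
    |deriv p t| ≤ 3 * (p t * (1 + q t / p t)) * p t / r t

namespace AlmostStraight

variable {r₂ : ℝ} {J : Set ℝ} {u r p q Q : ℝ → ℝ} (H : AlmostStraight r₂ J u r p q Q)
include H

section
variable {I : Set ℝ} (hI : Convex ℝ I) (hIJ : I ⊆ J) (hr : ∀ t ∈ I, r₂ ≤ r t)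
  (hp : ∀ t ∈ I, 0 < p t) (hq : ∀ t ∈ I, 0.55 ≤ 1 + q t / p t)
include hI hIJ hr hp hq

omit hI in
lemma Q_bounds : ∀ t ∈ I, 0.999 * (1 + q t / p t) ≤ Q t ∧ Q t ≤ 1.001 * (1 + q t / p t) := by
  intro t ht
  obtain ⟨-, -, -, h4, -⟩ := H.estimate t (hIJ ht) (hr t ht) (hp t ht) (hq t ht)
  rw [abs_le] at h4
  constructor <;> linarith

omit hI in
lemma Q_pos : ∀ t ∈ I, 0.5 ≤ Q t := by
  intro t ht
  have h1 := H.Q_bounds hIJ hr hp hq t ht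
  have h2 := hq t ht
  linarith

/-- The factor 2a − 1 is positive for a ≥ 0.55: a ray that is not almost radially ingoing turns
outwards. -/
lemma monotoneOn_Q : MonotoneOn Q I := by
  refine monotoneOn_of_hasDerivAt_nonneg hI (f' := deriv Q) (fun t ht =>
    (H.estimate t (hIJ ht) (hr t ht) (hp t ht) (hq t ht)).1.hasDerivAt) fun t ht => ?_
  obtain ⟨-, h2, -⟩ := H.estimate t (hIJ ht) (hr t ht) (hp t ht) (hq t ht)
  refine le_trans ?_ h2
  have h3 := hq t ht
  have h4 := hp t ht
  have h5 := H.r₂_pos.trans_le (hr t ht)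
  have : 0 ≤ 2 * (1 + q t / p t) - 1 := by linarith
  positivity

/-- This limits the decrease of r to a fixed factor, since 0 < 3/Q ≤ 6. For exactly straight motion
the derivative is ((a − 1) + 3(2a − 1)/a) p/r, which is positive for a ≥ 0.55. -/
lemma monotoneOn_log_r : MonotoneOn (fun t => Real.log (r t) - 3 / Q t) I := by
  refine monotoneOn_of_hasDerivAt_nonneg hI
    (f' := fun t => q t / r t + 3 * deriv Q t / Q t ^ 2) (fun t ht => ?_) fun t ht => ?_
  · have h1 := (H.estimate t (hIJ ht) (hr t ht) (hp t ht) (hq t ht)).1.hasDerivAt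
    have h2 := H.Q_pos hIJ hr hp hq t ht
    have h5 := H.r₂_pos.trans_le (hr t ht)
    refine (((H.r_deriv t (hIJ ht)).log h5.ne').sub
      ((hasDerivAt_const t (3 : ℝ)).div h1 (by linarith))).congr_deriv ?_
    ring
  · obtain ⟨-, h2, -⟩ := H.estimate t (hIJ ht) (hr t ht) (hp t ht) (hq t ht)
    obtain ⟨h6, h7⟩ := H.Q_bounds hIJ hr hp hq t ht
    have h8 := H.Q_pos hIJ hr hp hq t ht
    have h3 := hq t ht
    have h4 := hp t ht
    have h5 := H.r₂_pos.trans_le (hr t ht)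
    have hqa : q t = (1 + q t / p t - 1) * p t := by field_simp; ring
    have hqa' : q t / r t = (1 + q t / p t - 1) * (p t / r t) := by
      rw [← mul_div_assoc, ← hqa]
    rw [hqa']
    set a := 1 + q t / p t
    have e : 0.99 * ((2 * a - 1) * a * p t / r t) = 0.99 * ((2 * a - 1) * a) * (p t / r t) := by
      ring
    rw [e] at h2
    have hw : 0 < p t / r t := by positivity
    set w := p t / r t
    have hQ2 : 0 < Q t ^ 2 := by positivity
    rw [← sub_neg_eq_add, sub_nonneg, neg_le_iff_add_nonneg, ← sub_nonneg]
    -- The two terms compete only during inward motion, a < 1. Here 2.97 = 3 · 0.99, and 1.003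
    -- dominates 1.001².
    have hmain : 0 ≤ (a - 1) * Q t ^ 2 + 2.97 * ((2 * a - 1) * a) := by
      rcases le_or_gt 1 a with h | h
      · have : 0 ≤ a - 1 := by linarith
        have : 0 ≤ 2 * a - 1 := by linarith
        positivity
      · have h9 : Q t ^ 2 ≤ 1.003 * a ^ 2 := by nlinarith
        have h10 : (1 - a) * Q t ^ 2 ≤ (1 - a) * (1.003 * a ^ 2) :=
          mul_le_mul_of_nonneg_left h9 (by linarith)
        have h11 : 0 ≤ a * (2.97 * (2 * a - 1) - (1 - a) * (1.003 * a)) := by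
          refine mul_nonneg (by linarith) ?_
          nlinarith
        nlinarith
    have : 0 ≤ ((a - 1) * Q t ^ 2 + 2.97 * ((2 * a - 1) * a)) * w / Q t ^ 2 := by positivity
    have h12 : 3 * (0.99 * ((2 * a - 1) * a) * w) / Q t ^ 2 ≤ 3 * deriv Q t / Q t ^ 2 := by
      gcongr
    have h13 : ((a - 1) * Q t ^ 2 + 2.97 * ((2 * a - 1) * a)) * w / Q t ^ 2
      = (a - 1) * w + 3 * (0.99 * ((2 * a - 1) * a) * w) / Q t ^ 2 := by
      field_simp
      ring
    linarith

/-- In Minkowski space r/a + u is constant; replacing the coefficient 1 by 0.9 absorbs the relative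
errors. Since r/Q > 0, this bounds u from above. -/
lemma antitoneOn_u : AntitoneOn (fun t => r t / Q t + 0.9 * u t) I := by
  refine antitoneOn_of_hasDerivAt_nonpos hI
    (f' := fun t => (q t * Q t - r t * deriv Q t) / Q t ^ 2 + 0.9 * p t) (fun t ht => ?_)
    fun t ht => ?_
  · have h1 := (H.estimate t (hIJ ht) (hr t ht) (hp t ht) (hq t ht)).1.hasDerivAt
    have h2 := H.Q_pos hIJ hr hp hq t ht
    exact ((H.r_deriv t (hIJ ht)).div h1 (by linarith)).add ((H.u_deriv t (hIJ ht)).const_mul 0.9)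
  · obtain ⟨-, h2, -⟩ := H.estimate t (hIJ ht) (hr t ht) (hp t ht) (hq t ht)
    obtain ⟨h6, h7⟩ := H.Q_bounds hIJ hr hp hq t ht
    have h8 := H.Q_pos hIJ hr hp hq t ht
    have h3 := hq t ht
    have h4 := hp t ht
    have h5 := H.r₂_pos.trans_le (hr t ht)
    have hqa : q t = (1 + q t / p t - 1) * p t := by field_simp; ring
    rw [hqa]
    set a := 1 + q t / p t
    have h9 : 0.99 * ((2 * a - 1) * a * p t) ≤ r t * deriv Q t := by
      have : 0.99 * ((2 * a - 1) * a * p t) = r t * (0.99 * ((2 * a - 1) * a * p t / r t)) := by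
        field_simp
      rw [this]
      exact mul_le_mul_of_nonneg_left h2 h5.le
    have hQ2 : 0 < Q t ^ 2 := by positivity
    have h10 : ((a - 1) * p t * Q t - r t * deriv Q t) / Q t ^ 2 ≤ - 0.9 * p t := by
      rw [div_le_iff₀ hQ2]
      have h11 : (a - 1) * Q t + 0.9 * Q t ^ 2 ≤ 0.99 * ((2 * a - 1) * a) := by
        have : Q t ^ 2 ≤ 1.003 * a ^ 2 := by nlinarith
        rcases le_or_gt 1 a with h | h
        · have : (a - 1) * Q t ≤ (a - 1) * (1.001 * a) :=
            mul_le_mul_of_nonneg_left h7 (by linarith)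
          nlinarith
        · have : (1 - a) * (0.999 * a) ≤ (1 - a) * Q t :=
            mul_le_mul_of_nonneg_left h6 (by linarith)
          nlinarith
      have h12 := mul_le_mul_of_nonneg_right h11 h4.le
      linarith
    linarith

/-- This bounds the slope whenever r and u are bounded. The logarithmic derivative of Q is about (2a
− 1) p/r, which is at most 3q/r + 2p/r = (3a − 1) p/r. -/
lemma antitoneOn_log_Q :
    AntitoneOn (fun t => Real.log (Q t) - 3 * Real.log (r t) - 2 / r₂ * u t) I := by
  refine antitoneOn_of_hasDerivAt_nonpos hI
    (f' := fun t => deriv Q t / Q t - 3 * (q t / r t) - 2 / r₂ * p t) (fun t ht => ?_)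
    fun t ht => ?_
  · have h1 := (H.estimate t (hIJ ht) (hr t ht) (hp t ht) (hq t ht)).1.hasDerivAt
    have h2 := H.Q_pos hIJ hr hp hq t ht
    have h5 := H.r₂_pos.trans_le (hr t ht)
    exact ((h1.log (by linarith)).sub (((H.r_deriv t (hIJ ht)).log h5.ne').const_mul 3)).sub
      ((H.u_deriv t (hIJ ht)).const_mul (2 / r₂))
  · obtain ⟨-, -, h2, -⟩ := H.estimate t (hIJ ht) (hr t ht) (hp t ht) (hq t ht)
    obtain ⟨h6, h7⟩ := H.Q_bounds hIJ hr hp hq t ht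
    have h8 := H.Q_pos hIJ hr hp hq t ht
    have h3 := hq t ht
    have h4 := hp t ht
    have h5 := H.r₂_pos.trans_le (hr t ht)
    have hqa : q t = (1 + q t / p t - 1) * p t := by field_simp; ring
    have hqa' : q t / r t = (1 + q t / p t - 1) * (p t / r t) := by
      rw [← mul_div_assoc, ← hqa]
    have hr2 : 2 * (p t / r t) ≤ 2 / r₂ * p t := by
      have h9 : p t / r t ≤ p t / r₂ := div_le_div_of_nonneg_left h4.le H.r₂_pos (hr t ht)
      calc 2 * (p t / r t) ≤ 2 * (p t / r₂) := by linarith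
        _ = _ := by ring
    rw [hqa']
    set a := 1 + q t / p t
    have e : 1.01 * ((2 * a - 1) * a * p t / r t) = 1.01 * ((2 * a - 1) * a) * (p t / r t) := by
      ring
    rw [e] at h2
    have hw : 0 < p t / r t := by positivity
    set w := p t / r t
    have hQ : 0 < Q t := by linarith
    have h9 : deriv Q t / Q t ≤ 1.02 * (2 * a - 1) * w := by
      rw [div_le_iff₀ hQ]
      have h10 : 1.01 * a ≤ 1.02 * Q t := by linarith
      have h11 : 0 ≤ (2 * a - 1) * w := mul_nonneg (by linarith) hw.le
      nlinarith [mul_le_mul_of_nonneg_left h10 h11]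
    nlinarith

end

/-- A continuity argument. At a first time where one of the strict inequalities fails, the weak ones
hold up to and including that time, so the monotone quantities are available and improve the bounds
on r and on the slope to strict ones; a Gronwall estimate excludes p = 0. The margins e⁶ and 0.57
against 0.55 pay for this. -/
lemma good (hr0 : Real.exp 6 * r₂ < r 0) (hp0 : 0 < p 0) (hq0 : 0.57 ≤ 1 + q 0 / p 0) :
    ∀ t ∈ J, 0 ≤ t → r₂ < r t ∧ 0 < p t ∧ 0.55 < 1 + q t / p t := by
  by_contra! hcon
  obtain ⟨t₁, ht₁, h0t₁, hbad⟩ := hcon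
  have hsub : Icc 0 t₁ ⊆ J := H.ordConnected.out H.zero_mem ht₁
  have hrc : ContinuousOn r (Icc 0 t₁) := fun t ht =>
    (H.r_deriv t (hsub ht)).continuousAt.continuousWithinAt
  have hpc : ContinuousOn p (Icc 0 t₁) := fun t ht =>
    (H.p_diff t (hsub ht)).continuousAt.continuousWithinAt
  have hqc : ContinuousOn q (Icc 0 t₁) := fun t ht =>
    (H.q_cont t (hsub ht)).continuousWithinAt
  have hequiv : ∀ t, 0 < p t → (0.55 < 1 + q t / p t ↔ 0 < q t + 0.45 * p t) := by
    intro t ht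
    have : 1 + q t / p t = (p t + q t) / p t := by field_simp
    rw [this, lt_div_iff₀ ht]
    constructor <;> intro h <;> linarith
  -- The slope condition is multiplied by p, so that it remains continuous even where p might
  -- vanish.
  set f : ℝ → ℝ := fun t => min (r t - r₂) (min (p t) (q t + 0.45 * p t)) with hf
  have hfc : ContinuousOn f (Icc 0 t₁) :=
    ContinuousOn.inf (hrc.sub continuousOn_const)
      (hpc.inf (hqc.add (continuousOn_const.mul hpc)))
  have hgood : ∀ t, 0 < f t ↔ r₂ < r t ∧ 0 < p t ∧ 0.55 < 1 + q t / p t := by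
    intro t
    simp only [hf, lt_min_iff, sub_pos]
    constructor
    · rintro ⟨h1, h2, h3⟩; exact ⟨h1, h2, (hequiv t h2).2 h3⟩
    · rintro ⟨h1, h2, h3⟩; exact ⟨h1, h2, (hequiv t h2).1 h3⟩
  have hr₂ := H.r₂_pos
  have he6 : 1 < Real.exp 6 := Real.one_lt_exp_iff.2 (by norm_num)
  have hf0 : 0 < f 0 := (hgood 0).2 ⟨by nlinarith, hp0, by linarith⟩
  set S : Set ℝ := Icc 0 t₁ ∩ f ⁻¹' Iic 0 with hS
  have hSc : IsCompact S :=
    isCompact_Icc.of_isClosed_subset (hfc.preimage_isClosed_of_isClosed isClosed_Icc isClosed_Iic)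
      inter_subset_left
  have hSne : S.Nonempty := by
    refine ⟨t₁, ⟨h0t₁, le_rfl⟩, ?_⟩
    by_contra hcon
    have h1 := (hgood t₁).1 (not_le.1 hcon)
    exact absurd h1.2.2 (not_lt.2 (hbad h1.1 h1.2.1))
  set τ := sInf S with hτ
  have hτS : τ ∈ S := hSc.sInf_mem hSne
  have hτ0 : 0 < τ := by
    rcases hτS.1.1.lt_or_eq with h | h
    · exact h
    · exfalso
      have := hτS.2
      rw [← h] at this
      exact absurd hf0 (not_lt.2 this)
  have hlt : ∀ t ∈ Ico 0 τ, 0 < f t := by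
    intro t ht
    by_contra hcon
    have : t ∈ S := ⟨⟨ht.1, ht.2.le.trans hτS.1.2⟩, not_lt.1 hcon⟩
    exact absurd (csInf_le hSc.bddBelow this) (not_le.2 ht.2)
  have hτI : Icc 0 τ ⊆ Icc 0 t₁ := Icc_subset_Icc_right hτS.1.2
  have hIJ : Icc 0 τ ⊆ J := hτI.trans hsub
  have hfnn : 0 ≤ f τ := by
    have hct : Tendsto f (𝓝[<] τ) (𝓝 (f τ)) := by
      have h1 : ContinuousWithinAt f (Icc 0 t₁) τ := hfc τ hτS.1
      have h2 : Tendsto f (𝓝[Ico 0 τ] τ) (𝓝 (f τ)) :=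
        h1.mono_left (nhdsWithin_mono _ (Ico_subset_Icc_self.trans hτI))
      rwa [nhdsWithin_Ico_eq_nhdsLT hτ0] at h2
    refine ge_of_tendsto hct ?_
    filter_upwards [Ioo_mem_nhdsLT hτ0] with t ht using (hlt t ⟨ht.1.le, ht.2⟩).le
  have hfτ : r₂ ≤ r τ ∧ 0 ≤ p τ ∧ 0 ≤ q τ + 0.45 * p τ := by
    simpa only [hf, le_min_iff, sub_nonneg] using hfnn
  -- `p` stays positive
  have hpτ : 0 < p τ := by
    obtain ⟨B, hB⟩ := isCompact_Icc.exists_bound_of_continuousOn ((hpc.mono hτI).add (hqc.mono hτI))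
    -- `B` bounds p + q = p a on the compact interval, whence |p'| ≤ L p, and p exp(L t) cannot
    -- decrease.
    set L : ℝ := 3 * B / r₂ with hL
    have hmono : MonotoneOn (fun t => p t * Real.exp (L * t)) (Icc 0 τ) := by
      have hexp : ∀ t, HasDerivAt (fun t => Real.exp (L * t)) (Real.exp (L * t) * L) t := by
        intro t
        simpa using ((hasDerivAt_id t).const_mul L).exp
      refine monotoneOn_of_deriv_nonneg (convex_Icc 0 τ) ?_ ?_ ?_
      · exact (hpc.mono hτI).mul fun t _ => (hexp t).continuousAt.continuousWithinAt
      · intro t ht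
        exact ((H.p_diff t (hIJ (interior_subset ht))).mul
          (hexp t).differentiableAt).differentiableWithinAt
      · intro t ht
        have htI := interior_subset ht
        rw [interior_Icc] at ht
        have hd : HasDerivAt (fun t => p t * Real.exp (L * t))
            (deriv p t * Real.exp (L * t) + p t * (Real.exp (L * t) * L)) t :=
          (H.p_diff t (hIJ htI)).hasDerivAt.mul (hexp t)
        rw [hd.deriv]
        have hg := (hgood t).1 (hlt t ⟨ht.1.le, ht.2⟩)
        obtain ⟨-, -, -, -, h5⟩ := H.estimate t (hIJ htI) hg.1.le hg.2.1 hg.2.2.le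
        have hB' : p t * (1 + q t / p t) ≤ B := by
          have := hB t htI
          have e : p t * (1 + q t / p t) = p t + q t := by
            have := hg.2.1.ne'
            field_simp
          rw [e]
          exact (le_abs_self _).trans this
        have h6 : 3 * (p t * (1 + q t / p t)) * p t / r t ≤ L * p t := by
          have hpt := hg.2.1
          have hB0 : 0 ≤ B := (norm_nonneg _).trans (hB t htI)
          calc 3 * (p t * (1 + q t / p t)) * p t / r t ≤ 3 * B * p t / r₂ := by
                gcongr
                exact hg.1.le
            _ = L * p t := by rw [hL]; ring
        have h7 : 0 ≤ deriv p t + L * p t := by linarith [neg_le_of_abs_le h5]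
        have := mul_nonneg h7 (Real.exp_pos (L * t)).le
        linarith
    have h1 := hmono ⟨le_rfl, hτ0.le⟩ ⟨hτ0.le, le_rfl⟩ hτ0.le
    simp only [mul_zero, Real.exp_zero, mul_one] at h1
    by_contra hcon
    have : p τ = 0 := le_antisymm (not_lt.1 hcon) hfτ.2.1
    rw [this, zero_mul] at h1
    linarith
  have hall : ∀ t ∈ Icc 0 τ, r₂ ≤ r t ∧ 0 < p t ∧ 0.55 ≤ 1 + q t / p t := by
    intro t ht
    rcases ht.2.lt_or_eq with h | h
    · have := (hgood t).1 (hlt t ⟨ht.1, h⟩)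
      exact ⟨this.1.le, this.2.1, this.2.2.le⟩
    · rw [h]
      refine ⟨hfτ.1, hpτ, ?_⟩
      have : 1 + q τ / p τ = (p τ + q τ) / p τ := by field_simp
      rw [this, le_div_iff₀ hpτ]
      linarith
  have hI : Convex ℝ (Icc 0 τ) := convex_Icc 0 τ
  have g1 : ∀ t ∈ Icc 0 τ, r₂ ≤ r t := fun t ht => (hall t ht).1
  have g2 : ∀ t ∈ Icc 0 τ, 0 < p t := fun t ht => (hall t ht).2.1
  have g3 : ∀ t ∈ Icc 0 τ, 0.55 ≤ 1 + q t / p t := fun t ht => (hall t ht).2.2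
  have m0 : (0 : ℝ) ∈ Icc 0 τ := ⟨le_rfl, hτ0.le⟩
  have m1 : τ ∈ Icc 0 τ := ⟨hτ0.le, le_rfl⟩
  have k1 := H.monotoneOn_Q hI hIJ g1 g2 g3 m0 m1 hτ0.le
  have k2 := H.monotoneOn_log_r hI hIJ g1 g2 g3 m0 m1 hτ0.le
  have b0 := H.Q_bounds hIJ g1 g2 g3 0 m0
  have b1 := H.Q_bounds hIJ g1 g2 g3 τ m1
  have c0 := H.Q_pos hIJ g1 g2 g3 0 m0
  have c1 := H.Q_pos hIJ g1 g2 g3 τ m1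
  -- As 3/Q lies in (0, 6], log r decreases by less than 6, which is the margin in `hr0`.
  have hrlog : r₂ < r τ := by
    have hr0' : 0 < r 0 := by nlinarith
    have hrτ : 0 < r τ := hr₂.trans_le hfτ.1
    have h3 : 3 / Q 0 ≤ 6 := by
      rw [div_le_iff₀ (by linarith)]; linarith
    have h4 : 0 < 3 / Q τ := by positivity
    have h5 : Real.log (Real.exp 6 * r₂) < Real.log (r 0) :=
      Real.log_lt_log (by positivity) hr0
    rw [Real.log_mul (by positivity) hr₂.ne', Real.log_exp] at h5
    exact (Real.log_lt_log_iff hr₂ hrτ).1 (by linarith)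
  -- Q does not decrease and agrees with a up to 0.1 percent, so at `τ` the slope is at least 0.57 ·
  -- 0.999/1.001 > 0.55.
  have := (hgood τ).2 ⟨hrlog, hpτ, by linarith⟩
  exact absurd this (not_lt.2 hτS.2)

section
variable (hr0 : Real.exp 6 * r₂ < r 0) (hp0 : 0 < p 0) (hq0 : 0.57 ≤ 1 + q 0 / p 0)
include hr0 hp0 hq0

/-- Because the earlier time is arbitrary, this upgrades unboundedness of r to r → ∞. -/
lemma r_lower {t₁ t : ℝ} (h₁ : t₁ ∈ J) (h0 : 0 ≤ t₁) (ht : t ∈ J) (hle : t₁ ≤ t) :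
    Real.exp (-6) * r t₁ ≤ r t := by
  have G := H.good hr0 hp0 hq0
  have hI : Convex ℝ (J ∩ Ici 0) := H.ordConnected.convex.inter (convex_Ici 0)
  have g1 : ∀ t ∈ J ∩ Ici 0, r₂ ≤ r t := fun t ht => (G t ht.1 ht.2).1.le
  have g2 : ∀ t ∈ J ∩ Ici 0, 0 < p t := fun t ht => (G t ht.1 ht.2).2.1
  have g3 : ∀ t ∈ J ∩ Ici 0, 0.55 ≤ 1 + q t / p t := fun t ht => (G t ht.1 ht.2).2.2.le
  have m0 : t₁ ∈ J ∩ Ici 0 := ⟨h₁, h0⟩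
  have m1 : t ∈ J ∩ Ici 0 := ⟨ht, h0.trans hle⟩
  have k2 := H.monotoneOn_log_r hI inter_subset_left g1 g2 g3 m0 m1 hle
  have c0 := H.Q_pos inter_subset_left g1 g2 g3 t₁ m0
  have c1 := H.Q_pos inter_subset_left g1 g2 g3 t m1
  have r1 : 0 < r t₁ := H.r₂_pos.trans_le (g1 _ m0)
  have r2 : 0 < r t := H.r₂_pos.trans_le (g1 _ m1)
  have h3 : 3 / Q t₁ ≤ 6 := by
    rw [div_le_iff₀ (by linarith)]; linarith
  have h4 : 0 < 3 / Q t := by positivity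
  refine (Real.log_le_log_iff (by positivity) r2).1 ?_
  rw [Real.log_mul (by positivity) r1.ne', Real.log_exp]
  simp only at k2
  linarith

lemma u_bounds : ∃ B : ℝ, ∀ t ∈ J, 0 ≤ t → u 0 ≤ u t ∧ u t ≤ B := by
  have G := H.good hr0 hp0 hq0
  have hI : Convex ℝ (J ∩ Ici 0) := H.ordConnected.convex.inter (convex_Ici 0)
  have g1 : ∀ t ∈ J ∩ Ici 0, r₂ ≤ r t := fun t ht => (G t ht.1 ht.2).1.le
  have g2 : ∀ t ∈ J ∩ Ici 0, 0 < p t := fun t ht => (G t ht.1 ht.2).2.1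
  have g3 : ∀ t ∈ J ∩ Ici 0, 0.55 ≤ 1 + q t / p t := fun t ht => (G t ht.1 ht.2).2.2.le
  have hu : MonotoneOn u (J ∩ Ici 0) := monotoneOn_of_hasDerivAt_nonneg hI
    (fun t ht => H.u_deriv t ht.1) fun t ht => (g2 t ht).le
  have m0 : (0 : ℝ) ∈ J ∩ Ici 0 := ⟨H.zero_mem, mem_Ici.2 le_rfl⟩
  refine ⟨u 0 + r 0 / Q 0 / 0.9, fun t ht h0 => ⟨hu m0 ⟨ht, h0⟩ h0, ?_⟩⟩
  have k := H.antitoneOn_u hI inter_subset_left g1 g2 g3 m0 ⟨ht, h0⟩ h0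
  have c1 := H.Q_pos inter_subset_left g1 g2 g3 t ⟨ht, h0⟩
  have r1 : 0 < r t := H.r₂_pos.trans_le (g1 _ ⟨ht, h0⟩)
  have : 0 < r t / Q t := div_pos r1 (by linarith)
  simp only at k
  have h9 : 0.9 * (r 0 / Q 0 / 0.9) = r 0 / Q 0 := by ring
  linarith

/-- If `r` stays bounded, then the velocity stays bounded and the motion lasts only for a finite
parameter time. -/
lemma bounded_of_r_bounded {M : ℝ} (hM : ∀ t ∈ J, 0 ≤ t → r t ≤ M) :
    BddAbove J ∧ ∃ B, ∀ t ∈ J, 0 ≤ t → p t ≤ B ∧ p t * (1 + q t / p t) ≤ B := by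
  have G := H.good hr0 hp0 hq0
  have hI : Convex ℝ (J ∩ Ici 0) := H.ordConnected.convex.inter (convex_Ici 0)
  have g1 : ∀ t ∈ J ∩ Ici 0, r₂ ≤ r t := fun t ht => (G t ht.1 ht.2).1.le
  have g2 : ∀ t ∈ J ∩ Ici 0, 0 < p t := fun t ht => (G t ht.1 ht.2).2.1
  have g3 : ∀ t ∈ J ∩ Ici 0, 0.55 ≤ 1 + q t / p t := fun t ht => (G t ht.1 ht.2).2.2.le
  have m0 : (0 : ℝ) ∈ J ∩ Ici 0 := ⟨H.zero_mem, mem_Ici.2 le_rfl⟩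
  obtain ⟨U, hU⟩ := H.u_bounds hr0 hp0 hq0
  have hr₂ := H.r₂_pos
  -- the slope is bounded
  obtain ⟨A, hA0, hA⟩ : ∃ A, 0 < A ∧ ∀ t ∈ J ∩ Ici 0, 1 + q t / p t ≤ A := by
    set E : ℝ := Real.log (Q 0) - 3 * Real.log (r 0) - 2 / r₂ * u 0 + 3 * Real.log M + 2 / r₂ * U
    refine ⟨2 * Real.exp E, by positivity, fun t ht => ?_⟩
    have k := H.antitoneOn_log_Q hI inter_subset_left g1 g2 g3 m0 ht ht.2
    have b := H.Q_bounds inter_subset_left g1 g2 g3 t ht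
    have c := H.Q_pos inter_subset_left g1 g2 g3 t ht
    have hlog : Real.log (r t) ≤ Real.log M :=
      Real.log_le_log (hr₂.trans_le (g1 t ht)) (hM t ht.1 ht.2)
    have hu : 2 / r₂ * u t ≤ 2 / r₂ * U :=
      mul_le_mul_of_nonneg_left (hU t ht.1 ht.2).2 (by positivity)
    have hQ : Q t ≤ Real.exp E := by
      rw [← Real.log_le_iff_le_exp (by linarith)]
      simp only at k
      simp only [E]
      linarith
    have := g3 t ht
    linarith
  set L : ℝ := 3 * A / r₂ with hL
  have hL0 : 0 ≤ L := by positivity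
  -- Since u' = p, the logarithm of p changes by at most L times the change of u, which is bounded.
  have hp' : ∀ t ∈ J ∩ Ici 0, |deriv p t / p t| ≤ L * p t := by
    intro t ht
    obtain ⟨-, -, -, -, h5⟩ := H.estimate t ht.1 (g1 t ht) (g2 t ht) (g3 t ht)
    have hpt := g2 t ht
    have hrt := g1 t ht
    have hAt := hA t ht
    rw [abs_div, abs_of_pos hpt, div_le_iff₀ hpt]
    refine h5.trans ?_
    calc 3 * (p t * (1 + q t / p t)) * p t / r t ≤ 3 * (p t * A) * p t / r₂ := by gcongr
      _ = L * p t * p t := by rw [hL]; ring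
  have hlogp : ∀ t ∈ J ∩ Ici 0, HasDerivAt (fun t => Real.log (p t)) (deriv p t / p t) t :=
    fun t ht => (H.p_diff t ht.1).hasDerivAt.log (g2 t ht).ne'
  have hlow : ∀ t ∈ J ∩ Ici 0, Real.log (p 0) - L * (U - u 0) ≤ Real.log (p t) := by
    intro t ht
    have hm : MonotoneOn (fun t => Real.log (p t) + L * u t) (J ∩ Ici 0) :=
      monotoneOn_of_hasDerivAt_nonneg hI (f' := fun t => deriv p t / p t + L * p t)
        (fun t ht => (hlogp t ht).add ((H.u_deriv t ht.1).const_mul L))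
        fun t ht => by linarith [neg_le_of_abs_le (hp' t ht)]
    have h1 := hm m0 ht ht.2
    have h2 : L * u t ≤ L * U := mul_le_mul_of_nonneg_left (hU t ht.1 ht.2).2 hL0
    simp only at h1
    linarith
  have hhigh : ∀ t ∈ J ∩ Ici 0, Real.log (p t) ≤ Real.log (p 0) + L * (U - u 0) := by
    intro t ht
    have hm : AntitoneOn (fun t => Real.log (p t) - L * u t) (J ∩ Ici 0) :=
      antitoneOn_of_hasDerivAt_nonpos hI (f' := fun t => deriv p t / p t - L * p t)
        (fun t ht => (hlogp t ht).sub ((H.u_deriv t ht.1).const_mul L))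
        fun t ht => by linarith [le_of_abs_le (hp' t ht)]
    have h1 := hm m0 ht ht.2
    have h2 : L * u t ≤ L * U := mul_le_mul_of_nonneg_left (hU t ht.1 ht.2).2 hL0
    simp only at h1
    linarith
  set a₁ : ℝ := Real.exp (Real.log (p 0) - L * (U - u 0)) with ha₁
  set b₁ : ℝ := Real.exp (Real.log (p 0) + L * (U - u 0)) with hb₁
  have ha₁0 : 0 < a₁ := Real.exp_pos _
  have hpa : ∀ t ∈ J ∩ Ici 0, a₁ ≤ p t := fun t ht =>
    (Real.le_log_iff_exp_le (g2 t ht)).1 (hlow t ht)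
  have hpb : ∀ t ∈ J ∩ Ici 0, p t ≤ b₁ := fun t ht =>
    (Real.log_le_iff_le_exp (g2 t ht)).1 (hhigh t ht)
  refine ⟨⟨max 0 ((U - u 0) / a₁), fun t ht => ?_⟩, max b₁ (b₁ * A), fun t ht h0 => ⟨?_, ?_⟩⟩
  · rcases le_total t 0 with h | h
    · exact h.trans (le_max_left _ _)
    · refine le_trans ?_ (le_max_right _ _)
      -- u grows at least at the rate `a₁` and remains below `U`; this bounds the parameter.
      have hm : MonotoneOn (fun t => u t - a₁ * t) (J ∩ Ici 0) :=
        monotoneOn_of_hasDerivAt_nonneg hI (f' := fun t => p t - a₁)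
          (fun t ht => ((H.u_deriv t ht.1).sub ((hasDerivAt_id t).const_mul a₁)).congr_deriv
            (by simp)) fun t ht => by linarith [hpa t ht]
      have h1 := hm m0 ⟨ht, h⟩ h
      have h2 := (hU t ht h).2
      rw [le_div_iff₀ ha₁0]
      simp only [mul_zero, sub_zero] at h1
      linarith
  · exact (hpb t ⟨ht, h0⟩).trans (le_max_left _ _)
  · refine le_trans ?_ (le_max_right _ _)
    have h1 := hpb t ⟨ht, h0⟩
    have h2 := hA t ⟨ht, h0⟩
    have h3 := g3 t ⟨ht, h0⟩
    have h4 := g2 t ⟨ht, h0⟩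
    exact mul_le_mul h1 h2 (by linarith) (Real.exp_pos _).le

end

end AlmostStraight

end

/-! ### First derivatives of the metric and the equations of motion in components. -/

section

/-! ### Partial derivatives -/

lemma pd_add {f k : E4 → ℝ} {X : E4} (hf : DifferentiableAt ℝ f X) (hk : DifferentiableAt ℝ k X)
    (α : Fin 4) : pd α (fun Y => f Y + k Y) X = pd α f X + pd α k X := by
  have := (hf.hasFDerivAt.add hk.hasFDerivAt).fderiv
  simp only [pd]
  rw [show (fun Y => f Y + k Y) = f + k from rfl, this]
  rfl

lemma pd_mul {f k : E4 → ℝ} {X : E4} (hf : DifferentiableAt ℝ f X) (hk : DifferentiableAt ℝ k X)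
    (α : Fin 4) : pd α (fun Y => f Y * k Y) X = f X * pd α k X + k X * pd α f X := by
  have := (hf.hasFDerivAt.mul hk.hasFDerivAt).fderiv
  simp only [pd]
  rw [show (fun Y => f Y * k Y) = f * k from rfl, this]
  rfl

lemma pd_const (a : ℝ) (X : E4) (α : Fin 4) : pd α (fun _ => a) X = 0 := by
  simp [pd]

lemma pd_coord (β : Fin 4) (X : E4) (α : Fin 4) :
    pd α (fun Y => Y β) X = if α = β then 1 else 0 := by
  have := (ContinuousLinearMap.proj (R := ℝ) (φ := fun _ : Fin 4 => ℝ) β).hasFDerivAt (x := X)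
  have h2 : fderiv ℝ (fun Y : E4 => Y β) X = ContinuousLinearMap.proj β := this.fderiv
  rw [pd, h2]
  simp [Pi.single_apply, eq_comm]

/-- Differentiability is not needed, because `fderiv` takes the default value zero. -/
lemma pd_eq_zero_of_invariant {f : E4 → ℝ} {α : Fin 4}
    (hf : ∀ Y (τ : ℝ), f (Y + τ • Pi.single α 1) = f Y) (X : E4) : pd α f X = 0 := by
  by_cases hd : DifferentiableAt ℝ f X
  · rw [pd, ← hd.lineDeriv_eq_fderiv, lineDeriv]
    simp [hf]
  · rw [pd, fderiv_zero_of_not_differentiableAt hd]; rfl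

lemma pd_inv_r (X : E4) (hX : X 1 ≠ 0) (α : Fin 4) :
    pd α (fun Y => (Y 1)⁻¹) X = if α = 1 then - (X 1 ^ 2)⁻¹ else 0 := by
  have h1 : HasFDerivAt (fun Y : E4 => Y 1)
      (ContinuousLinearMap.proj (R := ℝ) (φ := fun _ : Fin 4 => ℝ) 1) X :=
    (ContinuousLinearMap.proj (R := ℝ) (φ := fun _ : Fin 4 => ℝ) 1).hasFDerivAt
  have := (hasDerivAt_inv hX).comp_hasFDerivAt X h1
  have h2 : fderiv ℝ (fun Y : E4 => (Y 1)⁻¹) X = _ := this.fderiv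
  rw [pd, h2]
  by_cases hα : α = 1 <;> simp [hα, eq_comm]

lemma differentiableAt_coord (β : Fin 4) (X : E4) : DifferentiableAt ℝ (fun Y : E4 => Y β) X :=
  (ContinuousLinearMap.proj (R := ℝ) (φ := fun _ : Fin 4 => ℝ) β).differentiableAt

/-! ### The conformal factor of the round metric -/

/-- The function `4 / (1 + |y|²)²`. -/
def conformalFactor (X : E4) : ℝ := 4 / (1 + X 2 ^ 2 + X 3 ^ 2) ^ 2

lemma roundMetric_ang (s : Bool) (X : E4) (I J : Fin 2) :
    roundMetric s (ang X) I J = conformalFactor X * (if I = J then 1 else 0) :=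
  roundMetric_apply s (ang X) I J

lemma conformalFactor_bounds {X : E4} (hX : X 2 ^ 2 + X 3 ^ 2 ≤ 1) :
    1 ≤ conformalFactor X ∧ conformalFactor X ≤ 4 := by
  have h0 : 0 ≤ X 2 ^ 2 + X 3 ^ 2 := by positivity
  have h1 : 0 < (1 + X 2 ^ 2 + X 3 ^ 2) ^ 2 := by positivity
  rw [conformalFactor, le_div_iff₀ h1, div_le_iff₀ h1]
  constructor <;> nlinarith

lemma hasFDerivAt_conformalFactor (X : E4) :
    HasFDerivAt conformalFactor
      ((-16 * X 2 / (1 + X 2 ^ 2 + X 3 ^ 2) ^ 3) •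
          (ContinuousLinearMap.proj 2 : E4 →L[ℝ] ℝ)
        + (-16 * X 3 / (1 + X 2 ^ 2 + X 3 ^ 2) ^ 3) •
          (ContinuousLinearMap.proj 3 : E4 →L[ℝ] ℝ)) X := by
  have h2 : HasFDerivAt (fun Y : E4 => Y 2) (ContinuousLinearMap.proj 2 : E4 →L[ℝ] ℝ) X :=
    (ContinuousLinearMap.proj 2 : E4 →L[ℝ] ℝ).hasFDerivAt
  have h3 : HasFDerivAt (fun Y : E4 => Y 3) (ContinuousLinearMap.proj 3 : E4 →L[ℝ] ℝ) X :=
    (ContinuousLinearMap.proj 3 : E4 →L[ℝ] ℝ).hasFDerivAt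
  have hD : (1 + X 2 ^ 2 + X 3 ^ 2) ≠ 0 := by positivity
  have h4 := (((h2.pow 2).const_add 1).add (h3.pow 2)).pow 2
  have h5 := ((hasDerivAt_inv (pow_ne_zero 2 hD)).comp_hasFDerivAt X h4).const_mul 4
  refine (h5.congr_fderiv ?_).congr_of_eventuallyEq (Eventually.of_forall fun Y => ?_)
  · ext v
    simp
    field_simp
    ring
  · simp [conformalFactor, div_eq_mul_inv]

lemma pd_conformalFactor_zero (X : E4) : pd 0 conformalFactor X = 0 :=
  pd_eq_zero_of_invariant (fun Y τ => by simp [conformalFactor]) X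

lemma pd_conformalFactor_one (X : E4) : pd 1 conformalFactor X = 0 :=
  pd_eq_zero_of_invariant (fun Y τ => by simp [conformalFactor]) X

lemma abs_pd_conformalFactor_le {X : E4} (hX : X 2 ^ 2 + X 3 ^ 2 ≤ 1) (α : Fin 4) :
    |pd α conformalFactor X| ≤ 16 := by
  have key : ∀ z : ℝ, z ^ 2 ≤ 1 → |-16 * z / (1 + X 2 ^ 2 + X 3 ^ 2) ^ 3| ≤ 16 := by
    intro z hz
    have h1 : (1 : ℝ) ≤ 1 + X 2 ^ 2 + X 3 ^ 2 := by nlinarith [sq_nonneg (X 2), sq_nonneg (X 3)]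
    have h3 : (1 : ℝ) ≤ (1 + X 2 ^ 2 + X 3 ^ 2) ^ 3 := one_le_pow₀ h1
    have h4 : |z| ≤ 1 := abs_le_one_iff_mul_self_le_one.2 (by nlinarith)
    rw [abs_div, abs_mul, abs_of_pos (by linarith : (0 : ℝ) < (1 + X 2 ^ 2 + X 3 ^ 2) ^ 3),
      div_le_iff₀ (by linarith)]
    norm_num
    nlinarith
  have h := (hasFDerivAt_conformalFactor X).fderiv
  rw [pd, h]
  fin_cases α
  · simp
  · simp
  · simpa using key (X 2) (by nlinarith [sq_nonneg (X 3)])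
  · simpa using key (X 3) (by nlinarith [sq_nonneg (X 2)])

/-! ### The first jet of the metric -/

/-- The coordinate index of an angular index. -/
def idx : Fin 2 → Fin 4 := ![2, 3]

lemma idx_ne_one (I : Fin 2) : idx I ≠ 1 := by fin_cases I <;> simp [idx]

section
variable (g : BondiMetric) (m : ℝ → E3 → ℝ) (h : ℝ → E3 → E3 →L[ℝ] E3 →L[ℝ] ℝ) (s : Bool)

/-- The function `m` in the coordinates of a chart. -/
def mChart (X : E4) : ℝ := m (X 0) (stereo s (ang X))

/-- The components of `h` in the coordinates of a chart. -/
def hChart (I J : Fin 2) (X : E4) : ℝ :=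
  h (X 0) (stereo s (ang X)) (frame s (ang X) I) (frame s (ang X) J)

/-- The remainder of `g_{uu}`. -/
def uuRem (X : E4) : ℝ := g.comp s X 0 0 - (-1 + m (X 0) (stereo s (ang X)) / X 1)

/-- The remainder of `g_{ur}`. -/
def urRem (X : E4) : ℝ := g.comp s X 0 1 - (-1)

/-- The remainder of `g_{IJ}`. -/
def angRem (I J : Fin 2) (X : E4) : ℝ :=
  g.angularBlock s X I J - (roundMetric s (ang X) I J * X 1 ^ 2
      + h (X 0) (stereo s (ang X)) (frame s (ang X) I) (frame s (ang X) J) * X 1)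

lemma ang_add_single_one (X : E4) (τ : ℝ) : ang (X + τ • Pi.single 1 1) = ang X := by
  ext i; fin_cases i <;> simp [ang]

lemma pd_one_mChart (X : E4) : pd 1 (mChart m s) X = 0 :=
  pd_eq_zero_of_invariant (fun Y τ => by simp [mChart, ang_add_single_one]) X

lemma pd_one_hChart (I J : Fin 2) (X : E4) : pd 1 (hChart h s I J) X = 0 :=
  pd_eq_zero_of_invariant (fun Y τ => by simp [hChart, ang_add_single_one]) X

lemma BondiMetric.comp_idx_idx (I J : Fin 2) (X : E4) :
    g.comp s X (idx I) (idx J) = g.angularBlock s X I J := by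
  fin_cases I <;> fin_cases J <;>
  simp [idx, comp_two_two, comp_two_three, comp_three_two, comp_three_three]

lemma BondiMetric.comp_zero_idx (I : Fin 2) (X : E4) : g.comp s X 0 (idx I) =
    g.guA (X 0) (X 1) (stereo s (ang X)) (frame s (ang X) I) := by
  fin_cases I <;> simp [idx, comp_zero_two, comp_zero_three]

end

namespace AsymptoticallyFlat
variable {R C : ℝ} {g : BondiMetric} {m : ℝ → E3 → ℝ} {h : ℝ → E3 → E3 →L[ℝ] E3 →L[ℝ] ℝ}
  (H : AsymptoticallyFlat R C g m h)
include H

lemma differentiableAt_mChart (s : Bool) (X : E4) : DifferentiableAt ℝ (mChart m s) X :=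
  (H.m_regular s).differentiable (by norm_num) X

lemma differentiableAt_hChart (s : Bool) (I J : Fin 2) (X : E4) :
    DifferentiableAt ℝ (hChart h s I J) X :=
  (H.h_regular s I J).differentiable (by norm_num) X

/-- The asymptotic bounds concern the remainders, so derivatives of components must be split. The
remainder is differentiable because the component and m are. -/
lemma pd_comp_zero_zero (s : Bool) {X : E4} (hX : X ∈ region R) (h0 : X 1 ≠ 0) (α : Fin 4) :
    pd α (fun Y => g.comp s Y 0 0) X = pd α (uuRem g m s) X
      + (pd α (mChart m s) X / X 1 - if α = 1 then mChart m s X / X 1 ^ 2 else 0) := by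
  have hm := H.differentiableAt_mChart s X
  have hr : DifferentiableAt ℝ (fun Y : E4 => (Y 1)⁻¹) X := (differentiableAt_coord 1 X).inv h0
  have hmr : DifferentiableAt ℝ (fun Y : E4 => mChart m s Y * (Y 1)⁻¹) X := hm.mul hr
  have hc : DifferentiableAt ℝ (fun Y : E4 => (-1 : ℝ) + mChart m s Y * (Y 1)⁻¹) X :=
    (differentiableAt_const _).add hmr
  have h1 : DifferentiableAt ℝ (uuRem g m s) X := (H.differentiableAt_comp s hX 0 0).sub hc
  have e : (fun Y => g.comp s Y 0 0) = fun Y => uuRem g m s Y + (-1 + mChart m s Y * (Y 1)⁻¹) := by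
    ext Y; simp [uuRem, mChart, div_eq_mul_inv]
  rw [e, pd_add h1 hc, pd_add (differentiableAt_const _) hmr, pd_const, pd_mul hm hr,
    pd_inv_r X h0]
  split_ifs <;> field_simp <;> ring

lemma pd_comp_zero_one (s : Bool) {X : E4} (hX : X ∈ region R) (α : Fin 4) :
    pd α (fun Y => g.comp s Y 0 1) X = pd α (urRem g s) X := by
  have h1 : DifferentiableAt ℝ (urRem g s) X :=
    (H.differentiableAt_comp s hX 0 1).sub (differentiableAt_const _)
  have e : (fun Y => g.comp s Y 0 1) = fun Y => urRem g s Y + (-1) := by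
    ext Y; simp [urRem]
  rw [e, pd_add h1 (differentiableAt_const _), pd_const, add_zero]

lemma pd_comp_idx_idx (s : Bool) {X : E4} (hX : X ∈ region R) (I J : Fin 2) (α : Fin 4) :
    pd α (fun Y => g.comp s Y (idx I) (idx J)) X = pd α (angRem g h s I J) X
      + (pd α conformalFactor X * X 1 ^ 2 * (if I = J then 1 else 0)
        + pd α (hChart h s I J) X * X 1
        + if α = 1 then 2 * X 1 * conformalFactor X * (if I = J then 1 else 0)
          + hChart h s I J X else 0) := by
  have hr := differentiableAt_coord 1 X
  have hr2 : DifferentiableAt ℝ (fun Y : E4 => Y 1 * Y 1) X := hr.mul hr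
  have hh := H.differentiableAt_hChart s I J X
  have hw : DifferentiableAt ℝ conformalFactor X :=
    (hasFDerivAt_conformalFactor X).differentiableAt
  have hwr : DifferentiableAt ℝ (fun Y => conformalFactor Y * (Y 1 * Y 1)) X := hw.mul hr2
  set δ : ℝ := if I = J then 1 else 0 with hδ
  have hwδ : DifferentiableAt ℝ (fun Y => conformalFactor Y * (Y 1 * Y 1) * δ) X :=
    hwr.mul (differentiableAt_const _)
  have hhr : DifferentiableAt ℝ (fun Y => hChart h s I J Y * Y 1) X := hh.mul hr
  have hc : DifferentiableAt ℝ
      (fun Y => conformalFactor Y * (Y 1 * Y 1) * δ + hChart h s I J Y * Y 1) X := hwδ.add hhr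
  have e0 : ∀ Y, g.comp s Y (idx I) (idx J) = angRem g h s I J Y
      + (conformalFactor Y * (Y 1 * Y 1) * δ + hChart h s I J Y * Y 1) := by
    intro Y
    rw [angRem, roundMetric_ang, g.comp_idx_idx, hChart, ← hδ]
    ring
  have h1 : DifferentiableAt ℝ (angRem g h s I J) X := by
    have e1 : angRem g h s I J = fun Y => g.comp s Y (idx I) (idx J) -
      (conformalFactor Y * (Y 1 * Y 1) * δ + hChart h s I J Y * Y 1) := by
      ext Y; rw [e0]; ring
    rw [e1]
    exact (H.differentiableAt_comp s hX _ _).sub hc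
  rw [show (fun Y => g.comp s Y (idx I) (idx J)) = _ from funext e0, pd_add h1 hc,
    pd_add hwδ hhr, pd_mul hwr (differentiableAt_const _), pd_const, pd_mul hw hr2, pd_mul hr hr,
    pd_mul hh hr, pd_coord]
  split_ifs <;> ring

end AsymptoticallyFlat

/-! ### The geodesic equation in components -/

/-- As g_{rr} and g_{rI} vanish, this component involves u'' as its only acceleration and no
r-velocity. It can be solved for u'' first. -/
lemma BondiMetric.eulerLagrange_one {g : BondiMetric} {s : Bool} {X : E4}
    (hM : ∀ μ ν, DifferentiableAt ℝ (fun Y => g.comp s Y μ ν) X) (V A : E4) :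
    eulerLagrange (fun Y => bilin (g.comp s Y)) X V A (Pi.single 1 1) =
      g.comp s X 0 1 * A 0 + (pd 0 (fun Y => g.comp s Y 0 1) X * V 0
        + ∑ I, pd (idx I) (fun Y => g.comp s Y 0 1) X * V (idx I)) * V 0
      - 1 / 2 * pd 1 (fun Y => g.comp s Y 0 0) X * V 0 ^ 2
      - ∑ I, pd 1 (fun Y => g.comp s Y 0 (idx I)) X * V 0 * V (idx I)
      - 1 / 2 * ∑ I, ∑ J, pd 1 (fun Y => g.comp s Y (idx I) (idx J)) X * V (idx I) * V (idx J) := by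
  rw [eulerLagrange_bilin_single hM]
  simp only [Fin.sum_univ_four, Fin.sum_univ_two, idx, Matrix.cons_val_zero, Matrix.cons_val_one,
    comp_one_one, comp_one_two, comp_one_three, comp_two_one, comp_three_one, comp_two_zero,
    comp_three_zero, show ∀ Y, g.comp s Y 1 0 = g.comp s Y 0 1 from fun Y => by
      rw [comp_one_zero, comp_zero_one], pd_const]
  ring

/-- This component determines r'' once u'' and the angular accelerations are under control. -/
lemma BondiMetric.eulerLagrange_zero {g : BondiMetric} {s : Bool} {X : E4}
    (hM : ∀ μ ν, DifferentiableAt ℝ (fun Y => g.comp s Y μ ν) X) (V A : E4) :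
    eulerLagrange (fun Y => bilin (g.comp s Y)) X V A (Pi.single 0 1) =
      g.comp s X 0 0 * A 0 + g.comp s X 0 1 * A 1 + ∑ I, g.comp s X 0 (idx I) * A (idx I)
      + 1 / 2 * pd 0 (fun Y => g.comp s Y 0 0) X * V 0 ^ 2
      - 1 / 2 * ∑ I, ∑ J, pd 0 (fun Y => g.comp s Y (idx I) (idx J)) X * V (idx I) * V (idx J)
      + pd 1 (fun Y => g.comp s Y 0 0) X * V 0 * V 1
      + ∑ I, pd (idx I) (fun Y => g.comp s Y 0 0) X * V (idx I) * V 0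
      + pd 1 (fun Y => g.comp s Y 0 1) X * V 1 ^ 2
      + ∑ I, pd (idx I) (fun Y => g.comp s Y 0 1) X * V (idx I) * V 1
      + ∑ I, pd 1 (fun Y => g.comp s Y 0 (idx I)) X * V 1 * V (idx I)
      + ∑ I, ∑ J, pd (idx J) (fun Y => g.comp s Y 0 (idx I)) X * V (idx J) * V (idx I) := by
  rw [eulerLagrange_bilin_single hM]
  simp only [Fin.sum_univ_four, Fin.sum_univ_two, idx, Matrix.cons_val_zero, Matrix.cons_val_one,
    comp_one_one, comp_one_two, comp_one_three, comp_two_one, comp_three_one, comp_two_zero,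
    comp_three_zero, show ∀ Y, g.comp s Y 1 0 = g.comp s Y 0 1 from fun Y => by
      rw [comp_one_zero, comp_zero_one], pd_const]
  ring

lemma BondiMetric.eulerLagrange_idx {g : BondiMetric} {s : Bool} {X : E4}
    (hM : ∀ μ ν, DifferentiableAt ℝ (fun Y => g.comp s Y μ ν) X) (V A : E4) (I : Fin 2) :
    eulerLagrange (fun Y => bilin (g.comp s Y)) X V A (Pi.single (idx I) 1) =
      g.comp s X 0 (idx I) * A 0 + ∑ J, g.comp s X (idx I) (idx J) * A (idx J)
      + (pd 0 (fun Y => g.comp s Y 0 (idx I)) X * V 0 + pd 1 (fun Y => g.comp s Y 0 (idx I)) X * V 1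
        + ∑ J, pd (idx J) (fun Y => g.comp s Y 0 (idx I)) X * V (idx J)) * V 0
      + ∑ J, (pd 0 (fun Y => g.comp s Y (idx I) (idx J)) X * V 0
        + pd 1 (fun Y => g.comp s Y (idx I) (idx J)) X * V 1
        + ∑ K, pd (idx K) (fun Y => g.comp s Y (idx I) (idx J)) X * V (idx K)) * V (idx J)
      - 1 / 2 * pd (idx I) (fun Y => g.comp s Y 0 0) X * V 0 ^ 2
      - pd (idx I) (fun Y => g.comp s Y 0 1) X * V 0 * V 1
      - ∑ J, pd (idx I) (fun Y => g.comp s Y 0 (idx J)) X * V 0 * V (idx J)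
      - 1 / 2 * ∑ J, ∑ K, pd (idx I) (fun Y => g.comp s Y (idx J) (idx K)) X
          * V (idx J) * V (idx K) := by
  rw [eulerLagrange_bilin_single hM]
  fin_cases I <;>
  · simp only [Fin.sum_univ_four, Fin.sum_univ_two, idx, Fin.zero_eta, Fin.mk_one,
      Matrix.cons_val_zero, Matrix.cons_val_one,
      comp_one_one, comp_one_two, comp_one_three, comp_two_one, comp_three_one, comp_two_zero,
      comp_three_zero, show ∀ Y, g.comp s Y 1 0 = g.comp s Y 0 1 from fun Y => by
        rw [comp_one_zero, comp_zero_one], pd_const]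
    ring

lemma BondiMetric.bilin_comp_self (g : BondiMetric) (s : Bool) (X V : E4) :
    bilin (g.comp s X) V V = g.comp s X 0 0 * V 0 ^ 2 + 2 * g.comp s X 0 1 * V 0 * V 1
      + 2 * ∑ I, g.comp s X 0 (idx I) * V 0 * V (idx I)
      + ∑ I, ∑ J, g.comp s X (idx I) (idx J) * V (idx I) * V (idx J) := by
  rw [bilin_apply]
  simp only [Fin.sum_univ_four, Fin.sum_univ_two, idx, Matrix.cons_val_zero, Matrix.cons_val_one,
    comp_one_one, comp_one_two, comp_one_three, comp_two_one, comp_three_one, comp_two_zero,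
    comp_three_zero, show ∀ Y, g.comp s Y 1 0 = g.comp s Y 0 1 from fun Y => by
      rw [comp_one_zero, comp_zero_one]]
  ring

end

/-! ### Degree counting, and the angular velocity of a null vector. -/

section

/-- `x` is of degree at most `k` in `b`, uniformly over the index type. -/
def Deg {ι : Type*} (b : ι → ℝ) (k : ℕ) (x : ι → ℝ) : Prop :=
  ∃ K, 0 ≤ K ∧ ∀ i, |x i| ≤ K * (1 + |b i|) ^ k

namespace Deg
variable {ι : Type*} {b x y : ι → ℝ} {k l : ℕ}

lemma mono (hx : Deg b k x) (hkl : k ≤ l) : Deg b l x := by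
  obtain ⟨K, hK, h⟩ := hx
  refine ⟨K, hK, fun i => (h i).trans ?_⟩
  gcongr
  linarith [abs_nonneg (b i)]

lemma of_bound {C : ℝ} (h : ∀ i, |x i| ≤ C) : Deg b 0 x :=
  ⟨|C|, abs_nonneg C, fun i => by simpa using (h i).trans (le_abs_self C)⟩

lemma const (a : ℝ) : Deg b 0 (fun _ => a) := of_bound (C := |a|) fun _ => le_rfl

lemma add (hx : Deg b k x) (hy : Deg b l y) : Deg b (max k l) (fun i => x i + y i) := by
  obtain ⟨K, hK, h⟩ := hx.mono (le_max_left k l)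
  obtain ⟨L, hL, h'⟩ := hy.mono (le_max_right k l)
  refine ⟨K + L, by positivity, fun i => (abs_add_le _ _).trans ?_⟩
  rw [add_mul]
  exact add_le_add (h i) (h' i)

lemma mul (hx : Deg b k x) (hy : Deg b l y) : Deg b (k + l) (fun i => x i * y i) := by
  obtain ⟨K, hK, h⟩ := hx
  obtain ⟨L, hL, h'⟩ := hy
  refine ⟨K * L, by positivity, fun i => ?_⟩
  rw [abs_mul, pow_add]
  calc |x i| * |y i| ≤ (K * (1 + |b i|) ^ k) * (L * (1 + |b i|) ^ l) :=
        mul_le_mul (h i) (h' i) (abs_nonneg _) (by positivity)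
    _ = _ := by ring

lemma neg (hx : Deg b k x) : Deg b k (fun i => - x i) := by
  obtain ⟨K, hK, h⟩ := hx
  exact ⟨K, hK, fun i => by rw [abs_neg]; exact h i⟩

lemma sub (hx : Deg b k x) (hy : Deg b l y) : Deg b (max k l) (fun i => x i - y i) := by
  simpa only [sub_eq_add_neg] using hx.add hy.neg

lemma sum {n : ℕ} {x : Fin n → ι → ℝ} (hx : ∀ j, Deg b k (x j)) :
    Deg b k (fun i => ∑ j, x j i) := by
  choose K hK h using hx
  refine ⟨∑ j, K j, Finset.sum_nonneg fun j _ => hK j, fun i => ?_⟩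
  rw [Finset.sum_mul]
  exact (Finset.abs_sum_le_sum_abs _ _).trans (Finset.sum_le_sum fun j _ => h j i)

/-- A quantity is controlled by its product with a factor close to `1`. -/
lemma of_mul_one_sub {δ : ι → ℝ} (hy : Deg b k y) (hδ : ∀ i, |δ i| ≤ 1 / 2)
    (h : ∀ i, x i * (1 - δ i) = y i) : Deg b k x := by
  obtain ⟨K, hK, hy⟩ := hy
  refine ⟨2 * K, by positivity, fun i => ?_⟩
  have h1 : 1 / 2 ≤ |1 - δ i| := (by linarith [le_of_abs_le (hδ i)] : (1 : ℝ) / 2 ≤ 1 - δ i).trans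
    (le_abs_self _)
  have h2 : |x i| * |1 - δ i| ≤ K * (1 + |b i|) ^ k := by rw [← abs_mul, h]; exact hy i
  have h3 : |x i| * (1 / 2) ≤ |x i| * |1 - δ i| := mul_le_mul_of_nonneg_left h1 (abs_nonneg _)
  linarith

/-- A nearly diagonal system of two equations controls its unknowns. -/
lemma of_nearly_diagonal {ω ε : ι → ℝ} {Z Y : Fin 2 → ι → ℝ} {c : Fin 2 → Fin 2 → ι → ℝ} {C : ℝ}
    (hω : ∀ i, 1 ≤ ω i) (hε : ∀ i, 0 ≤ ε i) (hεC : ∀ i, ε i * C ≤ 1 / 8)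
    (hc : ∀ I J i, |c I J i| ≤ C) (hY : ∀ I, Deg b k (Y I))
    (h : ∀ I i, ω i * Z I i + ε i * ∑ J, c I J i * Z J i = Y I i) (I : Fin 2) : Deg b k (Z I) := by
  choose K hK hY using hY
  refine ⟨2 * (K 0 + K 1), by linarith [hK 0, hK 1], fun i => ?_⟩
  have key : ∀ I, |Z I i| ≤ |Y I i| + 1 / 8 * (|Z 0 i| + |Z 1 i|) := by
    intro I
    have hsum : |ε i * ∑ J, c I J i * Z J i| ≤ 1 / 8 * (|Z 0 i| + |Z 1 i|) := by
      rw [abs_mul, abs_of_nonneg (hε i), Fin.sum_univ_two]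
      have h0 : |c I 0 i * Z 0 i + c I 1 i * Z 1 i| ≤ C * (|Z 0 i| + |Z 1 i|) := by
        refine (abs_add_le _ _).trans ?_
        rw [abs_mul, abs_mul, mul_add]
        gcongr
        · exact hc I 0 i
        · exact hc I 1 i
      calc _ ≤ ε i * (C * (|Z 0 i| + |Z 1 i|)) := mul_le_mul_of_nonneg_left h0 (hε i)
        _ = ε i * C * (|Z 0 i| + |Z 1 i|) := by ring
        _ ≤ _ := mul_le_mul_of_nonneg_right (hεC i) (by positivity)
    have h1 : ω i * |Z I i| ≤ |Y I i| + 1 / 8 * (|Z 0 i| + |Z 1 i|) := by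
      have : ω i * Z I i = Y I i - ε i * ∑ J, c I J i * Z J i := by rw [← h I i]; ring
      rw [← abs_of_pos (zero_lt_one.trans_le (hω i)), ← abs_mul, this]
      exact (abs_sub _ _).trans (by linarith)
    have h2 : 1 * |Z I i| ≤ ω i * |Z I i| := mul_le_mul_of_nonneg_right (hω i) (abs_nonneg _)
    linarith
  have k0 := key 0
  have k1 := key 1
  have y0 := hY 0 i
  have y1 := hY 1 i
  have hI : |Z I i| ≤ |Z 0 i| + |Z 1 i| := by
    fin_cases I
    · exact le_add_of_nonneg_right (abs_nonneg _)
    · exact le_add_of_nonneg_left (abs_nonneg _)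
  have : 2 * (K 0 + K 1) * (1 + |b i|) ^ k
      = 2 * (K 0 * (1 + |b i|) ^ k + K 1 * (1 + |b i|) ^ k) := by ring
  rw [this]
  linarith [abs_nonneg (Y 0 i), abs_nonneg (Y 1 i)]

end Deg

/-- The null condition bounds the angular velocity. -/
lemma angular_velocity_bound {ε C m e₀ e₁ ω ρ : ℝ} {β V : Fin 2 → ℝ} {c k : Fin 2 → Fin 2 → ℝ}
    (hε : 0 ≤ ε) (hε1 : ε ≤ 1) (hC : 1 ≤ C) (hεC : ε * C ≤ 1 / 100) (hm : |m| ≤ C) (he₀ : |e₀| ≤ C)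
    (he₁ : |e₁| ≤ C) (hω : 1 ≤ ω) (hβ : ∀ I, |β I| ≤ C) (hc : ∀ I J, |c I J| ≤ C)
    (hk : ∀ I J, |k I J| ≤ C) (hρ : 0.55 ≤ 1 + ρ)
    (hnull : ω * ∑ I, V I ^ 2 = 1 + 2 * ρ - ε * (m + ε * e₀ + 2 * ε * e₁ * ρ + 2 * ∑ I, β I * V I
      + ∑ I, ∑ J, c I J * V I * V J + ε * ∑ I, ∑ J, k I J * V I * V J)) :
    ∑ I, V I ^ 2 ≤ 4 * (1 + ρ) := by
  have hquad : ∀ d : Fin 2 → Fin 2 → ℝ, (∀ I J, |d I J| ≤ C) →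
      |∑ I, ∑ J, d I J * V I * V J| ≤ C * (2 * ∑ I, V I ^ 2) := by
    intro d hd
    have h1 : |∑ I, ∑ J, d I J * V I * V J| ≤ ∑ I, ∑ J, C * (|V I| * |V J|) := by
      refine (Finset.abs_sum_le_sum_abs _ _).trans (Finset.sum_le_sum fun I _ => ?_)
      refine (Finset.abs_sum_le_sum_abs _ _).trans (Finset.sum_le_sum fun J _ => ?_)
      rw [abs_mul, abs_mul, mul_assoc]
      exact mul_le_mul_of_nonneg_right (hd I J) (by positivity)
    refine h1.trans ?_
    simp only [Fin.sum_univ_two]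
    rw [← sq_abs (V 0), ← sq_abs (V 1)]
    nlinarith [mul_nonneg (by linarith : (0 : ℝ) ≤ C) (sq_nonneg (|V 0| - |V 1|))]
  have hlin : |∑ I, β I * V I| ≤ C * (1 + ∑ I, V I ^ 2) := by
    have h1 : |∑ I, β I * V I| ≤ ∑ I, C * |V I| := by
      refine (Finset.abs_sum_le_sum_abs _ _).trans (Finset.sum_le_sum fun I _ => ?_)
      rw [abs_mul]
      exact mul_le_mul_of_nonneg_right (hβ I) (abs_nonneg _)
    refine h1.trans ?_
    simp only [Fin.sum_univ_two]
    rw [← sq_abs (V 0), ← sq_abs (V 1)]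
    nlinarith [mul_nonneg (by linarith : (0 : ℝ) ≤ C) (sq_nonneg (|V 0| - 1 / 2)),
      mul_nonneg (by linarith : (0 : ℝ) ≤ C) (sq_nonneg (|V 1| - 1 / 2))]
  have hc' := hquad c hc
  have hk' := hquad k hk
  set S := ∑ I, V I ^ 2 with hS
  have hS0 : 0 ≤ S := Finset.sum_nonneg fun I _ => sq_nonneg _
  have hρ' : |ρ| ≤ 1 + ρ := abs_le.2 ⟨by linarith, by linarith⟩
  have b1 : |ε * e₀| ≤ C := by
    rw [abs_mul, abs_of_nonneg hε]
    nlinarith [abs_nonneg e₀]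
  have b2 : |2 * ε * e₁ * ρ| ≤ 2 * C * (1 + ρ) := by
    have : |2 * ε * e₁ * ρ| = 2 * (ε * |e₁|) * |ρ| := by
      rw [abs_mul, abs_mul, abs_mul, abs_of_nonneg hε, abs_two]; ring
    rw [this]
    have h1 : ε * |e₁| ≤ C := by nlinarith [abs_nonneg e₁]
    have h2 : 0 ≤ ε * |e₁| := by positivity
    have h3 := mul_le_mul h1 hρ' (abs_nonneg _) (by linarith)
    linarith
  have b3 : |ε * ∑ I, ∑ J, k I J * V I * V J| ≤ C * (2 * S) := by
    rw [abs_mul, abs_of_nonneg hε]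
    nlinarith [abs_nonneg (∑ I, ∑ J, k I J * V I * V J)]
  set T := m + ε * e₀ + 2 * ε * e₁ * ρ + 2 * ∑ I, β I * V I
      + ∑ I, ∑ J, c I J * V I * V J + ε * ∑ I, ∑ J, k I J * V I * V J with hT
  -- Only a lower bound of the bracket is needed. Multiplied by ε it costs at most one percent of 4
  -- + 2(1 + ρ) + 6S, which is absorbed by the slack between the flat value 1 + 2ρ and the bound 4(1
  -- + ρ).
  have hTlow : -(C * (4 + 2 * (1 + ρ) + 6 * S)) ≤ T := by
    have := neg_le_of_abs_le hm
    have := neg_le_of_abs_le b1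
    have := neg_le_of_abs_le b2
    have := neg_le_of_abs_le b3
    have := neg_le_of_abs_le hlin
    have := neg_le_of_abs_le hc'
    rw [hT]
    nlinarith
  have h1 : -(1 / 100 * (4 + 2 * (1 + ρ) + 6 * S)) ≤ ε * T := by
    have h2 := mul_le_mul_of_nonneg_left hTlow hε
    have h3 : 0 ≤ 4 + 2 * (1 + ρ) + 6 * S := by linarith
    nlinarith [mul_le_mul_of_nonneg_right hεC h3]
  have h2 : S ≤ ω * S := by nlinarith
  nlinarith

end

/-! ### Estimates for the scaled geodesic equation. -/

section

/-- The geodesic equation at a point, in terms of quantities that are bounded as `r → ∞`: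
`ε = 1/r`, the slope `ρ = dr/du`, the scaled angular velocity `V`, and the scaled accelerations
`P`, `q`, `Z`. The index type parametrizes all geodesics of all metrics under consideration. -/
structure ScaledGeodesic {ι : Type*} (C : ℝ) (b ε ω ρ P q m mu : ι → ℝ) (mI V Z : Fin 2 → ι → ℝ)
    (h hu : Fin 2 → Fin 2 → ι → ℝ) (hK : Fin 2 → Fin 2 → Fin 2 → ι → ℝ) : Prop where
  ε_pos : ∀ i, 0 < ε i
  ε_le : ∀ i, ε i * C ≤ 1 / 100
  one_le_C : 1 ≤ C
  b_nonneg : ∀ i, 0 ≤ b i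
  b_sq : ∀ i, b i ^ 2 = 1 + ρ i
  slope : ∀ i, 0.55 ≤ 1 + ρ i
  ω_bounds : ∀ i, 1 ≤ ω i ∧ ω i ≤ 4
  m_bound : ∀ i, |m i| ≤ C
  mu_bound : ∀ i, |mu i| ≤ C
  mI_bound : ∀ I i, |mI I i| ≤ C
  h_bound : ∀ I J i, |h I J i| ≤ C
  hu_bound : ∀ I J i, |hu I J i| ≤ C
  hK_bound : ∀ I J K i, |hK I J K i| ≤ C
  equations : ∃ (e₀ e₀u e₀r e₁ e₁u e₁r : ι → ℝ) (e₀I e₁I β βu βr ωI : Fin 2 → ι → ℝ)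
    (βI k ku kr : Fin 2 → Fin 2 → ι → ℝ) (kK : Fin 2 → Fin 2 → Fin 2 → ι → ℝ),
    ((∀ i, |e₀ i| ≤ C) ∧ (∀ i, |e₀u i| ≤ C) ∧ (∀ i, |e₀r i| ≤ C) ∧ (∀ i, |e₁ i| ≤ C) ∧
      (∀ i, |e₁u i| ≤ C) ∧ (∀ i, |e₁r i| ≤ C) ∧ (∀ I i, |e₀I I i| ≤ C) ∧ (∀ I i, |e₁I I i| ≤ C) ∧
      (∀ I i, |β I i| ≤ C) ∧ (∀ I i, |βu I i| ≤ C) ∧ (∀ I i, |βr I i| ≤ C) ∧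
      (∀ I i, |ωI I i| ≤ 16) ∧ (∀ I J i, |βI I J i| ≤ C) ∧ (∀ I J i, |k I J i| ≤ C) ∧
      (∀ I J i, |ku I J i| ≤ C) ∧ (∀ I J i, |kr I J i| ≤ C) ∧ (∀ I J K i, |kK I J K i| ≤ C)) ∧
    -- the null condition
    (∀ i, ω i * ∑ I, V I i ^ 2 = 1 + 2 * ρ i - ε i * (m i + ε i * e₀ i + 2 * ε i * e₁ i * ρ i
      + 2 * ∑ I, β I i * V I i + ∑ I, ∑ J, h I J i * V I i * V J i
      + ε i * ∑ I, ∑ J, k I J i * V I i * V J i)) ∧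
    -- the equation of motion for `u`
    (∀ i, (-1 + ε i ^ 2 * e₁ i) * P i + ε i * e₁u i + ε i ^ 2 * ∑ I, e₁I I i * V I i
      + 1 / 2 * m i * ε i - 1 / 2 * ε i ^ 2 * e₀r i - ε i * ∑ I, βr I i * V I i
      - ω i * ∑ I, V I i ^ 2 - 1 / 2 * ε i * ∑ I, ∑ J, h I J i * V I i * V J i
      - 1 / 2 * ε i ^ 2 * ∑ I, ∑ J, kr I J i * V I i * V J i = 0) ∧
    -- the equation of motion for `r`
    (∀ i, (-1 + m i * ε i + ε i ^ 2 * e₀ i) * P i + (-1 + ε i ^ 2 * e₁ i) * q i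
      + ε i * ∑ I, β I i * Z I i + 1 / 2 * mu i + 1 / 2 * ε i * e₀u i
      - 1 / 2 * ∑ I, ∑ J, hu I J i * V I i * V J i
      - 1 / 2 * ε i * ∑ I, ∑ J, ku I J i * V I i * V J i
      - m i * ε i * ρ i + ε i ^ 2 * e₀r i * ρ i + ε i * ∑ I, mI I i * V I i
      + ε i ^ 2 * ∑ I, e₀I I i * V I i + ε i ^ 2 * e₁r i * ρ i ^ 2
      + ε i ^ 2 * ∑ I, e₁I I i * V I i * ρ i + ε i * ∑ I, βr I i * ρ i * V I i
      + ε i * ∑ I, ∑ J, βI I J i * V J i * V I i = 0) ∧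
    -- the angular equations of motion
    (∀ I i, ε i * β I i * P i + ω i * Z I i + ε i * ∑ J, h I J i * Z J i
      + ε i ^ 2 * ∑ J, k I J i * Z J i
      + βu I i + ε i * βr I i * ρ i + ε i * ∑ J, βI I J i * V J i
      + ∑ J, (hu I J i + ε i * ku I J i + (ε i * h I J i + ε i ^ 2 * kr I J i) * ρ i
        + ∑ K, (ε i * hK I J K i + ε i ^ 2 * kK I J K i) * V K i) * V J i
      + 2 * ω i * ρ i * V I i + (∑ K, ωI K i * V K i) * V I i
      - 1 / 2 * ε i * mI I i - 1 / 2 * ε i ^ 2 * e₀I I i - ε i ^ 2 * e₁I I i * ρ i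
      - ε i * ∑ J, βI J I i * V J i - 1 / 2 * ωI I i * ∑ J, V J i ^ 2
      - 1 / 2 * ∑ J, ∑ K, (ε i * hK J K I i + ε i ^ 2 * kK J K I i) * V J i * V K i = 0)

namespace ScaledGeodesic
variable {ι : Type*} {C : ℝ} {b ε ω ρ P q m mu : ι → ℝ} {mI V Z : Fin 2 → ι → ℝ}
    {h hu : Fin 2 → Fin 2 → ι → ℝ} {hK : Fin 2 → Fin 2 → Fin 2 → ι → ℝ}
  (H : ScaledGeodesic C b ε ω ρ P q m mu mI V Z h hu hK)
include H

lemma ε_le_one (i : ι) : ε i ≤ 1 := by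
  have h1 := H.ε_le i
  have h2 := H.ε_pos i
  have h3 := H.one_le_C
  nlinarith

/-- The slope may be large, so sizes are measured in powers of b = √(1 + ρ). The equations are
solved in a fixed order: the null condition gives degree 1 for V, the equation for u degree 2 for P,
the angular equations degree 3 for Z, and the equation for r degree 4 for q. Beyond the flat terms,
only ∂_u m and ∂_u h appear without a factor ε. -/
lemma degrees : ∃ N N' : ι → ℝ, Deg b 1 (V 0) ∧ Deg b 1 (V 1) ∧ (∀ i, ∑ I, V I i ^ 2 ≤ 4 * (1 + ρ i)) ∧
    Deg b 3 (Z 0) ∧ Deg b 3 (Z 1) ∧ Deg b 2 N ∧ Deg b 4 N' ∧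
    (∀ i, P i = - (1 + 2 * ρ i) + ε i * N i) ∧
    (∀ i, q i = - P i + 1 / 2 * mu i - 1 / 2 * ∑ I, ∑ J, hu I J i * V I i * V J i
      + ε i * N' i) := by
  obtain ⟨e₀, e₀u, e₀r, e₁, e₁u, e₁r, e₀I, e₁I, β, βu, βr, ωI, βI, k, ku, kr, kK,
    ⟨he₀, he₀u, he₀r, he₁, he₁u, he₁r, he₀I, he₁I, hβ, hβu, hβr, hωI, hβI, hk, hku, hkr, hkK⟩,
    hnull, hE1, hE0, hEI⟩ := H.equations
  have hε1 := H.ε_le_one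
  have hV2 : ∀ i, ∑ I, V I i ^ 2 ≤ 4 * (1 + ρ i) := fun i =>
    angular_velocity_bound (H.ε_pos i).le (hε1 i) H.one_le_C (H.ε_le i) (H.m_bound i) (he₀ i)
      (he₁ i) (H.ω_bounds i).1 (fun I => hβ I i) (fun I J => H.h_bound I J i) (fun I J => hk I J i)
      (H.slope i) (hnull i)
  have dV : ∀ I, Deg b 1 (V I) := by
    intro I
    refine ⟨2, by norm_num, fun i => ?_⟩
    have h1 : V I i ^ 2 ≤ ∑ I, V I i ^ 2 :=
      Finset.single_le_sum (f := fun I => V I i ^ 2) (fun I _ => sq_nonneg _) (Finset.mem_univ I)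
    have h2 : V I i ^ 2 ≤ (2 * b i) ^ 2 := by rw [mul_pow, H.b_sq]; linarith [hV2 i]
    have h3 := abs_le_of_sq_le_sq h2 (by linarith [H.b_nonneg i])
    rw [pow_one, abs_of_nonneg (H.b_nonneg i)]
    linarith
  have dε : Deg b 0 ε := Deg.of_bound (C := 1) fun i => by
    rw [abs_of_pos (H.ε_pos i)]; exact hε1 i
  have dω : Deg b 0 ω := Deg.of_bound (C := 4) fun i => by
    rw [abs_of_pos (zero_lt_one.trans_le (H.ω_bounds i).1)]; exact (H.ω_bounds i).2
  have dρ : Deg b 2 ρ := by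
    refine ⟨1, by norm_num, fun i => ?_⟩
    have h1 : |ρ i| ≤ 1 + ρ i := abs_le.2 ⟨by linarith [H.slope i], by linarith⟩
    rw [← H.b_sq] at h1
    rw [abs_of_nonneg (H.b_nonneg i), one_mul]
    exact h1.trans (by nlinarith [H.b_nonneg i])
  have dm : Deg b 0 m := Deg.of_bound H.m_bound
  have dmu : Deg b 0 mu := Deg.of_bound H.mu_bound
  have dmI : ∀ I, Deg b 0 (mI I) := fun I => Deg.of_bound (H.mI_bound I)
  have dh : ∀ I J, Deg b 0 (h I J) := fun I J => Deg.of_bound (H.h_bound I J)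
  have dhu : ∀ I J, Deg b 0 (hu I J) := fun I J => Deg.of_bound (H.hu_bound I J)
  have dhK : ∀ I J K, Deg b 0 (hK I J K) := fun I J K => Deg.of_bound (H.hK_bound I J K)
  have de₀ : Deg b 0 e₀ := Deg.of_bound he₀
  have de₀u : Deg b 0 e₀u := Deg.of_bound he₀u
  have de₀r : Deg b 0 e₀r := Deg.of_bound he₀r
  have de₁ : Deg b 0 e₁ := Deg.of_bound he₁
  have de₁u : Deg b 0 e₁u := Deg.of_bound he₁u
  have de₁r : Deg b 0 e₁r := Deg.of_bound he₁r
  have de₀I : ∀ I, Deg b 0 (e₀I I) := fun I => Deg.of_bound (he₀I I)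
  have de₁I : ∀ I, Deg b 0 (e₁I I) := fun I => Deg.of_bound (he₁I I)
  have dβ : ∀ I, Deg b 0 (β I) := fun I => Deg.of_bound (hβ I)
  have dβu : ∀ I, Deg b 0 (βu I) := fun I => Deg.of_bound (hβu I)
  have dβr : ∀ I, Deg b 0 (βr I) := fun I => Deg.of_bound (hβr I)
  have dωI : ∀ I, Deg b 0 (ωI I) := fun I => Deg.of_bound (hωI I)
  have dβI : ∀ I J, Deg b 0 (βI I J) := fun I J => Deg.of_bound (hβI I J)
  have dk : ∀ I J, Deg b 0 (k I J) := fun I J => Deg.of_bound (hk I J)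
  have dku : ∀ I J, Deg b 0 (ku I J) := fun I J => Deg.of_bound (hku I J)
  have dkr : ∀ I J, Deg b 0 (kr I J) := fun I J => Deg.of_bound (hkr I J)
  have dkK : ∀ I J K, Deg b 0 (kK I J K) := fun I J K => Deg.of_bound (hkK I J K)
  have d2 : Deg b 0 (fun _ => (2 : ℝ)) := Deg.const 2
  have d1 : Deg b 0 (fun _ => (1 : ℝ)) := Deg.const 1
  have dhalf : Deg b 0 (fun _ => (1 / 2 : ℝ)) := Deg.const _
  have dVV : Deg b 2 (fun i => ∑ I, V I i * V I i) := Deg.sum fun I => (dV I).mul (dV I)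
  have dquad : ∀ {c : Fin 2 → Fin 2 → ι → ℝ}, (∀ I J, Deg b 0 (c I J)) →
      Deg b 2 (fun i => ∑ I, ∑ J, c I J i * V I i * V J i) := fun hc =>
    Deg.sum fun I => Deg.sum fun J => ((hc I J).mul (dV I)).mul (dV J)
  have dlin : ∀ {c : Fin 2 → ι → ℝ}, (∀ I, Deg b 0 (c I)) →
      Deg b 1 (fun i => ∑ I, c I i * V I i) := fun hc => Deg.sum fun I => (hc I).mul (dV I)
  -- the remainder in the null condition
  have dN : Deg b 2 (fun i => m i + ε i * e₀ i + 2 * ε i * e₁ i * ρ i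
      + 2 * ∑ I, β I i * V I i + ∑ I, ∑ J, h I J i * V I i * V J i
      + ε i * ∑ I, ∑ J, k I J i * V I i * V J i) :=
    (((((dm.add (dε.mul de₀)).add (((d2.mul dε).mul de₁).mul dρ)).add (d2.mul (dlin dβ))).add
      (dquad dh)).add (dε.mul (dquad dk))).mono (by norm_num)
  set N₀ := fun i => m i + ε i * e₀ i + 2 * ε i * e₁ i * ρ i
      + 2 * ∑ I, β I i * V I i + ∑ I, ∑ J, h I J i * V I i * V J i
      + ε i * ∑ I, ∑ J, k I J i * V I i * V J i with hN₀
  -- the remainder in the equation for `u`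
  have dM : Deg b 2 (fun i => e₁u i + ε i * ∑ I, e₁I I i * V I i + 1 / 2 * m i
      - 1 / 2 * (ε i * e₀r i) - ∑ I, βr I i * V I i
      - 1 / 2 * ∑ I, ∑ J, h I J i * V I i * V J i
      - 1 / 2 * (ε i * ∑ I, ∑ J, kr I J i * V I i * V J i)) :=
    ((((((de₁u.add (dε.mul (dlin de₁I))).add (dhalf.mul dm)).sub (dhalf.mul (dε.mul de₀r))).sub
      (dlin dβr)).sub (dhalf.mul (dquad dh))).sub
        (dhalf.mul (dε.mul (dquad dkr)))).mono (by norm_num)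
  set M := fun i => e₁u i + ε i * ∑ I, e₁I I i * V I i + 1 / 2 * m i
      - 1 / 2 * (ε i * e₀r i) - ∑ I, βr I i * V I i
      - 1 / 2 * ∑ I, ∑ J, h I J i * V I i * V J i
      - 1 / 2 * (ε i * ∑ I, ∑ J, kr I J i * V I i * V J i) with hM
  have hsmall : ∀ i, |ε i ^ 2 * e₁ i| ≤ 1 / 2 := by
    intro i
    have h1 := H.ε_pos i
    have h2 := hε1 i
    have h3 := H.ε_le i
    have h4 := he₁ i
    rw [abs_mul, abs_of_pos (by positivity)]
    have h5 : ε i * |e₁ i| ≤ 1 / 100 := (mul_le_mul_of_nonneg_left h4 h1.le).trans h3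
    nlinarith [mul_nonneg h1.le (abs_nonneg (e₁ i))]
  -- The null condition replaces ω ∑ V² by its flat value 1 + 2ρ, up to the error ε N₀.
  have hPeq : ∀ i, P i * (1 - ε i ^ 2 * e₁ i) = -(1 + 2 * ρ i) + ε i * N₀ i + ε i * M i := by
    intro i
    have h1 := hE1 i
    have h2 := hnull i
    simp only [hN₀, hM]
    linear_combination -h1 - h2
  have dP : Deg b 2 P := by
    refine Deg.of_mul_one_sub ?_ hsmall hPeq
    exact (((d1.add (d2.mul dρ)).neg.add (dε.mul dN)).add (dε.mul dM)).mono (by norm_num)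
  -- the angular acceleration
  have dZ : ∀ I, Deg b 3 (Z I) := by
    have hcoef : ∀ I J i, |(1 / 2 : ℝ) * h I J i + 1 / 2 * (ε i * k I J i)| ≤ C := by
      intro I J i
      have h1 := H.h_bound I J i
      have h2 := hk I J i
      have h3 : |ε i * k I J i| ≤ C := by
        rw [abs_mul, abs_of_pos (H.ε_pos i)]
        nlinarith [hε1 i, H.ε_pos i, abs_nonneg (k I J i)]
      refine (abs_add_le _ _).trans ?_
      rw [abs_mul, abs_mul _ (ε i * k I J i), abs_of_pos (by norm_num : (0 : ℝ) < 1 / 2)]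
      linarith
    -- The coupling ε h + ε² k is written as 2ε (½ h + ½ ε k), whose coefficients are bounded by `C`
    -- itself. Powers of ε are spelled as products to match `Deg.mul`.
    refine Deg.of_nearly_diagonal (ω := ω) (ε := fun i => 2 * ε i) (C := C)
      (Y := fun I i => -(ε i * β I i * P i
      + βu I i + ε i * βr I i * ρ i + ε i * ∑ J, βI I J i * V J i
      + ∑ J, (hu I J i + ε i * ku I J i + (ε i * h I J i + ε i * (ε i * kr I J i)) * ρ i
        + ∑ K, (ε i * hK I J K i + ε i * (ε i * kK I J K i)) * V K i) * V J i
      + 2 * ω i * ρ i * V I i + (∑ K, ωI K i * V K i) * V I i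
      - 1 / 2 * ε i * mI I i - 1 / 2 * (ε i * (ε i * e₀I I i)) - ε i * (ε i * e₁I I i) * ρ i
      - ε i * ∑ J, βI J I i * V J i - 1 / 2 * ωI I i * ∑ J, V J i * V J i
      - 1 / 2 * ∑ J, ∑ K, (ε i * hK J K I i + ε i * (ε i * kK J K I i)) * V J i * V K i))
      (fun i => (H.ω_bounds i).1) (fun i => by linarith [H.ε_pos i])
      (fun i => by linarith [H.ε_le i]) hcoef (fun I => ?_) (fun I i => ?_)
    · refine Deg.neg (Deg.mono (k := 3) ?_ le_rfl)
      have t1 : Deg b 3 (fun i => ∑ J, (hu I J i + ε i * ku I J i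
          + (ε i * h I J i + ε i * (ε i * kr I J i)) * ρ i
          + ∑ K, (ε i * hK I J K i + ε i * (ε i * kK I J K i)) * V K i) * V J i) := by
        refine Deg.sum fun J => Deg.mono (k := 2 + 1) (Deg.mul ?_ (dV J)) le_rfl
        refine Deg.mono (((dhu I J).add (dε.mul (dku I J))).add
          (((dε.mul (dh I J)).add (dε.mul (dε.mul (dkr I J)))).mul dρ) |>.add (Deg.sum fun K =>
            ((dε.mul (dhK I J K)).add (dε.mul (dε.mul (dkK I J K)))).mul (dV K))) (by norm_num)
      have t2 : Deg b 2 (fun i => ∑ J, ∑ K, (ε i * hK J K I i + ε i * (ε i * kK J K I i))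
          * V J i * V K i) :=
        dquad (c := fun J K i => ε i * hK J K I i + ε i * (ε i * kK J K I i)) fun J K =>
          (dε.mul (dhK J K I)).add (dε.mul (dε.mul (dkK J K I)))
      refine Deg.mono ((((((((((((((dε.mul (dβ I)).mul dP).add (dβu I)).add
        ((dε.mul (dβr I)).mul dρ)).add (dε.mul (dlin (dβI I)))).add t1).add
        (((d2.mul dω).mul dρ).mul (dV I))).add ((dlin dωI).mul (dV I))).sub
        ((dhalf.mul dε).mul (dmI I))).sub (dhalf.mul (dε.mul (dε.mul (de₀I I))))).sub
        ((dε.mul (dε.mul (de₁I I))).mul dρ)).sub (dε.mul (dlin fun J => dβI J I))).sub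
        ((dhalf.mul (dωI I)).mul dVV)).sub (dhalf.mul t2)) (by norm_num)
    · have := hEI I i
      simp only [Fin.sum_univ_two] at this ⊢
      linear_combination this
  have dW : Deg b 4 (fun i => - (m i + ε i * e₀ i) * P i - ∑ I, β I i * Z I i - 1 / 2 * e₀u i
      + 1 / 2 * ∑ I, ∑ J, ku I J i * V I i * V J i + m i * ρ i - ε i * e₀r i * ρ i
      - ∑ I, mI I i * V I i - ε i * ∑ I, e₀I I i * V I i - ε i * e₁r i * (ρ i * ρ i)
      - ε i * ((∑ I, e₁I I i * V I i) * ρ i) - (∑ I, βr I i * V I i) * ρ i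
      - ∑ I, ∑ J, βI J I i * V I i * V J i) := by
    refine Deg.mono (((((((((((((dm.add (dε.mul de₀)).neg.mul dP).sub
      (Deg.sum fun I => (dβ I).mul (?_ : Deg b 3 (Z I)))).sub (dhalf.mul de₀u)).add
      (dhalf.mul (dquad dku))).add (dm.mul dρ)).sub ((dε.mul de₀r).mul dρ)).sub (dlin dmI)).sub
      (dε.mul (dlin de₀I))).sub ((dε.mul de₁r).mul (dρ.mul dρ))).sub
      (dε.mul ((dlin de₁I).mul dρ))).sub ((dlin dβr).mul dρ)).sub
      (dquad (c := fun I J => βI J I) fun I J => dβI J I)) (by norm_num)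
    exact dZ I
  set W := fun i => - (m i + ε i * e₀ i) * P i - ∑ I, β I i * Z I i - 1 / 2 * e₀u i
      + 1 / 2 * ∑ I, ∑ J, ku I J i * V I i * V J i + m i * ρ i - ε i * e₀r i * ρ i
      - ∑ I, mI I i * V I i - ε i * ∑ I, e₀I I i * V I i - ε i * e₁r i * (ρ i * ρ i)
      - ε i * ((∑ I, e₁I I i * V I i) * ρ i) - (∑ I, βr I i * V I i) * ρ i
      - ∑ I, ∑ J, βI J I i * V I i * V J i with hW
  have hqeq : ∀ i, q i * (1 - ε i ^ 2 * e₁ i) = - P i + 1 / 2 * mu i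
      - 1 / 2 * ∑ I, ∑ J, hu I J i * V I i * V J i - ε i * W i := by
    intro i
    have h1 := hE0 i
    simp only [hW, Fin.sum_univ_two] at h1 ⊢
    linear_combination -h1
  have dq : Deg b 4 q := by
    refine Deg.of_mul_one_sub ?_ hsmall hqeq
    exact ((((dP.neg).add (dhalf.mul dmu)).sub (dhalf.mul (dquad dhu))).sub
      (dε.mul dW)).mono (by norm_num)
  refine ⟨fun i => N₀ i + M i + ε i * (e₁ i * P i), fun i => ε i * (e₁ i * q i) - W i,
    dV 0, dV 1, hV2, dZ 0, dZ 1, ?_, ?_, fun i => ?_, fun i => ?_⟩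
  · exact ((dN.add dM).add (dε.mul (de₁.mul dP))).mono (by norm_num)
  · exact ((dε.mul (de₁.mul dq)).sub dW).mono (by norm_num)
  · linear_combination hPeq i
  · linear_combination hqeq i

/-- The estimates for the motion in the `(u, r)`-plane. -/
lemma estimates : ∃ K : ℝ, 0 ≤ K ∧ ∀ i,
    |P i + (1 + 2 * ρ i)| ≤ ε i * (K * (1 + ρ i)) ∧
    |- (1 / 2) * m i + 1 / 2 * ∑ I, ∑ J, h I J i * V I i * V J i| ≤ K * (1 + ρ i) ∧
    |q i - ρ i * P i - 1 / 2 * (mu i + ε i * ∑ I, mI I i * V I i) + 1 / 2 * ε i * m i * ρ i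
      + 1 / 2 * ε i * ρ i * ∑ I, ∑ J, h I J i * V I i * V J i
      + 1 / 2 * ∑ I, ∑ J, (hu I J i + ε i * ∑ L, hK I J L i * V L i) * V I i * V J i
      + 1 / 2 * ε i * ∑ I, ∑ J, h I J i * (Z I i * V J i + V I i * Z J i)
      - ε i * P i * ∑ I, ∑ J, h I J i * V I i * V J i
      - (1 + ρ i) * (1 + 2 * ρ i)| ≤ ε i * (K * (1 + ρ i) ^ 2) ∧
    ∑ I, V I i ^ 2 ≤ 4 * (1 + ρ i) := by
  obtain ⟨N, N', dV0, dV1, hV2, dZ0, dZ1, dN, dN', hP, hq⟩ := H.degrees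
  have dV : ∀ I, Deg b 1 (V I) := by intro I; fin_cases I <;> assumption
  have dZ : ∀ I, Deg b 3 (Z I) := by intro I; fin_cases I <;> assumption
  have dε : Deg b 0 ε := Deg.of_bound (C := 1) fun i => by
    rw [abs_of_pos (H.ε_pos i)]; exact H.ε_le_one i
  have dρ : Deg b 2 ρ := by
    refine ⟨1, by norm_num, fun i => ?_⟩
    have h1 : |ρ i| ≤ 1 + ρ i := abs_le.2 ⟨by linarith [H.slope i], by linarith⟩
    rw [← H.b_sq] at h1
    rw [abs_of_nonneg (H.b_nonneg i), one_mul]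
    exact h1.trans (by nlinarith [H.b_nonneg i])
  have dm : Deg b 0 m := Deg.of_bound H.m_bound
  have dmI : ∀ I, Deg b 0 (mI I) := fun I => Deg.of_bound (H.mI_bound I)
  have dh : ∀ I J, Deg b 0 (h I J) := fun I J => Deg.of_bound (H.h_bound I J)
  have dhK : ∀ I J K, Deg b 0 (hK I J K) := fun I J K => Deg.of_bound (H.hK_bound I J K)
  have d2 : Deg b 0 (fun _ => (2 : ℝ)) := Deg.const 2
  have d1 : Deg b 0 (fun _ => (1 : ℝ)) := Deg.const 1
  have dhalf : Deg b 0 (fun _ => (1 / 2 : ℝ)) := Deg.const _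
  have dhalf' : Deg b 0 (fun _ => (-(1 / 2) : ℝ)) := Deg.const _
  have dhVV : Deg b 2 (fun i => ∑ I, ∑ J, h I J i * V I i * V J i) :=
    Deg.sum fun I => Deg.sum fun J => ((dh I J).mul (dV I)).mul (dV J)
  have dP : Deg b 2 P := by
    have : P = fun i => - (1 + 2 * ρ i) + ε i * N i := funext hP
    rw [this]
    exact ((d1.add (d2.mul dρ)).neg.add (dε.mul dN)).mono (by norm_num)
  have dS : Deg b 2 (fun i => -(1 / 2) * m i + 1 / 2 * ∑ I, ∑ J, h I J i * V I i * V J i) :=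
    ((dhalf'.mul dm).add (dhalf.mul dhVV)).mono (by norm_num)
  have dhZ : Deg b 4 (fun i => ∑ I, ∑ J, h I J i * (Z I i * V J i + V I i * Z J i)) :=
    Deg.sum fun I => Deg.sum fun J => ((dh I J).mul
      (((dZ I).mul (dV J)).add ((dV I).mul (dZ J)))).mono (by norm_num)
  have dhV3 : Deg b 3 (fun i => ∑ I, ∑ J, (∑ L, hK I J L i * V L i) * V I i * V J i) :=
    Deg.sum fun I => Deg.sum fun J => ((Deg.sum fun L => (dhK I J L).mul (dV L)).mul
      (dV I)).mul (dV J)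
  -- This is what the correction of the slope leaves over: the terms ½ ∂_u m and −½ ∂_u h(V,V) of q
  -- have cancelled, and every remaining term carries a factor ε, taken out here.
  have dR : Deg b 4 (fun i => N' i - (1 + ρ i) * N i - 1 / 2 * ∑ I, mI I i * V I i
      + 1 / 2 * (m i * ρ i) + 1 / 2 * (ρ i * ∑ I, ∑ J, h I J i * V I i * V J i)
      + 1 / 2 * (∑ I, ∑ J, (∑ L, hK I J L i * V L i) * V I i * V J i)
      + 1 / 2 * (∑ I, ∑ J, h I J i * (Z I i * V J i + V I i * Z J i))
      - P i * ∑ I, ∑ J, h I J i * V I i * V J i) := by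
    refine Deg.mono ((((((((dN'.sub ((d1.add dρ).mul dN)).sub
      (dhalf.mul (Deg.sum fun I => (dmI I).mul (dV I)))).add (dhalf.mul (dm.mul dρ))).add
      (dhalf.mul (dρ.mul dhVV))).add (dhalf.mul dhV3)).add (dhalf.mul dhZ)).sub
      (dP.mul dhVV))) (by norm_num)
  obtain ⟨K₁, hK₁, hN⟩ := dN
  obtain ⟨K₂, hK₂, hS⟩ := dS
  obtain ⟨K₃, hK₃, hR⟩ := dR
  -- (1 + b)² ≤ 2 + 2b², and the constant 2 is absorbed because b² = 1 + ρ ≥ 0.55. This converts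
  -- degrees into powers of 1 + ρ.
  have hb2 : ∀ i, (1 + |b i|) ^ 2 ≤ 6 * (1 + ρ i) := by
    intro i
    rw [abs_of_nonneg (H.b_nonneg i)]
    have h1 := H.b_sq i
    have h2 := H.slope i
    nlinarith [sq_nonneg (1 - b i)]
  have hb4 : ∀ i, (1 + |b i|) ^ 4 ≤ 36 * (1 + ρ i) ^ 2 := by
    intro i
    have h1 := hb2 i
    have h2 : 0 ≤ (1 + |b i|) ^ 2 := by positivity
    calc (1 + |b i|) ^ 4 = (1 + |b i|) ^ 2 * (1 + |b i|) ^ 2 := by ring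
      _ ≤ (6 * (1 + ρ i)) * (6 * (1 + ρ i)) := mul_le_mul h1 h1 h2 (h2.trans h1)
      _ = _ := by ring
  refine ⟨6 * K₁ + 6 * K₂ + 36 * K₃, by positivity, fun i => ?_⟩
  have hε := H.ε_pos i
  have ha : 0 ≤ 1 + ρ i := by linarith [H.slope i]
  refine ⟨?_, ?_, ?_, hV2 i⟩
  · have e : P i + (1 + 2 * ρ i) = ε i * N i := by rw [hP i]; ring
    rw [e, abs_mul, abs_of_pos hε]
    refine mul_le_mul_of_nonneg_left ?_ hε.le
    refine (hN i).trans ?_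
    have := mul_le_mul_of_nonneg_left (hb2 i) hK₁
    nlinarith [mul_nonneg hK₂ ha, mul_nonneg hK₃ ha]
  · refine (hS i).trans ?_
    have := mul_le_mul_of_nonneg_left (hb2 i) hK₂
    nlinarith [mul_nonneg hK₁ ha, mul_nonneg hK₃ ha]
  · have e : q i - ρ i * P i - 1 / 2 * (mu i + ε i * ∑ I, mI I i * V I i) + 1 / 2 * ε i * m i * ρ i
      + 1 / 2 * ε i * ρ i * ∑ I, ∑ J, h I J i * V I i * V J i
      + 1 / 2 * ∑ I, ∑ J, (hu I J i + ε i * ∑ L, hK I J L i * V L i) * V I i * V J i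
      + 1 / 2 * ε i * ∑ I, ∑ J, h I J i * (Z I i * V J i + V I i * Z J i)
      - ε i * P i * ∑ I, ∑ J, h I J i * V I i * V J i
      - (1 + ρ i) * (1 + 2 * ρ i) = ε i * (N' i - (1 + ρ i) * N i - 1 / 2 * ∑ I, mI I i * V I i
      + 1 / 2 * (m i * ρ i) + 1 / 2 * (ρ i * ∑ I, ∑ J, h I J i * V I i * V J i)
      + 1 / 2 * (∑ I, ∑ J, (∑ L, hK I J L i * V L i) * V I i * V J i)
      + 1 / 2 * (∑ I, ∑ J, h I J i * (Z I i * V J i + V I i * Z J i))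
      - P i * ∑ I, ∑ J, h I J i * V I i * V J i) := by
      have h1 := hP i
      have h2 := hq i
      simp only [Fin.sum_univ_two] at h2 ⊢
      linear_combination h2 - (1 + ρ i) * h1
    rw [e, abs_mul, abs_of_pos hε]
    refine mul_le_mul_of_nonneg_left ?_ hε.le
    refine (hR i).trans ?_
    have := mul_le_mul_of_nonneg_left (hb4 i) hK₃
    have h2 : 0 ≤ (1 + ρ i) ^ 2 := by positivity
    nlinarith [mul_nonneg hK₁ h2, mul_nonneg hK₂ h2]

end ScaledGeodesic

end

/-! ### Jets of geodesics satisfy the scaled equations. -/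

section

/-- The second jet of a geodesic of an asymptotically flat metric, in one of the two charts, at a
point that is far out and where the geodesic does not move inwards too fast. -/
structure Jet (R C : ℝ) where
  g : BondiMetric
  m : ℝ → E3 → ℝ
  h : ℝ → E3 → E3 →L[ℝ] E3 →L[ℝ] ℝ
  flat : AsymptoticallyFlat R C g m h
  s : Bool
  X : E4
  W : E4
  A : E4
  mem_region : X ∈ region R
  mem_disc : X 2 ^ 2 + X 3 ^ 2 ≤ 1
  motion : eulerLagrange (fun Y => bilin (g.comp s Y)) X W A = 0
  null : bilin (g.comp s X) W W = 0
  one_le_C : 1 ≤ C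
  far : 100 * C ≤ X 1
  forward : 0 < W 0
  slope : 0.55 ≤ 1 + W 1 / W 0

namespace Jet
variable {R C : ℝ} (i : Jet R C)

lemma r_pos : 0 < i.X 1 := by linarith [i.one_le_C, i.far]
lemma r_ne : i.X 1 ≠ 0 := i.r_pos.ne'
lemma p_ne : i.W 0 ≠ 0 := i.forward.ne'

lemma comp_zero_zero_eq : i.g.comp i.s i.X 0 0 =
    -1 + mChart i.m i.s i.X / i.X 1 + uuRem i.g i.m i.s i.X := by
  simp only [uuRem, mChart]; ring

lemma comp_zero_one_eq : i.g.comp i.s i.X 0 1 = -1 + urRem i.g i.s i.X := by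
  simp only [urRem]; ring

lemma comp_idx_idx_eq (I J : Fin 2) : i.g.comp i.s i.X (idx I) (idx J) =
    conformalFactor i.X * (if I = J then 1 else 0) * i.X 1 ^ 2
      + hChart i.h i.s I J i.X * i.X 1 + angRem i.g i.h i.s I J i.X := by
  rw [angRem, roundMetric_ang, i.g.comp_idx_idx, hChart]; ring

/-- The null condition divided by (u')²; each angular velocity absorbs one factor r, and each
remainder the power of r that makes it bounded. -/
lemma null_eq : conformalFactor i.X * ∑ I, (i.X 1 * i.W (idx I) / i.W 0) ^ 2 =
    1 + 2 * (i.W 1 / i.W 0) - (i.X 1)⁻¹ * (mChart i.m i.s i.X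
      + (i.X 1)⁻¹ * (i.X 1 ^ 2 * uuRem i.g i.m i.s i.X)
      + 2 * (i.X 1)⁻¹ * (i.X 1 ^ 2 * urRem i.g i.s i.X) * (i.W 1 / i.W 0)
      + 2 * ∑ I, i.g.comp i.s i.X 0 (idx I) * (i.X 1 * i.W (idx I) / i.W 0)
      + ∑ I, ∑ J, hChart i.h i.s I J i.X * (i.X 1 * i.W (idx I) / i.W 0)
          * (i.X 1 * i.W (idx J) / i.W 0)
      + (i.X 1)⁻¹ * ∑ I, ∑ J, angRem i.g i.h i.s I J i.X * (i.X 1 * i.W (idx I) / i.W 0)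
          * (i.X 1 * i.W (idx J) / i.W 0)) := by
  have h1 := i.null
  have hr := i.r_ne
  have hp := i.p_ne
  rw [i.g.bilin_comp_self, i.comp_zero_zero_eq, i.comp_zero_one_eq] at h1
  simp only [i.comp_idx_idx_eq, Fin.sum_univ_two, Fin.isValue, if_true, one_ne_zero, zero_ne_one,
    if_false] at h1 ⊢
  rw [← sub_eq_zero, ← mul_zero (i.W 0 ^ 2)⁻¹, ← h1]
  field_simp
  ring

/-- The r-component of the Euler–Lagrange covector, multiplied by r/(u')². -/
lemma u_eq : (-1 + (i.X 1)⁻¹ ^ 2 * (i.X 1 ^ 2 * urRem i.g i.s i.X))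
        * (i.X 1 * i.A 0 / i.W 0 ^ 2)
      + (i.X 1)⁻¹ * (i.X 1 ^ 2 * pd 0 (urRem i.g i.s) i.X)
      + (i.X 1)⁻¹ ^ 2 * ∑ I, (i.X 1 ^ 2 * pd (idx I) (urRem i.g i.s) i.X)
        * (i.X 1 * i.W (idx I) / i.W 0)
      + 1 / 2 * mChart i.m i.s i.X * (i.X 1)⁻¹
      - 1 / 2 * (i.X 1)⁻¹ ^ 2 * (i.X 1 ^ 3 * pd 1 (uuRem i.g i.m i.s) i.X)
      - (i.X 1)⁻¹ * ∑ I, (i.X 1 * pd 1 (fun Y => i.g.comp i.s Y 0 (idx I)) i.X)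
        * (i.X 1 * i.W (idx I) / i.W 0)
      - conformalFactor i.X * ∑ I, (i.X 1 * i.W (idx I) / i.W 0) ^ 2
      - 1 / 2 * (i.X 1)⁻¹ * ∑ I, ∑ J, hChart i.h i.s I J i.X * (i.X 1 * i.W (idx I) / i.W 0)
          * (i.X 1 * i.W (idx J) / i.W 0)
      - 1 / 2 * (i.X 1)⁻¹ ^ 2 * ∑ I, ∑ J, (i.X 1 * pd 1 (angRem i.g i.h i.s I J) i.X)
          * (i.X 1 * i.W (idx I) / i.W 0) * (i.X 1 * i.W (idx J) / i.W 0) = 0 := by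
  have h1 := congrArg (fun L => L (Pi.single 1 1)) i.motion
  have hr := i.r_ne
  have hp := i.p_ne
  simp only [zero_apply] at h1
  rw [BondiMetric.eulerLagrange_one (i.flat.differentiableAt_comp i.s i.mem_region),
    i.comp_zero_one_eq] at h1
  simp only [i.flat.pd_comp_zero_zero i.s i.mem_region i.r_ne,
    i.flat.pd_comp_zero_one i.s i.mem_region, i.flat.pd_comp_idx_idx i.s i.mem_region,
    pd_one_mChart, pd_one_hChart, pd_conformalFactor_one,
    Fin.sum_univ_two, Fin.isValue, if_true, one_ne_zero, zero_ne_one, if_false] at h1 ⊢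
  rw [← mul_zero (i.X 1 / i.W 0 ^ 2), ← h1]
  field_simp
  ring

/-- The u-component of the Euler–Lagrange covector, multiplied by r/(u')². -/
lemma r_eq : (-1 + mChart i.m i.s i.X * (i.X 1)⁻¹
        + (i.X 1)⁻¹ ^ 2 * (i.X 1 ^ 2 * uuRem i.g i.m i.s i.X)) * (i.X 1 * i.A 0 / i.W 0 ^ 2)
      + (-1 + (i.X 1)⁻¹ ^ 2 * (i.X 1 ^ 2 * urRem i.g i.s i.X)) * (i.X 1 * i.A 1 / i.W 0 ^ 2)
      + (i.X 1)⁻¹ * ∑ I, i.g.comp i.s i.X 0 (idx I) * (i.X 1 ^ 2 * i.A (idx I) / i.W 0 ^ 2)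
      + 1 / 2 * pd 0 (mChart i.m i.s) i.X
      + 1 / 2 * (i.X 1)⁻¹ * (i.X 1 ^ 2 * pd 0 (uuRem i.g i.m i.s) i.X)
      - 1 / 2 * ∑ I, ∑ J, pd 0 (hChart i.h i.s I J) i.X * (i.X 1 * i.W (idx I) / i.W 0)
          * (i.X 1 * i.W (idx J) / i.W 0)
      - 1 / 2 * (i.X 1)⁻¹ * ∑ I, ∑ J, pd 0 (angRem i.g i.h i.s I J) i.X
          * (i.X 1 * i.W (idx I) / i.W 0) * (i.X 1 * i.W (idx J) / i.W 0)
      - mChart i.m i.s i.X * (i.X 1)⁻¹ * (i.W 1 / i.W 0)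
      + (i.X 1)⁻¹ ^ 2 * (i.X 1 ^ 3 * pd 1 (uuRem i.g i.m i.s) i.X) * (i.W 1 / i.W 0)
      + (i.X 1)⁻¹ * ∑ I, pd (idx I) (mChart i.m i.s) i.X * (i.X 1 * i.W (idx I) / i.W 0)
      + (i.X 1)⁻¹ ^ 2 * ∑ I, (i.X 1 ^ 2 * pd (idx I) (uuRem i.g i.m i.s) i.X)
          * (i.X 1 * i.W (idx I) / i.W 0)
      + (i.X 1)⁻¹ ^ 2 * (i.X 1 ^ 3 * pd 1 (urRem i.g i.s) i.X) * (i.W 1 / i.W 0) ^ 2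
      + (i.X 1)⁻¹ ^ 2 * ∑ I, (i.X 1 ^ 2 * pd (idx I) (urRem i.g i.s) i.X)
          * (i.X 1 * i.W (idx I) / i.W 0) * (i.W 1 / i.W 0)
      + (i.X 1)⁻¹ * ∑ I, (i.X 1 * pd 1 (fun Y => i.g.comp i.s Y 0 (idx I)) i.X)
          * (i.W 1 / i.W 0) * (i.X 1 * i.W (idx I) / i.W 0)
      + (i.X 1)⁻¹ * ∑ I, ∑ J, pd (idx J) (fun Y => i.g.comp i.s Y 0 (idx I)) i.X
          * (i.X 1 * i.W (idx J) / i.W 0) * (i.X 1 * i.W (idx I) / i.W 0) = 0 := by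
  have h1 := congrArg (fun L => L (Pi.single 0 1)) i.motion
  have hr := i.r_ne
  have hp := i.p_ne
  simp only [zero_apply] at h1
  rw [BondiMetric.eulerLagrange_zero (i.flat.differentiableAt_comp i.s i.mem_region),
    i.comp_zero_one_eq, i.comp_zero_zero_eq] at h1
  simp only [i.flat.pd_comp_zero_zero i.s i.mem_region i.r_ne,
    i.flat.pd_comp_zero_one i.s i.mem_region, i.flat.pd_comp_idx_idx i.s i.mem_region,
    pd_one_mChart, pd_conformalFactor_zero, idx_ne_one,
    Fin.sum_univ_two, Fin.isValue, if_true, one_ne_zero, zero_ne_one, if_false] at h1 ⊢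
  rw [← mul_zero (i.X 1 / i.W 0 ^ 2), ← h1]
  field_simp
  ring

/-- An angular component of the Euler–Lagrange covector, divided by (u')²; the factor r² of g_{IJ}
is absorbed in `Z`. -/
lemma angular_eq (I : Fin 2) :
    (i.X 1)⁻¹ * i.g.comp i.s i.X 0 (idx I) * (i.X 1 * i.A 0 / i.W 0 ^ 2)
      + conformalFactor i.X * (i.X 1 ^ 2 * i.A (idx I) / i.W 0 ^ 2)
      + (i.X 1)⁻¹ * ∑ J, hChart i.h i.s I J i.X * (i.X 1 ^ 2 * i.A (idx J) / i.W 0 ^ 2)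
      + (i.X 1)⁻¹ ^ 2 * ∑ J, angRem i.g i.h i.s I J i.X * (i.X 1 ^ 2 * i.A (idx J) / i.W 0 ^ 2)
      + pd 0 (fun Y => i.g.comp i.s Y 0 (idx I)) i.X
      + (i.X 1)⁻¹ * (i.X 1 * pd 1 (fun Y => i.g.comp i.s Y 0 (idx I)) i.X) * (i.W 1 / i.W 0)
      + (i.X 1)⁻¹ * ∑ J, pd (idx J) (fun Y => i.g.comp i.s Y 0 (idx I)) i.X
        * (i.X 1 * i.W (idx J) / i.W 0)
      + ∑ J, (pd 0 (hChart i.h i.s I J) i.X + (i.X 1)⁻¹ * pd 0 (angRem i.g i.h i.s I J) i.X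
        + ((i.X 1)⁻¹ * hChart i.h i.s I J i.X
          + (i.X 1)⁻¹ ^ 2 * (i.X 1 * pd 1 (angRem i.g i.h i.s I J) i.X)) * (i.W 1 / i.W 0)
        + ∑ K, ((i.X 1)⁻¹ * pd (idx K) (hChart i.h i.s I J) i.X
          + (i.X 1)⁻¹ ^ 2 * pd (idx K) (angRem i.g i.h i.s I J) i.X)
            * (i.X 1 * i.W (idx K) / i.W 0)) * (i.X 1 * i.W (idx J) / i.W 0)
      + 2 * conformalFactor i.X * (i.W 1 / i.W 0) * (i.X 1 * i.W (idx I) / i.W 0)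
      + (∑ K, pd (idx K) conformalFactor i.X * (i.X 1 * i.W (idx K) / i.W 0))
        * (i.X 1 * i.W (idx I) / i.W 0)
      - 1 / 2 * (i.X 1)⁻¹ * pd (idx I) (mChart i.m i.s) i.X
      - 1 / 2 * (i.X 1)⁻¹ ^ 2 * (i.X 1 ^ 2 * pd (idx I) (uuRem i.g i.m i.s) i.X)
      - (i.X 1)⁻¹ ^ 2 * (i.X 1 ^ 2 * pd (idx I) (urRem i.g i.s) i.X) * (i.W 1 / i.W 0)
      - (i.X 1)⁻¹ * ∑ J, pd (idx I) (fun Y => i.g.comp i.s Y 0 (idx J)) i.X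
        * (i.X 1 * i.W (idx J) / i.W 0)
      - 1 / 2 * pd (idx I) conformalFactor i.X * ∑ J, (i.X 1 * i.W (idx J) / i.W 0) ^ 2
      - 1 / 2 * ∑ J, ∑ K, ((i.X 1)⁻¹ * pd (idx I) (hChart i.h i.s J K) i.X
          + (i.X 1)⁻¹ ^ 2 * pd (idx I) (angRem i.g i.h i.s J K) i.X)
          * (i.X 1 * i.W (idx J) / i.W 0) * (i.X 1 * i.W (idx K) / i.W 0) = 0 := by
  have h1 := congrArg (fun L => L (Pi.single (idx I) 1)) i.motion
  have hr := i.r_ne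
  have hp := i.p_ne
  simp only [zero_apply] at h1
  rw [BondiMetric.eulerLagrange_idx (i.flat.differentiableAt_comp i.s i.mem_region)] at h1
  rw [← mul_zero (i.W 0 ^ 2)⁻¹, ← h1]
  fin_cases I <;>
  · simp only [i.flat.pd_comp_zero_zero i.s i.mem_region i.r_ne, i.comp_idx_idx_eq,
      i.flat.pd_comp_zero_one i.s i.mem_region, i.flat.pd_comp_idx_idx i.s i.mem_region,
      pd_one_hChart, pd_conformalFactor_zero, pd_conformalFactor_one, idx_ne_one,
      Fin.zero_eta, Fin.mk_one,
      Fin.sum_univ_two, Fin.isValue, if_true, one_ne_zero, zero_ne_one, if_false]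
    field_simp
    ring

/-- The slope `dr/du`. -/
def ρ : ℝ := i.W 1 / i.W 0
/-- The scaled angular velocity. -/
def V (I : Fin 2) : ℝ := i.X 1 * i.W (idx I) / i.W 0
/-- The scaled acceleration of `u`. -/
def P : ℝ := i.X 1 * i.A 0 / i.W 0 ^ 2
/-- The scaled acceleration of `r`. -/
def q : ℝ := i.X 1 * i.A 1 / i.W 0 ^ 2
/-- The scaled angular acceleration. -/
def Z (I : Fin 2) : ℝ := i.X 1 ^ 2 * i.A (idx I) / i.W 0 ^ 2

lemma abs_pow_mul_le {f : ℝ} {n : ℕ} (hf : |f| ≤ C / i.X 1 ^ n) : |i.X 1 ^ n * f| ≤ C := by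
  have hr := pow_pos i.r_pos n
  rw [abs_mul, abs_of_pos hr]
  rwa [le_div_iff₀ hr, mul_comm] at hf

lemma abs_le_of_zero {f : ℝ} (hf : |f| ≤ C / i.X 1 ^ 0) : |f| ≤ C := by
  simpa using hf

end Jet

/-- The index type contains the jets for all metrics, charts and points together, so a constant
obtained from it depends on `R` and `C` alone. -/
theorem scaledGeodesic_jet {R C : ℝ} (hC : 1 ≤ C) :
    ScaledGeodesic (ι := Jet R C) C (fun i => √(1 + i.ρ)) (fun i => (i.X 1)⁻¹)
      (fun i => conformalFactor i.X) Jet.ρ Jet.P Jet.q (fun i => mChart i.m i.s i.X)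
      (fun i => pd 0 (mChart i.m i.s) i.X) (fun I i => pd (idx I) (mChart i.m i.s) i.X)
      (fun I i => i.V I) (fun I i => i.Z I) (fun I J i => hChart i.h i.s I J i.X)
      (fun I J i => pd 0 (hChart i.h i.s I J) i.X)
      (fun I J K i => pd (idx K) (hChart i.h i.s I J) i.X) where
  ε_pos i := inv_pos.2 i.r_pos
  ε_le i := by
    rw [inv_mul_le_iff₀ i.r_pos]
    linarith [i.far]
  one_le_C := hC
  b_nonneg i := Real.sqrt_nonneg _
  b_sq i := Real.sq_sqrt (by have := i.slope; simp only [Jet.ρ]; linarith)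
  slope i := i.slope
  ω_bounds i := conformalFactor_bounds i.mem_disc
  m_bound i := i.abs_le_of_zero (i.flat.m_bound i.s i.X i.mem_region i.mem_disc).1
  mu_bound i := i.abs_le_of_zero
    ((i.flat.m_bound i.s i.X i.mem_region i.mem_disc).2.2 0 (by norm_num))
  mI_bound I i := i.abs_le_of_zero
    ((i.flat.m_bound i.s i.X i.mem_region i.mem_disc).2.2 _ (idx_ne_one I))
  h_bound I J i := i.abs_le_of_zero (i.flat.h_bound i.s I J i.X i.mem_region i.mem_disc).1
  hu_bound I J i := i.abs_le_of_zero
    ((i.flat.h_bound i.s I J i.X i.mem_region i.mem_disc).2.2 0 (by norm_num))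
  hK_bound I J K i := i.abs_le_of_zero
    ((i.flat.h_bound i.s I J i.X i.mem_region i.mem_disc).2.2 _ (idx_ne_one K))
  equations := by
    have h0 := fun i : Jet R C => i.flat.guu_expansion i.s i.X i.mem_region i.mem_disc
    have h1 := fun i : Jet R C => i.flat.gur_expansion i.s i.X i.mem_region i.mem_disc
    have hI := fun (I : Fin 2) (i : Jet R C) =>
      i.flat.guI_expansion i.s I i.X i.mem_region i.mem_disc
    have hIJ := fun (I J : Fin 2) (i : Jet R C) =>
      i.flat.gIJ_expansion i.s I J i.X i.mem_region i.mem_disc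
    simp only [← BondiMetric.comp_zero_idx] at hI
    refine ⟨fun i => i.X 1 ^ 2 * uuRem i.g i.m i.s i.X,
      fun i => i.X 1 ^ 2 * pd 0 (uuRem i.g i.m i.s) i.X,
      fun i => i.X 1 ^ 3 * pd 1 (uuRem i.g i.m i.s) i.X,
      fun i => i.X 1 ^ 2 * urRem i.g i.s i.X,
      fun i => i.X 1 ^ 2 * pd 0 (urRem i.g i.s) i.X,
      fun i => i.X 1 ^ 3 * pd 1 (urRem i.g i.s) i.X,
      fun I i => i.X 1 ^ 2 * pd (idx I) (uuRem i.g i.m i.s) i.X,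
      fun I i => i.X 1 ^ 2 * pd (idx I) (urRem i.g i.s) i.X,
      fun I i => i.g.comp i.s i.X 0 (idx I),
      fun I i => pd 0 (fun Y => i.g.comp i.s Y 0 (idx I)) i.X,
      fun I i => i.X 1 * pd 1 (fun Y => i.g.comp i.s Y 0 (idx I)) i.X,
      fun I i => pd (idx I) conformalFactor i.X,
      fun I J i => pd (idx J) (fun Y => i.g.comp i.s Y 0 (idx I)) i.X,
      fun I J i => angRem i.g i.h i.s I J i.X,
      fun I J i => pd 0 (angRem i.g i.h i.s I J) i.X,
      fun I J i => i.X 1 * pd 1 (angRem i.g i.h i.s I J) i.X,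
      fun I J K i => pd (idx K) (angRem i.g i.h i.s I J) i.X,
      ⟨fun i => i.abs_pow_mul_le (h0 i).1, fun i => i.abs_pow_mul_le ((h0 i).2.2 0 (by norm_num)),
        fun i => i.abs_pow_mul_le (h0 i).2.1, fun i => i.abs_pow_mul_le (h1 i).1,
        fun i => i.abs_pow_mul_le ((h1 i).2.2 0 (by norm_num)),
        fun i => i.abs_pow_mul_le (h1 i).2.1,
        fun I i => i.abs_pow_mul_le ((h0 i).2.2 _ (idx_ne_one I)),
        fun I i => i.abs_pow_mul_le ((h1 i).2.2 _ (idx_ne_one I)),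
        fun I i => i.abs_le_of_zero (hI I i).1,
        fun I i => i.abs_le_of_zero ((hI I i).2.2 0 (by norm_num)),
        fun I i => ?_, fun I i => abs_pd_conformalFactor_le i.mem_disc _,
        fun I J i => i.abs_le_of_zero ((hI I i).2.2 _ (idx_ne_one J)),
        fun I J i => i.abs_le_of_zero (hIJ I J i).1,
        fun I J i => i.abs_le_of_zero ((hIJ I J i).2.2 0 (by norm_num)),
        fun I J i => ?_, fun I J K i => i.abs_le_of_zero ((hIJ I J i).2.2 _ (idx_ne_one K))⟩,
      Jet.null_eq, Jet.u_eq, Jet.r_eq, fun I i => i.angular_eq I⟩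
    · have := i.abs_pow_mul_le (hI I i).2.1
      rwa [zero_add, pow_one] at this
    · have := i.abs_pow_mul_le (hIJ I J i).2.1
      rwa [zero_add, pow_one] at this

end

/-! ### The corrected slope and its derivative along a geodesic. -/

section

lemma OrderBound.mono {R C C' : ℝ} {n : ℕ} {f : E4 → ℝ} (hR : 0 ≤ R) (hC : C ≤ C')
    (hf : OrderBound R C n f) : OrderBound R C' n f := by
  intro X hX hd
  obtain ⟨h1, h2, h3⟩ := hf X hX hd
  have hr : 0 < X 1 := hR.trans_lt hX
  have key : ∀ k : ℕ, C / X 1 ^ k ≤ C' / X 1 ^ k := fun k => by gcongr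
  exact ⟨h1.trans (key _), h2.trans (key _), fun μ hμ => (h3 μ hμ).trans (key _)⟩

section
variable {R C : ℝ} {g : BondiMetric} {m : ℝ → E3 → ℝ} {h : ℝ → E3 → E3 →L[ℝ] E3 →L[ℝ] ℝ}

lemma AsymptoticallyFlat.mono {C' : ℝ} (H : AsymptoticallyFlat R C g m h) (hR : 0 ≤ R)
    (hC : C ≤ C') : AsymptoticallyFlat R C' g m h :=
  { H with
    m_bound := fun s => (H.m_bound s).mono hR hC
    h_bound := fun s I J => (H.h_bound s I J).mono hR hC
    guu_expansion := fun s => (H.guu_expansion s).mono hR hC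
    gur_expansion := fun s => (H.gur_expansion s).mono hR hC
    guI_expansion := fun s I => (H.guI_expansion s I).mono hR hC
    gIJ_expansion := fun s I J => (H.gIJ_expansion s I J).mono hR hC }

/-- The slope `dr/du` of a curve, shifted by one and corrected by terms that are small for large `r`
and remove the rapidly changing part of its derivative. -/
def Curve.correctedSlope (m : ℝ → E3 → ℝ) (h : ℝ → E3 → E3 →L[ℝ] E3 →L[ℝ] ℝ) (c : Curve)
    (t : ℝ) : ℝ :=
  1 + deriv c.r t / deriv c.u t - m (c.u t) (c.x t) / (2 * c.r t)
    + c.r t * h (c.u t) (c.x t) (deriv c.x t) (deriv c.x t) / (2 * deriv c.u t ^ 2)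

variable {c : Curve} {J : Set ℝ} (hc : IsNullGeodesic R g c J)
include hc

namespace IsNullGeodesic

/-- The second jet of a geodesic in a chart. -/
def jet (H : AsymptoticallyFlat R C g m h) {t : ℝ} (ht : t ∈ J) {s : Bool}
    (hs : InChart s (c.x t)) (hd : angularCoord s (c.x t) 0 ^ 2 + angularCoord s (c.x t) 1 ^ 2 ≤ 1)
    (hC : 1 ≤ C) (hr : 100 * C ≤ c.r t) (hp : 0 < deriv c.u t)
    (hq : 0.55 ≤ 1 + deriv c.r t / deriv c.u t) : Jet R C where
  g := g
  m := m
  h := h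
  flat := H
  s := s
  X := c.lift s t
  W := deriv (c.lift s) t
  A := deriv (deriv (c.lift s)) t
  mem_region := hc.lift_mem_region ht
  mem_disc := hd
  motion := hc.eulerLagrange_lift H ht hs
  null := hc.null_lift ht hs
  one_le_C := hC
  far := hr
  forward := by rwa [← hc.deriv_u ht hs]
  slope := by rwa [← hc.deriv_u ht hs, ← hc.deriv_r ht hs]

lemma h_velocity {t : ℝ} (ht : t ∈ J) {s : Bool} (hs : InChart s (c.x t)) :
    h (c.u t) (c.x t) (deriv c.x t) (deriv c.x t) =
      ∑ I, ∑ K, hChart h s I K (c.lift s t) * deriv (c.lift s) t (idx I)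
        * deriv (c.lift s) t (idx K) := by
  have e : ∀ I, ang (deriv (c.lift s) t) I = deriv (c.lift s) t (idx I) := by
    intro I; fin_cases I <;> rfl
  have h0 : c.lift s t 0 = c.u t := rfl
  rw [hc.deriv_x ht hs, fderiv_stereo_eq_sum]
  simp only [map_add, map_smul, _root_.add_apply, _root_.smul_apply, smul_eq_mul, Fin.sum_univ_two,
    hChart, hc.stereo_lift ht hs, h0, e]
  ring

lemma norm_deriv_x_sq {t : ℝ} (ht : t ∈ J) {s : Bool} (hs : InChart s (c.x t)) :
    ‖deriv c.x t‖ ^ 2 = conformalFactor (c.lift s t) * ∑ I, deriv (c.lift s) t (idx I) ^ 2 := by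
  rw [hc.deriv_x ht hs, ← real_inner_self_eq_norm_sq, inner_fderiv_stereo, Fin.sum_univ_two]
  simp only [conformalFactor, ang, idx, Matrix.cons_val_zero, Matrix.cons_val_one]
  ring

lemma correctedSlope_eq {t : ℝ} (ht : t ∈ J) {s : Bool} (hs : InChart s (c.x t)) :
    c.correctedSlope m h t = 1 + deriv (c.lift s) t 1 / deriv (c.lift s) t 0
      - mChart m s (c.lift s t) / (2 * c.lift s t 1)
      + c.lift s t 1 * (∑ I, ∑ K, hChart h s I K (c.lift s t) * deriv (c.lift s) t (idx I)
        * deriv (c.lift s) t (idx K)) / (2 * deriv (c.lift s) t 0 ^ 2) := by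
  rw [Curve.correctedSlope, hc.h_velocity ht hs, hc.deriv_u ht hs, hc.deriv_r ht hs, mChart,
    hc.stereo_lift ht hs]
  rfl

lemma hasDerivAt_comp_lift {t : ℝ} (ht : t ∈ J) {s : Bool} (hs : InChart s (c.x t)) {f : E4 → ℝ}
    (hf : DifferentiableAt ℝ f (c.lift s t)) : HasDerivAt (fun τ => f (c.lift s τ))
      (pd 0 f (c.lift s t) * deriv (c.lift s) t 0 + pd 1 f (c.lift s t) * deriv (c.lift s) t 1
        + ∑ I, pd (idx I) f (c.lift s t) * deriv (c.lift s) t (idx I)) t := by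
  have h1 := hf.hasFDerivAt.comp_hasDerivAt t
    ((hc.contDiffAt_lift ht hs).differentiableAt (by norm_num)).hasDerivAt
  rw [fderiv_eq_sum_pd, Fin.sum_univ_four] at h1
  refine h1.congr_deriv ?_
  simp only [Fin.sum_univ_two, idx, Matrix.cons_val_zero, Matrix.cons_val_one]
  ring

/-- Up to the flat term (1 + ρ)(1 + 2ρ), the factor multiplying `i.W 0 / i.X 1` is the quantity
estimated in `ScaledGeodesic.estimates`. Differentiating m and h along the curve produces no
r-derivative, as they depend on u and x only. The jet is introduced through the equation `hi` so
that it stays opaque. -/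
lemma hasDerivAt_correctedSlope (H : AsymptoticallyFlat R C g m h) {t : ℝ} (ht : t ∈ J) {s : Bool}
    (hs : InChart s (c.x t))
    (hd : angularCoord s (c.x t) 0 ^ 2 + angularCoord s (c.x t) 1 ^ 2 ≤ 1)
    (hC : 1 ≤ C) (hr : 100 * C ≤ c.r t) (hp : 0 < deriv c.u t)
    (hq : 0.55 ≤ 1 + deriv c.r t / deriv c.u t) (i : Jet R C)
    (hi : i = hc.jet H ht hs hd hC hr hp hq) :
    HasDerivAt (c.correctedSlope m h) (i.W 0 / i.X 1 * (i.q - i.ρ * i.P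
      - 1 / 2 * (pd 0 (mChart m s) i.X + (i.X 1)⁻¹ * ∑ I, pd (idx I) (mChart m s) i.X * i.V I)
      + 1 / 2 * (i.X 1)⁻¹ * mChart m s i.X * i.ρ
      + 1 / 2 * (i.X 1)⁻¹ * i.ρ * ∑ I, ∑ J, hChart h s I J i.X * i.V I * i.V J
      + 1 / 2 * ∑ I, ∑ J, (pd 0 (hChart h s I J) i.X
        + (i.X 1)⁻¹ * ∑ L, pd (idx L) (hChart h s I J) i.X * i.V L) * i.V I * i.V J
      + 1 / 2 * (i.X 1)⁻¹ * ∑ I, ∑ J, hChart h s I J i.X * (i.Z I * i.V J + i.V I * i.Z J)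
      - (i.X 1)⁻¹ * i.P * ∑ I, ∑ J, hChart h s I J i.X * i.V I * i.V J)) t := by
  have hrn : i.X 1 ≠ 0 := i.r_ne
  have hpn : i.W 0 ≠ 0 := i.p_ne
  have hW : HasDerivAt (deriv (c.lift s)) i.A t := by
    have := ((contDiffAt_deriv (hc.contDiffAt_lift ht hs)).differentiableAt
      (by norm_num)).hasDerivAt
    rw [hi]; exact this
  have dW : ∀ μ, HasDerivAt (fun τ => deriv (c.lift s) τ μ) (i.A μ) t := hasDerivAt_pi.1 hW
  have dX : HasDerivAt (fun τ => c.lift s τ 1) (i.W 1) t := by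
    have := hasDerivAt_pi.1 ((hc.contDiffAt_lift ht hs).differentiableAt (by norm_num)).hasDerivAt 1
    rw [hi]; exact this
  have dm := hc.hasDerivAt_comp_lift ht hs (H.differentiableAt_mChart s _)
  have dh := fun I K => hc.hasDerivAt_comp_lift ht hs (H.differentiableAt_hChart s I K _)
  simp only [pd_one_mChart, pd_one_hChart] at dm dh
  have eX : c.lift s t = i.X := by rw [hi]; rfl
  have eW : deriv (c.lift s) t = i.W := by rw [hi]; rfl
  have dS := HasDerivAt.fun_sum (u := Finset.univ) fun I _ => HasDerivAt.fun_sum (u := Finset.univ)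
    fun K _ => ((dh I K).fun_mul (dW (idx I))).fun_mul (dW (idx K))
  rw [← eX] at hrn
  rw [← eW] at hpn
  have key := (((hasDerivAt_const t (1 : ℝ)).fun_add ((dW 1).fun_div (dW 0) hpn)).fun_sub
    (dm.fun_div (dX.const_mul 2) (mul_ne_zero two_ne_zero hrn))).fun_add
    ((dX.fun_mul dS).fun_div (((dW 0).fun_pow 2).const_mul 2)
      (mul_ne_zero two_ne_zero (pow_ne_zero 2 hpn)))
  refine (key.congr_of_eventuallyEq ?_).congr_deriv ?_
  · exact (hc.eventually_inChart ht hs).mono fun τ hτ => hc.correctedSlope_eq hτ.1 hτ.2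
  · rw [eX] at hrn
    rw [eW] at hpn
    simp only [Jet.q, Jet.ρ, Jet.P, Jet.V, Jet.Z, eX, eW, Fin.sum_univ_two]
    field_simp
    ring

end IsNullGeodesic
end

end

/-! ### Uniform estimates far out. -/

section

/-- Far out, the corrected slope of a geodesic that does not move inwards too fast grows at a rate
given by the slope, uniformly for all metrics with the same bounds. -/
theorem exists_correctedSlope_estimates (R : ℝ) {C : ℝ} (hC : 1 ≤ C) :
    ∃ r₂ : ℝ, 1 ≤ r₂ ∧ ∀ (g : BondiMetric) (m : ℝ → E3 → ℝ) (h : ℝ → E3 → E3 →L[ℝ] E3 →L[ℝ] ℝ),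
      AsymptoticallyFlat R C g m h → ∀ (c : Curve) (J : Set ℝ), IsNullGeodesic R g c J →
      ∀ t ∈ J, ∀ a, a = 1 + deriv c.r t / deriv c.u t → r₂ ≤ c.r t → 0 < deriv c.u t → 0.55 ≤ a →
        DifferentiableAt ℝ (c.correctedSlope m h) t ∧
        0.99 * ((2 * a - 1) * a * deriv c.u t / c.r t) ≤ deriv (c.correctedSlope m h) t ∧
        deriv (c.correctedSlope m h) t ≤ 1.01 * ((2 * a - 1) * a * deriv c.u t / c.r t) ∧
        |c.correctedSlope m h t - a| ≤ a / 1000 ∧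
        |deriv (deriv c.u) t| ≤ 3 * (deriv c.u t * a) * deriv c.u t / c.r t ∧
        ‖deriv c.x t‖ ≤ 4 * (deriv c.u t + deriv c.u t * a) := by
  obtain ⟨K, hK, hest⟩ := (scaledGeodesic_jet (R := R) hC).estimates
  -- The term 100 C is the condition `Jet.far`; the term 1000 K makes all relative errors K/r at
  -- most 1/1000.
  refine ⟨100 * C + 1000 * K, by linarith, ?_⟩
  intro g m h H c J hc t ht a ha hr hp hq
  obtain ⟨s, hs, hd⟩ := exists_chart (hc.mem_sphere t ht)
  have hq' : 0.55 ≤ 1 + deriv c.r t / deriv c.u t := ha ▸ hq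
  obtain ⟨i, hi⟩ : ∃ i, i = hc.jet H ht hs hd hC (by linarith) hp hq' := ⟨_, rfl⟩
  have hQ := hc.hasDerivAt_correctedSlope H ht hs hd hC (by linarith) hp hq' i hi
  have eX : c.lift s t = i.X := by rw [hi]; rfl
  have eW : deriv (c.lift s) t = i.W := by rw [hi]; rfl
  have er : c.r t = i.X 1 := by rw [← eX]; rfl
  have ep : deriv c.u t = i.W 0 := by rw [← eW]; exact hc.deriv_u ht hs
  have ea : a = 1 + i.ρ := by
    rw [ha, ep, Jet.ρ, ← eW, hc.deriv_r ht hs]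
  have eA : deriv (deriv c.u) t = i.P * i.W 0 ^ 2 / i.X 1 := by
    have h1 : deriv (deriv fun τ => c.lift s τ 0) t = deriv (deriv (c.lift s)) t 0 :=
      deriv_deriv_apply_of_contDiffAt (hc.contDiffAt_lift ht hs) 0
    have h2 : deriv (deriv (c.lift s)) t 0 = i.A 0 := by rw [hi]; rfl
    have h3 : (fun τ => c.lift s τ 0) = c.u := rfl
    have hrn := i.r_ne
    have hpn := i.p_ne
    rw [h3, h2] at h1
    rw [h1, Jet.P]
    field_simp
  have es : i.s = s := by rw [hi]; rfl
  have em : i.m = m := by rw [hi]; rfl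
  have eh : i.h = h := by rw [hi]; rfl
  obtain ⟨h1, h2, h3, h4⟩ := hest i
  simp only [es, em, eh] at h2 h3
  have hcs := hc.correctedSlope_eq (m := m) (h := h) ht hs
  have hx := hc.norm_deriv_x_sq ht hs
  rw [eX, eW] at hcs hx
  rw [er] at hr ⊢
  rw [ep] at hp ⊢
  rw [eA]
  have hrho : i.ρ = a - 1 := by linarith
  have hrpos := i.r_pos
  set ε := (i.X 1)⁻¹ with hε
  have hεpos : 0 < ε := inv_pos.2 hrpos
  have hεr : ε * i.X 1 = 1 := inv_mul_cancel₀ hrpos.ne'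
  have hεK : ε * K ≤ 1 / 1000 := by
    rw [hε, inv_mul_le_iff₀ hrpos]
    linarith
  have hdiv : ∀ z, z / i.X 1 = z * ε := fun z => div_eq_mul_inv z _
  simp only [← ea] at h1 h2 h3 h4
  have hsmall : ∀ z, 0 ≤ z → ε * (K * z) ≤ z / 1000 := fun z hz => by
    have := mul_le_mul_of_nonneg_right hεK hz
    linarith
  have hp' := hp.le
  -- The error is proportional to a², the main term to (2a − 1) a. They are comparable only because
  -- a ≥ 0.55 stays away from 1/2.
  have hsq : a ^ 2 / 1000 ≤ 0.01 * ((2 * a - 1) * a) := by nlinarith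
  have hr1 : 1 ≤ i.X 1 := by linarith
  refine ⟨hQ.differentiableAt, ?_, ?_, ?_, ?_, ?_⟩
  · rw [hQ.deriv]
    have h5 := (abs_le.1 (h3.trans (hsmall _ (sq_nonneg a)))).1
    rw [hdiv (i.W 0), hdiv, show 0.99 * ((2 * a - 1) * a * i.W 0 * ε) = i.W 0 * ε * (0.99 * ((2 * a - 1) * a))
      by ring]
    refine mul_le_mul_of_nonneg_left ?_ (by positivity)
    rw [hrho] at h5 ⊢
    linarith
  · rw [hQ.deriv]
    have h5 := (abs_le.1 (h3.trans (hsmall _ (sq_nonneg a)))).2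
    rw [hdiv (i.W 0), hdiv, show 1.01 * ((2 * a - 1) * a * i.W 0 * ε) = i.W 0 * ε * (1.01 * ((2 * a - 1) * a))
      by ring]
    refine mul_le_mul_of_nonneg_left ?_ (by positivity)
    rw [hrho] at h5 ⊢
    linarith
  · have e : c.correctedSlope m h t - a = ε * (-(1 / 2) * mChart m s i.X
        + 1 / 2 * ∑ I, ∑ J, hChart h s I J i.X * i.V I * i.V J) := by
      have hrn := i.r_ne
      have hpn := i.p_ne
      rw [hcs, ea]
      simp only [Jet.ρ, Jet.V, Fin.sum_univ_two, hε]
      field_simp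
      ring
    rw [e, abs_mul, abs_of_pos hεpos]
    exact (mul_le_mul_of_nonneg_left h2 hεpos.le).trans (hsmall _ (by linarith))
  · have h5 := abs_le.1 (h1.trans (hsmall _ (by linarith)))
    have h6 : |i.P| ≤ 3 * a := by
      rw [abs_le]
      constructor <;> linarith [h5.1, h5.2]
    rw [hdiv, hdiv, show i.P * i.W 0 ^ 2 * ε = i.P * (i.W 0 ^ 2 * ε) by ring, abs_mul,
      abs_of_nonneg (by positivity : 0 ≤ i.W 0 ^ 2 * ε)]
    calc |i.P| * (i.W 0 ^ 2 * ε) ≤ 3 * a * (i.W 0 ^ 2 * ε) :=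
        mul_le_mul_of_nonneg_right h6 (by positivity)
      _ = _ := by ring
  · have e : ∑ I, i.W (idx I) ^ 2 = (i.W 0 * ε) ^ 2 * ∑ I, i.V I ^ 2 := by
      have hrn := i.r_ne
      have hpn := i.p_ne
      simp only [Jet.V, Fin.sum_univ_two, hε]
      field_simp
    have h5 := conformalFactor_bounds i.mem_disc
    have hε1 : ε ≤ 1 := inv_le_one_of_one_le₀ hr1
    have ha0 : 0 ≤ a := by linarith
    have h6 : ‖deriv c.x t‖ ^ 2 ≤ (4 * (i.W 0 + i.W 0 * a)) ^ 2 := by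
      rw [hx, e]
      have h7 : (i.W 0 * ε) ^ 2 ≤ i.W 0 ^ 2 := by
        rw [mul_pow]
        exact mul_le_of_le_one_right (by positivity) (pow_le_one₀ hεpos.le hε1)
      calc conformalFactor i.X * ((i.W 0 * ε) ^ 2 * ∑ I, i.V I ^ 2)
          ≤ 4 * (i.W 0 ^ 2 * (4 * a)) := by
            gcongr
            exact h5.2
        _ ≤ _ := by
          have h8 : 0 ≤ i.W 0 ^ 2 * (1 + a + a ^ 2) := by positivity
          linarith
    exact (abs_le_of_sq_le_sq' h6 (by positivity)).2

/-- The maximum with R + 1 places `r₂` strictly inside the region, as the continuation argument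
requires. -/
theorem exists_almostStraight (R : ℝ) {C : ℝ} (hC : 1 ≤ C) :
    ∃ r₂ : ℝ, R < r₂ ∧ ∀ (g : BondiMetric) (m : ℝ → E3 → ℝ) (h : ℝ → E3 → E3 →L[ℝ] E3 →L[ℝ] ℝ),
      AsymptoticallyFlat R C g m h → ∀ (c : Curve) (J : Set ℝ), IsNullGeodesic R g c J → 0 ∈ J →
        AlmostStraight r₂ J c.u c.r (deriv c.u) (deriv c.r) (c.correctedSlope m h) ∧
        ∀ t ∈ J, r₂ ≤ c.r t → 0 < deriv c.u t → 0.55 ≤ 1 + deriv c.r t / deriv c.u t →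
          ‖deriv c.x t‖ ≤ 4 * (deriv c.u t + deriv c.u t * (1 + deriv c.r t / deriv c.u t)) := by
  obtain ⟨r₂, hr₂, hest⟩ := exists_correctedSlope_estimates R hC
  refine ⟨max r₂ (R + 1), by linarith [le_max_right r₂ (R + 1)], ?_⟩
  intro g m h H c J hc h0
  refine ⟨⟨by linarith [le_max_left r₂ (R + 1)], hc.ordConnected, h0, fun t ht => ?_, fun t ht => ?_,
    fun t ht => ?_, fun t ht => ?_, fun t ht hr hp hq => ?_⟩, fun t ht hr hp hq => ?_⟩
  · exact ((hc.contDiffAt_u ht).differentiableAt (by norm_num)).hasDerivAt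
  · exact ((hc.contDiffAt_r ht).differentiableAt (by norm_num)).hasDerivAt
  · exact (contDiffAt_deriv (hc.contDiffAt_u ht)).differentiableAt (by norm_num)
  · exact (contDiffAt_deriv (hc.contDiffAt_r ht)).continuousAt
  · obtain ⟨h1, h2, h3, h4, h5, -⟩ :=
      hest g m h H c J hc t ht _ rfl ((le_max_left _ _).trans hr) hp hq
    exact ⟨h1, h2, h3, h4, h5⟩
  · exact (hest g m h H c J hc t ht _ rfl ((le_max_left _ _).trans hr) hp hq).2.2.2.2.2

end

/-! ### The bound on the infimum of Ω, and the conclusion. -/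

section

section
variable {R C : ℝ} {g : BondiMetric} {m : ℝ → E3 → ℝ} {h : ℝ → E3 → E3 →L[ℝ] E3 →L[ℝ] ℝ}

/-- In the Bondi gauge, the first-order coefficient of the angular metric is trace-free. -/
lemma trace_h_eq_zero (H : AsymptoticallyFlat R C g m h) (hg : BondiGauge R g) (hC : 1 ≤ C)
    (s : Bool) (u : ℝ) :
    h u (stereo s 0) (frame s 0 0) (frame s 0 0) + h u (stereo s 0) (frame s 0 1) (frame s 0 1)
      = 0 := by
  set T := h u (stereo s 0) (frame s 0 0) (frame s 0 0)
    + h u (stereo s 0) (frame s 0 1) (frame s 0 1) with hT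
  have key : ∀ r, R < r → 1 ≤ r → r * |T| ≤ 2 * C + 2 * C ^ 2 := by
    intro r hr h1
    set X : E4 := quad u r 0 with hX
    have hXR : X ∈ region R := hr
    have hXd : X 2 ^ 2 + X 3 ^ 2 ≤ 1 := by simp [hX, quad]
    have ha : ang X = 0 := ang_quad u r 0
    have hω : conformalFactor X = 4 := by simp [hX, quad, conformalFactor]
    have hk := fun I J => (H.gIJ_expansion s I J X hXR hXd).1
    have hh := fun I J => (H.h_bound s I J X hXR hXd).1
    have hdet := hg s X hXR
    have hblock : ∀ I J, g.angularBlock s X I J = angRem g h s I J X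
        + (4 * (if I = J then 1 else 0) * r ^ 2 + hChart h s I J X * r) := by
      intro I J
      rw [angRem, roundMetric_ang, hω, hChart]
      simp [hX]
    have hT' : T = hChart h s 0 0 X + hChart h s 1 1 X := by
      simp only [hChart, ha]; rfl
    have hk' : ∀ I J, |angRem g h s I J X| ≤ C := fun I J => (hk I J).trans_eq (by simp)
    have hh' : ∀ I J, |hChart h s I J X| ≤ C := fun I J => (hh I J).trans_eq (by simp)
    have hlin : ∀ I J, |hChart h s I J X * r + angRem g h s I J X| ≤ 2 * C * r := by
      intro I J
      refine (abs_add_le _ _).trans ?_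
      rw [abs_mul, abs_of_pos (by linarith : 0 < r)]
      nlinarith [hk' I J, hh' I J, abs_nonneg (hChart h s I J X)]
    have hprod : ∀ I J I' J', |(hChart h s I J X * r + angRem g h s I J X)
        * (hChart h s I' J' X * r + angRem g h s I' J' X)| ≤ 4 * C ^ 2 * r ^ 2 := by
      intro I J I' J'
      rw [abs_mul]
      calc _ ≤ (2 * C * r) * (2 * C * r) :=
            mul_le_mul (hlin I J) (hlin I' J') (abs_nonneg _) (by positivity)
        _ = _ := by ring
    -- At the centre of the chart the gauge reads det(4r² + E) = det(4r²), that is 4r² tr E + det E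
    -- = 0, with E = r h + O(1). The part of order r³ is 4r³ T, and all else is O(r²).
    have e : 4 * r ^ 2 * (r * T) = - (4 * r ^ 2 * (angRem g h s 0 0 X + angRem g h s 1 1 X))
        - (hChart h s 0 0 X * r + angRem g h s 0 0 X) * (hChart h s 1 1 X * r + angRem g h s 1 1 X)
        + (hChart h s 0 1 X * r + angRem g h s 0 1 X)
          * (hChart h s 1 0 X * r + angRem g h s 1 0 X) := by
      have hX1 : X 1 = r := rfl
      rw [Matrix.det_fin_two, Matrix.det_fin_two] at hdet
      simp only [Matrix.smul_apply, smul_eq_mul, roundMetric_ang, hω, hblock, hX1,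
        Fin.isValue, if_true, one_ne_zero, zero_ne_one, if_false] at hdet
      rw [hT']
      linear_combination hdet
    have h2 : |4 * r ^ 2 * (r * T)| ≤ 4 * r ^ 2 * (2 * C) + 4 * C ^ 2 * r ^ 2 + 4 * C ^ 2 * r ^ 2 := by
      rw [e]
      refine (abs_add_le _ _).trans (add_le_add ((abs_sub _ _).trans (add_le_add ?_ ?_)) ?_)
      · rw [abs_neg, abs_mul, abs_of_pos (by positivity : 0 < 4 * r ^ 2)]
        refine mul_le_mul_of_nonneg_left ?_ (by positivity)
        exact (abs_add_le _ _).trans (by linarith [hk' 0 0, hk' 1 1])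
      · exact hprod _ _ _ _
      · exact hprod _ _ _ _
    rw [abs_mul, abs_mul r, abs_of_pos (by positivity : 0 < 4 * r ^ 2),
      abs_of_pos (by linarith : 0 < r)] at h2
    refine le_of_mul_le_mul_left (h2.trans_eq ?_) (by positivity : 0 < 4 * r ^ 2)
    ring
  by_contra hne
  have hpos : 0 < |T| := abs_pos.2 hne
  set r := max (R + 1) (max 1 ((2 * C + 2 * C ^ 2 + 1) / |T|)) with hr
  have h1 := key r (by linarith [le_max_left (R + 1) (max 1 ((2 * C + 2 * C ^ 2 + 1) / |T|))])
    ((le_max_left _ _).trans (le_max_right _ _))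
  have h2 : (2 * C + 2 * C ^ 2 + 1) / |T| ≤ r := (le_max_right _ _).trans (le_max_right _ _)
  rw [div_le_iff₀ hpos] at h2
  linarith

lemma AsymptoticallyFlat.differentiable_m (H : AsymptoticallyFlat R C g m h) (s : Bool)
    (y : Fin 2 → ℝ) : Differentiable ℝ fun t => m t (stereo s y) := by
  have h1 : Differentiable ℝ fun t => quad t 0 y := fun t =>
    (contDiffAt_quad (n := 1) contDiffAt_id contDiffAt_const contDiffAt_const).differentiableAt
      (by norm_num)
  have h2 := ((H.m_regular s).differentiable (by norm_num)).comp h1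
  simpa only [Function.comp_def, ang_quad, quad_zero] using h2

lemma AsymptoticallyFlat.differentiable_h (H : AsymptoticallyFlat R C g m h) (s : Bool)
    (y : Fin 2 → ℝ) (I K : Fin 2) :
    Differentiable ℝ fun t => h t (stereo s y) (frame s y I) (frame s y K) := by
  have h1 : Differentiable ℝ fun t => quad t 0 y := fun t =>
    (contDiffAt_quad (n := 1) contDiffAt_id contDiffAt_const contDiffAt_const).differentiableAt
      (by norm_num)
  have h2 := ((H.h_regular s I K).differentiable (by norm_num)).comp h1
  simpa only [Function.comp_def, ang_quad, quad_zero] using h2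

/-- In the Bondi gauge, the infimum of `Ω` is at most one: its average over directions is
`1 + ½ ∂_u m`, and `m` is bounded. -/
theorem omega_inf_le_one (H : AsymptoticallyFlat R C g m h) (hg : BondiGauge R g) (hC : 1 ≤ C)
    {Ωi : ℝ} (hΩ : IsGLB (omegaValues m h) Ωi) : Ωi ≤ 1 := by
  set x := stereo true 0 with hx
  have hm := H.differentiable_m true 0
  have hh := fun I => H.differentiable_h true 0 I I
  have hnorm : ∀ I, inner ℝ (frame true 0 I) (frame true 0 I) = (4 : ℝ) := by
    intro I
    have := roundMetric_apply true 0 I I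
    simpa [roundMetric] using this
  -- Two orthogonal directions of squared length 4 at one point suffice; 1/8 is ½ · ¼. Their average
  -- removes h by the trace condition.
  have hval : ∀ u I, Ωi ≤ 1 - 1 / 8 * deriv (fun t => h t x (frame true 0 I) (frame true 0 I)) u
      + 1 / 2 * deriv (fun t => m t x) u := by
    intro u I
    refine hΩ.1 ⟨u, x, frame true 0 I, norm_stereo true 0, ?_, ?_, ?_⟩
    · rw [hx, inner_E3, frame, fderiv_stereo_apply]
      fin_cases I <;> simp [stereo_apply_zero, stereo_apply_one, stereo_apply_two]
    · intro h0
      have := hnorm I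
      rw [h0, inner_zero_left] at this
      norm_num at this
    · rw [inDirection, ← real_inner_self_eq_norm_sq, omegaTensor, hnorm]
      ring
  have hderiv : ∀ u, 2 * (Ωi - 1) ≤ deriv (fun t => m t x) u := by
    intro u
    have h1 : deriv (fun t => h t x (frame true 0 0) (frame true 0 0)) u
        + deriv (fun t => h t x (frame true 0 1) (frame true 0 1)) u = 0 := by
      rw [← deriv_fun_add (hh 0 u) (hh 1 u)]
      simp only [trace_h_eq_zero H hg hC]
      exact deriv_const u 0
    linarith [hval u 0, hval u 1]
  by_contra! hlt
  have hbound : ∀ u, |m u x| ≤ C := by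
    intro u
    have := (H.m_bound true (quad u (R + 1) 0) (by simp [quad]) (by simp [quad])).1
    simpa only [quad_zero, ang_quad, pow_zero, div_one] using this
  -- Over a u-interval of this length m would grow by 2(C + 1), but |m| ≤ C permits only 2C.
  set N := (C + 1) / (Ωi - 1) with hN
  have hNpos : 0 < N := div_pos (by linarith) (by linarith)
  have h1 := mul_sub_le_image_sub_of_le_deriv hm hderiv hNpos.le
  have h2 : 2 * (Ωi - 1) * (N - 0) = 2 * (C + 1) := by
    rw [hN]
    have : Ωi - 1 ≠ 0 := by linarith
    field_simp
    ring
  have h3 := abs_le.1 (hbound N)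
  have h4 := abs_le.1 (hbound 0)
  linarith [h3.2, h4.1]

/-- The worst case Ωi = 1 gives −1 + 1/√3 ≈ −0.423. This is the source of the threshold 0.57 for the
initial slope. -/
lemma IsBetaCrit.lower_bound {Ωi β : ℝ} (hβ : IsBetaCrit Ωi β) (hΩ : Ωi ≤ 1) : -0.43 ≤ β := by
  rcases lt_or_ge 0 Ωi with h0 | h0
  · rw [hβ.1 h0]
    have : (1.71 : ℝ) ≤ √(9 - 6 * Ωi) := Real.le_sqrt_of_sq_le (by norm_num; linarith)
    linarith
  · linarith [hβ.2 h0]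

end

/-- A geodesic that is far out and does not move inwards too fast reaches null infinity. -/
theorem exists_reachesNullInfinity (R : ℝ) {C : ℝ} (hC : 1 ≤ C) :
    ∃ rmin : ℝ, ∀ (g : BondiMetric) (m : ℝ → E3 → ℝ) (h : ℝ → E3 → E3 →L[ℝ] E3 →L[ℝ] ℝ),
      AsymptoticallyFlat R C g m h → ∀ (c : Curve) (J : Set ℝ), IsNullGeodesic R g c J →
      FutureInextendible R g c J → 0 ∈ J → rmin ≤ c.r 0 → 0 < deriv c.u 0 →
      0.57 ≤ 1 + deriv c.r 0 / deriv c.u 0 → ReachesNullInfinity c J := by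
  obtain ⟨r₂, hRr, hall⟩ := exists_almostStraight R hC
  refine ⟨Real.exp 6 * r₂ + 1, ?_⟩
  intro g m h H c J hc hext h0 hr hp hq
  obtain ⟨S, hx⟩ := hall g m h H c J hc h0
  have hr0 : Real.exp 6 * r₂ < c.r 0 := by linarith
  have hgood := S.good hr0 hp hq
  refine ⟨?_, ?_⟩
  · obtain ⟨B, hB⟩ := S.u_bounds hr0 hp hq
    refine ⟨max |c.u 0| |B|, fun t ht h0t => ?_⟩
    exact abs_le_max_abs_abs (hB t ht h0t).1 (hB t ht h0t).2
  · by_contra! hcon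
    obtain ⟨M, hM⟩ := hcon
    -- If r does not tend to infinity, it is below some M at arbitrarily late times; as it loses at
    -- most a factor e⁶ on the way, it never exceeded e⁶ M.
    have hbdd : ∀ t ∈ J, 0 ≤ t → c.r t ≤ Real.exp 6 * M := by
      intro t ht h0t
      obtain ⟨t', ht', htt', hlt⟩ := hM t ht
      have h1 := S.r_lower hr0 hp hq ht h0t ht' htt'
      rw [Real.exp_neg, inv_mul_le_iff₀ (Real.exp_pos 6)] at h1
      exact h1.trans (mul_le_mul_of_nonneg_left hlt.le (Real.exp_pos 6).le)
    obtain ⟨hJb, B, hB⟩ := S.bounded_of_r_bounded hr0 hp hq hbdd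
    have hlt : ∀ t ∈ J, t < sSup J := by
      intro t ht
      obtain ⟨ε, hε, hball⟩ := Metric.isOpen_iff.1 hc.isOpen t ht
      have h1 : t + ε / 2 ∈ J := hball (by simp [abs_of_pos hε, hε])
      linarith [le_csSup hJb h1]
    have hIoo : Ioo 0 (sSup J) ⊆ J := by
      intro t ht
      obtain ⟨t', ht', htt'⟩ := exists_lt_of_lt_csSup ⟨0, h0⟩ ht.2
      exact hc.ordConnected.out h0 ht' ⟨ht.1.le, htt'.le⟩
    -- The constant comes from the angular bound 4 (p + p a) ≤ 8 B.
    refine hc.not_futureInextendible H (B := 8 * B) (hlt 0 h0) hIoo hlt hRr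
      (fun t ht => (hgood t (hIoo ht) ht.1.le).1.le) ?_ ?_ ?_ hext
    all_goals
      intro t ht
      obtain ⟨g1, g2, g3⟩ := hgood t (hIoo ht) ht.1.le
      obtain ⟨b1, b2⟩ := hB t (hIoo ht) ht.1.le
    · rw [abs_of_pos g2]
      linarith
    · have e : deriv c.u t * (1 + deriv c.r t / deriv c.u t) = deriv c.u t + deriv c.r t := by
        field_simp
      have h1 : 0 < deriv c.u t * (1 + deriv c.r t / deriv c.u t) := mul_pos g2 (by linarith)
      rw [e] at b2 h1
      rw [abs_le]
      constructor <;> linarith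
    · refine (hx t (hIoo ht) g1.le g2 g3.le).trans ?_
      linarith

end

end NullAccess

end

theorem proposition2 (R C K Ωi β : ℝ) (hR : 0 < R) (hβ : NullAccess.IsBetaCrit Ωi β) :
    ∃ rmin : ℝ, ∀ (g : NullAccess.BondiMetric) (m : ℝ → NullAccess.E3 → ℝ)
      (h : ℝ → NullAccess.E3 → NullAccess.E3 →L[ℝ] NullAccess.E3 →L[ℝ] ℝ),
      NullAccess.AsymptoticallyFlat R C g m h →
      NullAccess.BondiGauge R g →
      IsGLB (NullAccess.omegaValues m h) Ωi →
      ∀ (c : NullAccess.Curve) (J : Set ℝ),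
        NullAccess.IsNullGeodesic R g c J →
        NullAccess.FutureInextendible R g c J →
        (0 : ℝ) ∈ J →
        rmin ≤ c.r 0 →
        -- future-directed at `p`, and not along `u = const`, so that `dr/du` makes sense
        0 < deriv c.u 0 →
        0 < (deriv c.r 0 / deriv c.u 0 - β)⁻¹ →
        (deriv c.r 0 / deriv c.u 0 - β)⁻¹ ≤ K →
        NullAccess.ReachesNullInfinity c J := by
  obtain ⟨rmin, hmin⟩ := NullAccess.exists_reachesNullInfinity R (le_max_right C 1)
  refine ⟨rmin, fun g m h H hg hΩ c J hc hext h0 hr hp hβ' _ => ?_⟩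
  have H' := H.mono hR.le (le_max_left C 1)
  have h1 := NullAccess.omega_inf_le_one H' hg (le_max_right C 1) hΩ
  have h2 := hβ.lower_bound h1
  have h3 := inv_pos.1 hβ'
  -- A positive reciprocal means dr/du > β ≥ −0.43, hence 1 + dr/du > 0.57.
  exact hmin g m h H' c J hc hext h0 hr hp (by linarith)
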